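/- Let $k\ge 2$ be a standard natural number. Work in second order arithmetic; $\omega$ denotes the set of all numbers of the (possibly nonstandard) model, and numbers code finite sequences. Let $(\omega)^k$ be the class of surjective functions $p:\omega\to k$ that are ordered, i.e. if $p(n)=i$ then each $j<i$ equals $p(m)$ for some $m<n$; let $(\omega)^k_{\mathrm{fin}}$ be the set of ordered finite sequences over $k$ in which every $i<k$ appears, and let $\tau_0,\tau_1,\dots$ be an enumeration of $(\omega)^k_{\mathrm{fin}}$ (such an enumeration exists provably in $\mathsf{RCA}_0$; the result holds for each one). Write $\sigma\prec p$ if $\sigma$ is an initial segment of $p$. A code for an open set is a set $O\subseteq\omega\times(\omega)^k_{\mathrm{fin}}$, and $p\in O$ means $\sigma\prec p$ for some $\langle n,\sigma\rangle\in O$; sequences of open sets are coded by subsets of $\omega\times\omega\times(\omega)^k_{\mathrm{fin}}$. $O$ is dense if for every $\tau\in(\omega)^k_{\mathrm{fin}}$ there is $\langle n,\sigma\rangle\in O$ with $\sigma$ and $\tau$ comparable. A Borel code (for a subset of $(\omega)^k$) is a tree $B\subseteq\omega^{<\omega}$ with no infinite path such that there is exactly one $m_B$ with $\langle m_B\rangle\in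 B$. An evaluation map for $B$ at $p\in(\omega)^k$ is a function $f:B\to\{0,1\}$ such that, for each $\sigma\in B$ other than the empty sequence $\lambda$, with last entry $a$: if $\sigma$ is a leaf, then $f(\sigma)=1$ iff $a=1$, or $a=2m+2$ and $\tau_m\prec p$, or $a=2m+3$ and $\tau_m\not\prec p$, for some $m$; if $\sigma$ is not a leaf and $a$ is even, then $f(\sigma)=1$ iff $f(\sigma^\smallfrown m)=1$ for some $\sigma^\smallfrown m\in B$; if $\sigma$ is not a leaf and $a$ is odd, then $f(\sigma)=1$ iff $f(\sigma^\smallfrown m)=1$ for all $\sigma^\smallfrown m\in B$; and $f(\lambda)=f(\langle m_B\rangle)$. Write $p\in B$ (respectively $p\notin B$) if there is an evaluation map $f$ for $B$ at $p$ with $f(\lambda)=1$ (respectively $f(\lambda)=0$). A Baire code for $B$ consists of open sets $U,V$ and a sequence $\langle D_n:n\in\omega\rangle$ of dense open sets such that $U\cup V$ is dense and, for every $x\in(\omega)^k$ with $x\in\bigcap_n D_n$: if $x\in U$ then $x\in B$, and if $x\in V$ then $x\notin B$. Theorem. Over $\mathsf{RCA}_0$ (that is, in every model of $\mathsf{RCA}_0$,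 not only in $\omega$-models) the following are equivalent. 1. $\mathsf{ATR}_0$. 2. For every Borel code $B$ for a subset of $(\omega)^k$ there is an $x\in(\omega)^k$ such that $x\in B$ or $x\notin B$. 3. Every Borel code $B$ for a subset of $(\omega)^k$ has a Baire code. -/

import Mathlib

/-!
Second order arithmetic, its subsystems `RCA₀` and `ATR₀`, and Borel and Baire codes for subsets of
the space `(ω)^k` of partitions of `ω` into `k` blocks.

Provability over `RCA₀` is expressed through all (Henkin) models of `RCA₀`: the first order part is
an arbitrary, possibly nonstandard structure, and the set variables range over an arbitrary family
of subsets of it.  Every notion below is the interpretation in such a model of the corresponding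
notion of second order arithmetic: number quantifiers range over `M.Num`, set quantifiers over
`M.Sets`, and finite sequences are the ones coded by elements of `M.Num`.
-/

universe u

/-- A structure for the language of second order arithmetic. -/
structure L2Structure where
  /-- the range of the number variables -/
  Num : Type u
  [instZero : Zero Num]
  [instOne : One Num]
  [instAdd : Add Num]
  [instMul : Mul Num]
  [instLT : LT Num]
  /-- the range of the set variables -/
  Sets : Set (Set Num)
  sets_nonempty : Sets.Nonempty

attribute [instance] L2Structure.instZero L2Structure.instOne L2Structure.instAdd
  L2Structure.instMul L2Structure.instLT

/-! ### Arithmetical formulas -/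

/-- Numerical terms; number variables are de Bruijn indices. -/
inductive ATerm : Type
  | var (i : ℕ)
  | zero
  | one
  | add (s t : ATerm)
  | mul (s t : ATerm)

/-- Arithmetical formulas: free set variables are allowed (`mem t X` says that `t` belongs to the
`X`-th set variable), set quantifiers are not.  Each quantifier binds the number variable `0`; the
bounding term of `allLt` and `exLt` is read outside of the quantifier. -/
inductive AFormula : Type
  | eq (s t : ATerm)
  | lt (s t : ATerm)
  | mem (t : ATerm) (X : ℕ)
  | neg (φ : AFormula)
  | and (φ ψ : AFormula)
  | or (φ ψ : AFormula)
  | imp (φ ψ : AFormula)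
  | allLt (t : ATerm) (φ : AFormula)
  | exLt (t : ATerm) (φ : AFormula)
  | all (φ : AFormula)
  | ex (φ : AFormula)

/-- The assignment that sends the variable `0` to `x` and the variable `n + 1` to `e n`. -/
def pushVar {α : Type u} (x : α) (e : ℕ → α) : ℕ → α
  | 0 => x
  | n + 1 => e n

namespace AFormula

/-- All quantifiers are bounded. -/
def IsDelta0 : AFormula → Prop
  | eq _ _ => True
  | lt _ _ => True
  | mem _ _ => True
  | neg φ => φ.IsDelta0
  | and φ ψ => φ.IsDelta0 ∧ ψ.IsDelta0
  | or φ ψ => φ.IsDelta0 ∧ ψ.IsDelta0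
  | imp φ ψ => φ.IsDelta0 ∧ ψ.IsDelta0
  | allLt _ φ => φ.IsDelta0
  | exLt _ φ => φ.IsDelta0
  | all _ => False
  | ex _ => False

/-- `Σ⁰₁` formulas: `∃ n, θ` with `θ` bounded. -/
def IsSigma1 (φ : AFormula) : Prop := ∃ θ : AFormula, θ.IsDelta0 ∧ φ = ex θ

/-- `Π⁰₁` formulas: `∀ n, θ` with `θ` bounded. -/
def IsPi1 (φ : AFormula) : Prop := ∃ θ : AFormula, θ.IsDelta0 ∧ φ = all θ

end AFormula

namespace L2Structure

variable (M : L2Structure.{u})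

/-- The value of a term under the assignment `e`. -/
def termVal (e : ℕ → M.Num) : ATerm → M.Num
  | .var i => e i
  | .zero => 0
  | .one => 1
  | .add s t => termVal e s + termVal e t
  | .mul s t => termVal e s * termVal e t

/-- Satisfaction of an arithmetical formula under the assignments `e` of the number variables and
`E` of the set variables. -/
def Sat : AFormula → (ℕ → M.Num) → (ℕ → Set M.Num) → Prop
  | .eq s t, e, _ => M.termVal e s = M.termVal e t
  | .lt s t, e, _ => M.termVal e s < M.termVal e t
  | .mem t X, e, E => M.termVal e t ∈ E X
  | .neg φ, e, E => ¬ Sat φ e E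
  | .and φ ψ, e, E => Sat φ e E ∧ Sat ψ e E
  | .or φ ψ, e, E => Sat φ e E ∨ Sat ψ e E
  | .imp φ ψ, e, E => Sat φ e E → Sat ψ e E
  | .allLt t φ, e, E => ∀ x, x < M.termVal e t → Sat φ (pushVar x e) E
  | .exLt t φ, e, E => ∃ x, x < M.termVal e t ∧ Sat φ (pushVar x e) E
  | .all φ, e, E => ∀ x, Sat φ (pushVar x e) E
  | .ex φ, e, E => ∃ x, Sat φ (pushVar x e) E

/-! ### `RCA₀` and `ACA₀` -/

/-- The basic axioms of second order arithmetic. -/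
structure BasicAxioms : Prop where
  succ_ne_zero : ∀ n : M.Num, n + 1 ≠ 0
  succ_inj : ∀ m n : M.Num, m + 1 = n + 1 → m = n
  add_zero : ∀ m : M.Num, m + 0 = m
  add_succ : ∀ m n : M.Num, m + (n + 1) = (m + n) + 1
  mul_zero : ∀ m : M.Num, m * 0 = 0
  mul_succ : ∀ m n : M.Num, m * (n + 1) = m * n + m
  not_lt_zero : ∀ m : M.Num, ¬ m < 0
  lt_succ_iff : ∀ m n : M.Num, m < n + 1 ↔ m < n ∨ m = n

/-- The scheme of `Σ⁰₁` induction, with number and set parameters. -/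
def Sigma1Induction : Prop :=
  ∀ φ : AFormula, φ.IsSigma1 →
    ∀ (e : ℕ → M.Num) (E : ℕ → Set M.Num), (∀ i, E i ∈ M.Sets) →
      M.Sat φ (pushVar 0 e) E →
      (∀ n, M.Sat φ (pushVar n e) E → M.Sat φ (pushVar (n + 1) e) E) →
      ∀ n, M.Sat φ (pushVar n e) E

/-- The scheme of `Δ⁰₁` (recursive) comprehension, with number and set parameters. -/
def Delta1Comprehension : Prop :=
  ∀ φ ψ : AFormula, φ.IsSigma1 → ψ.IsPi1 →
    ∀ (e : ℕ → M.Num) (E : ℕ → Set M.Num), (∀ i, E i ∈ M.Sets) →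
      (∀ n, M.Sat φ (pushVar n e) E ↔ M.Sat ψ (pushVar n e) E) →
      ∃ X ∈ M.Sets, ∀ n, n ∈ X ↔ M.Sat φ (pushVar n e) E

/-- `M` is a model of `RCA₀`. -/
structure RCA0 : Prop where
  basic : M.BasicAxioms
  sigma1_induction : M.Sigma1Induction
  delta1_comprehension : M.Delta1Comprehension

/-- The scheme of arithmetical comprehension, with number and set parameters. -/
def ArithmeticalComprehension : Prop :=
  ∀ φ : AFormula, ∀ (e : ℕ → M.Num) (E : ℕ → Set M.Num), (∀ i, E i ∈ M.Sets) →
    ∃ X ∈ M.Sets, ∀ n, n ∈ X ↔ M.Sat φ (pushVar n e) E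

/-- `M` is a model of `ACA₀`. -/
structure ACA0 : Prop where
  rca0 : M.RCA0
  arithmetical_comprehension : M.ArithmeticalComprehension

variable {M}

/-! ### Pairs, functions, well orders and `ATR₀` -/

/-- The code `(i + j)² + i` of the ordered pair of `i` and `j`. -/
def pair (i j : M.Num) : M.Num := (i + j) * (i + j) + i

/-- The set `F` of codes of pairs is (the graph of) a function from `A` to `B`. -/
def IsFun (F A B : Set M.Num) : Prop :=
  (∀ z ∈ F, ∃ a ∈ A, ∃ b ∈ B, z = pair a b) ∧ ∀ a ∈ A, ∃! b, pair a b ∈ F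

/-- `i ≤_X j`, where `X` is a set of codes of pairs. -/
def relLE (X : Set M.Num) (i j : M.Num) : Prop := pair i j ∈ X

/-- `i <_X j`. -/
def relLT (X : Set M.Num) (i j : M.Num) : Prop := relLE X i j ∧ ¬ relLE X j i

/-- The field of the reflexive relation coded by `X`. -/
def field (X : Set M.Num) : Set M.Num := {i | relLE X i i}

/-- `X` codes a (reflexive) linear order of its field. -/
structure IsLO (X : Set M.Num) : Prop where
  refl : ∀ i j, relLE X i j → i ∈ field X ∧ j ∈ field X
  trans : ∀ i j k, relLE X i j → relLE X j k → relLE X i k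
  antisymm : ∀ i j, relLE X i j → relLE X j i → i = j
  total : ∀ i ∈ field X, ∀ j ∈ field X, relLE X i j ∨ relLE X j i

/-- `X` codes a well order in the sense of `M`: a linear order such that no function of `M` is an
infinite descending sequence. -/
def IsWO (X : Set M.Num) : Prop :=
  IsLO X ∧ ¬ ∃ f ∈ M.Sets, IsFun f Set.univ (field X) ∧
    ∀ n a b, pair n a ∈ f → pair (n + 1) b ∈ f → relLT X b a

/-- `Y^j = {⟨m, a⟩ ∈ Y : a <_X j}`. -/
def below (X Y : Set M.Num) (j : M.Num) : Set M.Num :=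
  {z | ∃ m a, z = pair m a ∧ relLT X a j ∧ pair m a ∈ Y}

/-- `H_θ(X, Y)`: `X` is a linear order and `Y = {⟨n, j⟩ : j ∈ field(X) ∧ θ(n, Y^j)}`.  In `θ`, the
number variable `0` stands for `n`, the set variable `0` for `Y^j`, and all the others are
parameters. -/
def IsHierarchy (θ : AFormula) (e : ℕ → M.Num) (E : ℕ → Set M.Num) (X Y : Set M.Num) : Prop :=
  IsLO X ∧ ∀ z, z ∈ Y ↔
    ∃ n j, z = pair n j ∧ j ∈ field X ∧ M.Sat θ (pushVar n e) (pushVar (below X Y j) E)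

variable (M)

/-- The scheme of arithmetical transfinite recursion, with number and set parameters. -/
def ArithmeticalTransfiniteRecursion : Prop :=
  ∀ θ : AFormula, ∀ (e : ℕ → M.Num) (E : ℕ → Set M.Num), (∀ i, E i ∈ M.Sets) →
    ∀ X ∈ M.Sets, IsWO X → ∃ Y ∈ M.Sets, IsHierarchy θ e E X Y

/-- `M` is a model of `ATR₀`. -/
structure ATR0 : Prop where
  aca0 : M.ACA0
  transfinite_recursion : M.ArithmeticalTransfiniteRecursion

/-- The standard numerals. -/
def num : ℕ → M.Num
  | 0 => 0
  | n + 1 => num n + 1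

variable {M}

/-! ### Codes of finite sequences -/

/-- `a` divides `b`. -/
def Divides (a b : M.Num) : Prop := ∃ q, b = a * q

/-- `i` belongs to the finite set `{i < k : m(i + 1) + 1 divides n}` presented by the triple
`c = ⟨k, ⟨m, n⟩⟩`. -/
def FinMem (i c : M.Num) : Prop :=
  ∃ k m n, c = pair k (pair m n) ∧ i < k ∧ Divides (m * (i + 1) + 1) n

/-- `c` is a triple. -/
def IsTriple (c : M.Num) : Prop := ∃ k m n : M.Num, c = pair k (pair m n)

/-- `c` is the code of a finite set: the least triple that presents it. -/
def IsFinCode (c : M.Num) : Prop :=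
  IsTriple c ∧ ∀ c', c' < c → IsTriple c' → ¬ ∀ i, FinMem i c' ↔ FinMem i c

/-- The entry of the finite sequence `σ` at the place `i` is `x`. -/
def Entry (σ i x : M.Num) : Prop := FinMem (pair i x) σ

/-- `σ` is the code of a finite sequence of length `l`, that is, of a finite set of pairs that is
a function with domain `{i : i < l}`. -/
def IsSeqLen (σ l : M.Num) : Prop :=
  IsFinCode σ ∧ (∀ z, FinMem z σ → ∃ i x, i < l ∧ z = pair i x) ∧ ∀ i, i < l → ∃! x, Entry σ i x

/-- `σ` is an initial segment of the finite sequence `τ` (possibly `τ` itself). -/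
def InitSeg (σ τ : M.Num) : Prop :=
  ∃ l l', IsSeqLen σ l ∧ IsSeqLen τ l' ∧ (l < l' ∨ l = l') ∧
    ∀ i, i < l → ∀ x, Entry σ i x ↔ Entry τ i x

/-- `σ'` is the extension of the finite sequence `σ` by the single entry `m`. -/
def IsSnoc (σ m σ' : M.Num) : Prop :=
  ∃ l, IsSeqLen σ l ∧ IsSeqLen σ' (l + 1) ∧ (∀ i, i < l → ∀ x, Entry σ i x ↔ Entry σ' i x) ∧
    Entry σ' l m

/-- `σ` is the sequence `⟨m⟩` of length one. -/
def IsSingleton (σ m : M.Num) : Prop := IsSeqLen σ 1 ∧ Entry σ 0 m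

/-- `a` is the last entry of the nonempty finite sequence `σ`. -/
def IsLast (σ a : M.Num) : Prop := ∃ n, IsSeqLen σ (n + 1) ∧ Entry σ n a

/-- `σ` is the restriction of the function `p` to `{i : i < l}`. -/
def IsRestriction (p : Set M.Num) (l σ : M.Num) : Prop :=
  IsSeqLen σ l ∧ ∀ i, i < l → ∀ x, Entry σ i x ↔ pair i x ∈ p

/-- `σ ≺ p`: the finite sequence `σ` is an initial segment of the function `p`. -/
def PrecFun (σ : M.Num) (p : Set M.Num) : Prop := ∃ l, IsRestriction p l σ

/-! ### The space `(ω)^k` and its open sets -/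

variable (M)

/-- `(ω)^k`: the ordered surjective functions of `M` from the natural numbers to `k`. -/
def Partition (k : ℕ) : Set (Set M.Num) :=
  {p | p ∈ M.Sets ∧ IsFun p Set.univ {i | i < M.num k} ∧
    (∀ n i, pair n i ∈ p → ∀ j, j < i → ∃ m, m < n ∧ pair m j ∈ p) ∧
    ∀ i, i < M.num k → ∃ n, pair n i ∈ p}

/-- `(ω)^k_fin`: the (codes of) ordered finite sequences of numbers below `k` in which all numbers
below `k` appear. -/
def FinPartition (k : ℕ) : Set M.Num :=
  {σ | ∃ l, IsSeqLen σ l ∧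
    (∀ n i, n < l → Entry σ n i → i < M.num k) ∧
    (∀ n i, n < l → Entry σ n i → ∀ j, j < i → ∃ m, m < n ∧ Entry σ m j) ∧
    ∀ i, i < M.num k → ∃ n, n < l ∧ Entry σ n i}

/-- `τ` is a function of `M` that enumerates `(ω)^k_fin` as `τ_0, τ_1, …`. -/
def IsEnumeration (k : ℕ) (τ : Set M.Num) : Prop :=
  τ ∈ M.Sets ∧ IsFun τ Set.univ (M.FinPartition k) ∧
    ∀ σ ∈ M.FinPartition k, ∃ m, pair m σ ∈ τ

/-- `O` is a code for an open set in `(ω)^k`. -/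
def IsOpenCode (k : ℕ) (O : Set M.Num) : Prop :=
  O ∈ M.Sets ∧ ∀ z ∈ O, ∃ n, ∃ σ ∈ M.FinPartition k, z = pair n σ

/-- `D` is a code for a sequence of open sets in `(ω)^k`. -/
def IsOpenSeqCode (k : ℕ) (D : Set M.Num) : Prop :=
  D ∈ M.Sets ∧ ∀ z ∈ D, ∃ i n, ∃ σ ∈ M.FinPartition k, z = pair i (pair n σ)

variable {M}

/-- The partition `p` is in the open set coded by `O`. -/
def MemOpen (p O : Set M.Num) : Prop := ∃ n σ, pair n σ ∈ O ∧ PrecFun σ p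

/-- The code of the `i`-th open set of the sequence coded by `D`. -/
def openSlice (D : Set M.Num) (i : M.Num) : Set M.Num :=
  {z | ∃ n σ, z = pair n σ ∧ pair i (pair n σ) ∈ D}

/-- The finite sequences `σ` and `τ` are comparable. -/
def Comparable (σ τ : M.Num) : Prop := InitSeg σ τ ∨ InitSeg τ σ

/-- The open set coded by `O` is dense in `(ω)^k`.  (The union of two open codes is a code for the
union of the open sets.) -/
def IsDenseOpen (k : ℕ) (O : Set M.Num) : Prop :=
  ∀ τ ∈ M.FinPartition k, ∃ n σ, pair n σ ∈ O ∧ Comparable σ τ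

/-! ### Borel codes -/

/-- `T` is a tree: a set of finite sequences closed under initial segments. -/
def IsTree (T : Set M.Num) : Prop :=
  (∀ σ ∈ T, ∃ l, IsSeqLen σ l) ∧ ∀ σ ∈ T, ∀ ρ, InitSeg ρ σ → ρ ∈ T

variable (M)

/-- `B` is a Borel code: a tree of `M` without an infinite path in `M`, such that there is exactly
one `m` with `⟨m⟩ ∈ B`. -/
structure IsBorelCode (B : Set M.Num) : Prop where
  mem_sets : B ∈ M.Sets
  tree : IsTree B
  no_path : ¬ ∃ g ∈ M.Sets, IsFun g Set.univ Set.univ ∧ ∀ n, ∃ σ ∈ B, IsRestriction g n σ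
  root : ∃! m, ∃ σ ∈ B, IsSingleton σ m

variable {M}

/-- `σ` is a leaf of the tree `B`. -/
def IsLeaf (B : Set M.Num) (σ : M.Num) : Prop := σ ∈ B ∧ ¬ ∃ m, ∃ σ' ∈ B, IsSnoc σ m σ'

/-- The clopen set coded by the label `a` of a leaf contains `p`: the labels `0`, `1`, `2m + 2` and
`2m + 3` stand for `∅`, `(ω)^k`, `[τ_m]` and the complement of `[τ_m]`. -/
def LeafHolds (τ p : Set M.Num) (a : M.Num) : Prop :=
  a = 1 ∨ ∃ m t, pair m t ∈ τ ∧
    ((a = M.num 2 * m + M.num 2 ∧ PrecFun t p) ∨ (a = M.num 2 * m + M.num 3 ∧ ¬ PrecFun t p))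

variable (M)

/-- `f` is an evaluation map for the Borel code `B` at `p ∈ (ω)^k` (with respect to the enumeration
`τ` of `(ω)^k_fin`): a function `f : B → {0, 1}` of `M` that takes the right values at the leaves
and respects unions (last entry even) and intersections (last entry odd) at the interior nodes. -/
structure IsEvaluation (τ B p f : Set M.Num) : Prop where
  mem_sets : f ∈ M.Sets
  isFun : IsFun f B {0, 1}
  leaf : ∀ σ a, IsLeaf B σ → IsLast σ a → (pair σ 1 ∈ f ↔ LeafHolds τ p a)
  union : ∀ σ a, σ ∈ B → ¬ IsLeaf B σ → IsLast σ a → (∃ c, a = M.num 2 * c) →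
    (pair σ 1 ∈ f ↔ ∃ m, ∃ σ' ∈ B, IsSnoc σ m σ' ∧ pair σ' 1 ∈ f)
  inter : ∀ σ a, σ ∈ B → ¬ IsLeaf B σ → IsLast σ a → (∃ c, a = M.num 2 * c + 1) →
    (pair σ 1 ∈ f ↔ ∀ m, ∀ σ' ∈ B, IsSnoc σ m σ' → pair σ' 1 ∈ f)
  root : ∀ σ ρ m, IsSeqLen σ 0 → ρ ∈ B → IsSingleton ρ m → (pair σ 1 ∈ f ↔ pair ρ 1 ∈ f)

/-- `p ∈ B`: there is an evaluation map for `B` at `p` with value `1` at the empty sequence. -/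
def MemBorel (τ B p : Set M.Num) : Prop :=
  ∃ f, M.IsEvaluation τ B p f ∧ ∃ σ, IsSeqLen σ 0 ∧ pair σ 1 ∈ f

/-- `p ∉ B`: there is an evaluation map for `B` at `p` with value `0` at the empty sequence. -/
def NotMemBorel (τ B p : Set M.Num) : Prop :=
  ∃ f, M.IsEvaluation τ B p f ∧ ∃ σ, IsSeqLen σ 0 ∧ pair σ 0 ∈ f

/-- The open sets `U`, `V` and the sequence `D` of dense open sets form a Baire code for `B`. -/
structure IsBaireCode (k : ℕ) (τ B U V D : Set M.Num) : Prop where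
  openU : M.IsOpenCode k U
  openV : M.IsOpenCode k V
  openD : M.IsOpenSeqCode k D
  denseD : ∀ n, IsDenseOpen k (openSlice D n)
  denseUV : IsDenseOpen k (U ∪ V)
  mem_of_mem : ∀ x ∈ M.Partition k, (∀ n, MemOpen x (openSlice D n)) →
    MemOpen x U → M.MemBorel τ B x
  not_mem_of_mem : ∀ x ∈ M.Partition k, (∀ n, MemOpen x (openSlice D n)) →
    MemOpen x V → M.NotMemBorel τ B x

/-- For every Borel code `B` for a subset of `(ω)^k`, there is an `x ∈ (ω)^k` such that `x ∈ B` or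
`x ∉ B`. -/
def BorelCodesHaveEvaluatedPoint (k : ℕ) (τ : Set M.Num) : Prop :=
  ∀ B, M.IsBorelCode B → ∃ x ∈ M.Partition k, M.MemBorel τ B x ∨ M.NotMemBorel τ B x

/-- Every Borel code for a subset of `(ω)^k` has a Baire code. -/
def BorelCodesHaveBaireCode (k : ℕ) (τ : Set M.Num) : Prop :=
  ∀ B, M.IsBorelCode B → ∃ U V D, M.IsBaireCode k τ B U V D

end L2Structure

namespace L2Structure

section Arithmetic

variable {M : L2Structure.{u}}

/-- `Δ⁰₀` induction, for a property presented by a formula with a dummy variable `0`. -/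
theorem RCA0.bounded_induction (hM : M.RCA0) (θ : AFormula) (hθ : θ.IsDelta0)
    (e : ℕ → M.Num) (P : M.Num → Prop)
    (h : ∀ E w n, M.Sat θ (pushVar w (pushVar n e)) E ↔ P n)
    (h0 : P 0) (hs : ∀ n, P n → P (n + 1)) (n : M.Num) : P n := by
  obtain ⟨S, hS⟩ := M.sets_nonempty
  have key := hM.sigma1_induction (.ex θ) ⟨θ, hθ, rfl⟩ e (fun _ => S) (fun _ => hS)
    ⟨0, (h _ _ _).2 h0⟩ (fun n ⟨w, hw⟩ => ⟨0, (h _ _ _).2 (hs n ((h _ _ _).1 hw))⟩) n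
  obtain ⟨w, hw⟩ := key
  exact (h _ _ _).1 hw

namespace BasicInduction

variable (hM : M.RCA0)
include hM

theorem zero_add (n : M.Num) : 0 + n = n := by
  refine hM.bounded_induction (.eq (.add .zero (.var 1)) (.var 1)) trivial (fun _ => 0)
    (fun n => 0 + n = n) (fun _ _ _ => Iff.rfl) (hM.basic.add_zero 0) (fun n ih => ?_) n
  rw [hM.basic.add_succ, ih]

theorem succ_add (m n : M.Num) : m + 1 + n = m + n + 1 := by
  refine hM.bounded_induction (.eq (.add (.add (.var 2) .one) (.var 1))
    (.add (.add (.var 2) (.var 1)) .one)) trivial (fun _ => m)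
    (fun n => m + 1 + n = m + n + 1) (fun _ _ _ => Iff.rfl) ?_ (fun n ih => ?_) n
  · rw [hM.basic.add_zero, hM.basic.add_zero]
  · rw [hM.basic.add_succ, ih, hM.basic.add_succ]

theorem add_comm (m n : M.Num) : m + n = n + m := by
  refine hM.bounded_induction (.eq (.add (.var 2) (.var 1)) (.add (.var 1) (.var 2)))
    trivial (fun _ => m) (fun n => m + n = n + m) (fun _ _ _ => Iff.rfl) ?_ (fun n ih => ?_) n
  · rw [hM.basic.add_zero, zero_add hM]
  · rw [hM.basic.add_succ, ih, succ_add hM]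

theorem add_assoc (a b n : M.Num) : a + b + n = a + (b + n) := by
  refine hM.bounded_induction (.eq (.add (.add (.var 2) (.var 3)) (.var 1))
    (.add (.var 2) (.add (.var 3) (.var 1)))) trivial (pushVar a (fun _ => b))
    (fun n => a + b + n = a + (b + n)) (fun _ _ _ => Iff.rfl) ?_ (fun n ih => ?_) n
  · rw [hM.basic.add_zero, hM.basic.add_zero]
  · rw [hM.basic.add_succ, ih, hM.basic.add_succ, hM.basic.add_succ]

theorem zero_mul (n : M.Num) : 0 * n = 0 := by
  refine hM.bounded_induction (.eq (.mul .zero (.var 1)) .zero) trivial (fun _ => 0)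
    (fun n => 0 * n = 0) (fun _ _ _ => Iff.rfl) (hM.basic.mul_zero 0) (fun n ih => ?_) n
  rw [hM.basic.mul_succ, ih, hM.basic.add_zero]

theorem succ_mul (m n : M.Num) : (m + 1) * n = m * n + n := by
  refine hM.bounded_induction (.eq (.mul (.add (.var 2) .one) (.var 1))
    (.add (.mul (.var 2) (.var 1)) (.var 1))) trivial (fun _ => m)
    (fun n => (m + 1) * n = m * n + n) (fun _ _ _ => Iff.rfl) ?_ (fun n ih => ?_) n
  · rw [hM.basic.mul_zero, hM.basic.mul_zero, hM.basic.add_zero]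
  · rw [hM.basic.mul_succ, ih, hM.basic.mul_succ, hM.basic.add_succ, hM.basic.add_succ,
      add_assoc hM (m * n) n m, add_assoc hM (m * n) m n, add_comm hM n m]

theorem mul_comm (m n : M.Num) : m * n = n * m := by
  refine hM.bounded_induction (.eq (.mul (.var 2) (.var 1)) (.mul (.var 1) (.var 2)))
    trivial (fun _ => m) (fun n => m * n = n * m) (fun _ _ _ => Iff.rfl) ?_ (fun n ih => ?_) n
  · rw [hM.basic.mul_zero, zero_mul hM]
  · rw [hM.basic.mul_succ, ih, succ_mul hM]

theorem mul_add (a b n : M.Num) : a * (b + n) = a * b + a * n := by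
  refine hM.bounded_induction (.eq (.mul (.var 2) (.add (.var 3) (.var 1)))
    (.add (.mul (.var 2) (.var 3)) (.mul (.var 2) (.var 1)))) trivial (pushVar a (fun _ => b))
    (fun n => a * (b + n) = a * b + a * n) (fun _ _ _ => Iff.rfl) ?_ (fun n ih => ?_) n
  · rw [hM.basic.add_zero, hM.basic.mul_zero, hM.basic.add_zero]
  · rw [hM.basic.add_succ, hM.basic.mul_succ, ih, hM.basic.mul_succ, add_assoc hM]

theorem mul_assoc (a b n : M.Num) : a * b * n = a * (b * n) := by
  refine hM.bounded_induction (.eq (.mul (.mul (.var 2) (.var 3)) (.var 1))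
    (.mul (.var 2) (.mul (.var 3) (.var 1)))) trivial (pushVar a (fun _ => b))
    (fun n => a * b * n = a * (b * n)) (fun _ _ _ => Iff.rfl) ?_ (fun n ih => ?_) n
  · rw [hM.basic.mul_zero, hM.basic.mul_zero, hM.basic.mul_zero]
  · rw [hM.basic.mul_succ, ih, hM.basic.mul_succ, mul_add hM]

theorem add_right_cancel (a b n : M.Num) (h : a + n = b + n) : a = b := by
  revert h
  refine hM.bounded_induction (.imp (.eq (.add (.var 2) (.var 1)) (.add (.var 3) (.var 1)))
    (.eq (.var 2) (.var 3))) ⟨trivial, trivial⟩ (pushVar a (fun _ => b))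
    (fun n => a + n = b + n → a = b) (fun _ _ _ => Iff.rfl) ?_ (fun n ih h => ?_) n
  · rw [hM.basic.add_zero, hM.basic.add_zero]; exact id
  · rw [hM.basic.add_succ, hM.basic.add_succ] at h
    exact ih (hM.basic.succ_inj _ _ h)

theorem lt_add_succ (m d : M.Num) : m < m + d + 1 := by
  refine hM.bounded_induction (.lt (.var 2) (.add (.add (.var 2) (.var 1)) .one)) trivial
    (fun _ => m) (fun d => m < m + d + 1) (fun _ _ _ => Iff.rfl) ?_ (fun n ih => ?_) d
  · rw [hM.basic.add_zero]; exact (hM.basic.lt_succ_iff _ _).2 (Or.inr rfl)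
  · rw [hM.basic.add_succ]; exact (hM.basic.lt_succ_iff _ _).2 (Or.inl ih)

theorem exists_of_lt (m n : M.Num) (h : m < n) : ∃ d, m + d + 1 = n := by
  obtain ⟨S, hS⟩ := M.sets_nonempty
  have key := hM.sigma1_induction
    (.ex (.imp (.lt (.var 2) (.var 1)) (.eq (.add (.add (.var 2) (.var 0)) .one) (.var 1))))
    (by refine ⟨_, ?_, rfl⟩; exact ⟨trivial, trivial⟩) (fun _ => m) (fun _ => S) (fun _ => hS)
    ⟨0, fun h => absurd h (hM.basic.not_lt_zero _)⟩ ?_ n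
  · obtain ⟨d, hd⟩ := key
    exact ⟨d, hd h⟩
  · rintro n ⟨d, hd⟩
    by_cases h' : m < n
    · refine ⟨d + 1, fun _ => ?_⟩
      have h1 : m + d + 1 = n := hd h'
      change m + (d + 1) + 1 = n + 1
      rw [hM.basic.add_succ, h1]
    · refine ⟨0, fun h'' => ?_⟩
      have h1 : m = n := ((hM.basic.lt_succ_iff _ _).1 h'').resolve_left h'
      change m + 0 + 1 = n + 1
      rw [hM.basic.add_zero, h1]

theorem lt_iff (m n : M.Num) : m < n ↔ ∃ d, m + d + 1 = n :=
  ⟨exists_of_lt hM m n, fun ⟨d, hd⟩ => hd ▸ lt_add_succ hM m d⟩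

theorem eq_zero_or_succ (n : M.Num) : n = 0 ∨ 0 < n := by
  refine hM.bounded_induction (.or (.eq (.var 1) .zero) (.lt .zero (.var 1))) ⟨trivial, trivial⟩
    (fun _ => 0) (fun n => n = 0 ∨ 0 < n) (fun _ _ _ => Iff.rfl) (Or.inl rfl) (fun n ih => ?_) n
  exact Or.inr ((hM.basic.lt_succ_iff _ _).2 (ih.symm.imp id Eq.symm))

theorem trichotomy (m n : M.Num) : m < n ∨ m = n ∨ n < m := by
  refine hM.bounded_induction (.or (.lt (.var 2) (.var 1)) (.or (.eq (.var 2) (.var 1))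
    (.lt (.var 1) (.var 2)))) ⟨trivial, trivial, trivial⟩ (fun _ => m)
    (fun n => m < n ∨ m = n ∨ n < m) (fun _ _ _ => Iff.rfl) ?_ (fun n ih => ?_) n
  · exact (eq_zero_or_succ hM m).elim (fun h => Or.inr (Or.inl h)) (fun h => Or.inr (Or.inr h))
  · rcases ih with h | h | h
    · exact Or.inl ((hM.basic.lt_succ_iff _ _).2 (Or.inl h))
    · exact Or.inl ((hM.basic.lt_succ_iff _ _).2 (Or.inr h))
    · obtain ⟨d, rfl⟩ := exists_of_lt hM _ _ h
      rcases eq_zero_or_succ hM d with rfl | hd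
      · rw [hM.basic.add_zero]; exact Or.inr (Or.inl rfl)
      · obtain ⟨c, rfl⟩ := exists_of_lt hM _ _ hd
        refine Or.inr (Or.inr ((lt_iff hM _ _).2 ⟨c, ?_⟩))
        rw [zero_add hM, hM.basic.add_succ, succ_add hM]

theorem lt_trans (a b c : M.Num) (h : a < b) (h' : b < c) : a < c := by
  obtain ⟨d, rfl⟩ := exists_of_lt hM _ _ h
  obtain ⟨d', rfl⟩ := exists_of_lt hM _ _ h'
  refine (lt_iff hM _ _).2 ⟨d + 1 + d', ?_⟩
  rw [← add_assoc hM, hM.basic.add_succ]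

theorem lt_irrefl (a : M.Num) (h : a < a) : False := by
  obtain ⟨d, hd⟩ := exists_of_lt hM _ _ h
  rw [add_assoc hM, add_comm hM a] at hd
  have := add_right_cancel hM (d + 1) 0 a (hd.trans (zero_add hM a).symm)
  exact hM.basic.succ_ne_zero _ this

end BasicInduction

variable [hM : Fact M.RCA0]

open BasicInduction in
noncomputable instance : CommSemiring M.Num where
  add_assoc a b c := add_assoc hM.out a b c
  zero_add a := zero_add hM.out a
  add_zero a := hM.out.basic.add_zero a
  add_comm a b := add_comm hM.out a b
  nsmul := nsmulRec
  npow := npowRec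
  left_distrib a b c := mul_add hM.out a b c
  right_distrib a b c := by
    rw [mul_comm hM.out, mul_add hM.out, mul_comm hM.out c, mul_comm hM.out c]
  zero_mul a := zero_mul hM.out a
  mul_zero a := hM.out.basic.mul_zero a
  mul_assoc a b c := mul_assoc hM.out a b c
  one_mul a := by
    have := succ_mul hM.out 0 a
    rwa [zero_add hM.out, zero_mul hM.out, zero_add hM.out] at this
  mul_one a := by
    have := hM.out.basic.mul_succ a 0
    rwa [zero_add hM.out, hM.out.basic.mul_zero, zero_add hM.out] at this
  mul_comm a b := mul_comm hM.out a b

open BasicInduction in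
noncomputable instance : LinearOrder M.Num where
  le a b := a < b ∨ a = b
  lt a b := a < b
  le_refl a := Or.inr rfl
  le_trans a b c h h' := by
    rcases h with h | rfl
    · rcases h' with h' | rfl
      · exact Or.inl (lt_trans hM.out _ _ _ h h')
      · exact Or.inl h
    · exact h'
  lt_iff_le_not_ge a b := by
    constructor
    · intro h
      refine ⟨Or.inl h, ?_⟩
      rintro (h' | rfl)
      · exact lt_irrefl hM.out _ (lt_trans hM.out _ _ _ h h')
      · exact lt_irrefl hM.out _ h
    · rintro ⟨h | rfl, h'⟩
      · exact h
      · exact absurd (Or.inr rfl) h'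
  le_antisymm a b h h' := by
    rcases h with h | rfl
    · rcases h' with h' | rfl
      · exact (lt_irrefl hM.out _ (lt_trans hM.out _ _ _ h h')).elim
      · rfl
    · rfl
  le_total a b := by
    rcases trichotomy hM.out a b with h | h | h
    · exact Or.inl (Or.inl h)
    · exact Or.inl (Or.inr h)
    · exact Or.inr (Or.inl h)
  toDecidableLE := Classical.decRel _

theorem lt_iff_exists_add (m n : M.Num) : m < n ↔ ∃ d, m + d + 1 = n :=
  BasicInduction.lt_iff hM.out m n

theorem lt_add_one_iff' (m n : M.Num) : m < n + 1 ↔ m ≤ n := hM.out.basic.lt_succ_iff m n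

theorem add_lt_add_left' (a b c : M.Num) (h : a < b) : c + a < c + b := by
  obtain ⟨d, rfl⟩ := (lt_iff_exists_add a b).1 h
  exact (lt_iff_exists_add _ _).2 ⟨d, by ring⟩

theorem zero_le' (a : M.Num) : 0 ≤ a :=
  (BasicInduction.eq_zero_or_succ hM.out a).elim (fun h => h ▸ le_refl _) (fun h => h.le)

instance : IsStrictOrderedRing M.Num where
  add_le_add_left a b h c := by
    rcases h.lt_or_eq with h | rfl
    · rw [add_comm a, add_comm b]; exact (add_lt_add_left' _ _ c h).le
    · exact le_refl _
  le_of_add_le_add_left a b c h := by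
    by_contra! hlt
    exact absurd (add_lt_add_left' _ _ a hlt) h.not_gt
  zero_le_one := zero_le' 1
  exists_pair_ne := ⟨0, 1, fun h => hM.out.basic.succ_ne_zero 0 (by rw [zero_add]; exact h.symm)⟩
  mul_lt_mul_of_pos_left a ha b c hbc := by
    obtain ⟨d, rfl⟩ := (lt_iff_exists_add _ _).1 hbc
    obtain ⟨d', rfl⟩ := (lt_iff_exists_add _ _).1 ha
    exact (lt_iff_exists_add _ _).2 ⟨d + d' * d + d', by ring⟩
  mul_lt_mul_of_pos_right a ha b c hbc := by
    obtain ⟨d, rfl⟩ := (lt_iff_exists_add _ _).1 hbc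
    obtain ⟨d', rfl⟩ := (lt_iff_exists_add _ _).1 ha
    exact (lt_iff_exists_add _ _).2 ⟨d + d' * d + d', by ring⟩

instance : CanonicallyOrderedAdd M.Num where
  exists_add_of_le {a b} h := by
    rcases h.lt_or_eq with h | rfl
    · obtain ⟨d, rfl⟩ := (lt_iff_exists_add _ _).1 h
      exact ⟨d + 1, by ring⟩
    · exact ⟨0, by ring⟩
  le_add_self a b := by
    simpa using add_le_add_left (zero_le' b) a
  le_self_add a b := by
    simpa using add_le_add_right (zero_le' b) a

instance : SuccAddOrder M.Num where
  succ a := a + 1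
  le_succ a := le_self_add
  max_of_succ_le {a} h := by
    exact absurd ((lt_add_one_iff' a a).2 le_rfl) h.not_gt
  succ_le_of_lt {a b} h := by
    obtain ⟨d, rfl⟩ := (lt_iff_exists_add _ _).1 h
    rw [add_right_comm]; exact le_self_add
  succ_eq_add_one _ := rfl

theorem lt_iff_add_one_le' {a b : M.Num} : a < b ↔ a + 1 ≤ b := Order.add_one_le_iff.symm

end Arithmetic

end L2Structure

namespace L2Structure

variable {M : L2Structure.{u}}

/-- The property `P` of numbers defines a set of the model. -/
@[fun_prop]
def Rec (P : M.Num → Prop) : Prop := {c | P c} ∈ M.Sets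

/-- The function `f` on the numbers has its graph in the model. -/
@[fun_prop]
def RecF (f : M.Num → M.Num) : Prop := {z | ∃ c, z = pair c (f c)} ∈ M.Sets

/-- The term for the pair of `s` and `t`. -/
def pairTerm (s t : ATerm) : ATerm := .add (.mul (.add s t) (.add s t)) s

theorem Rec.congr {P Q : M.Num → Prop} (hP : Rec P) (h : ∀ c, Q c ↔ P c) : Rec Q := by
  have : Q = P := funext fun c => propext (h c)
  rwa [this]

theorem RecF.congr {f g : M.Num → M.Num} (hf : RecF f) (h : ∀ c, g c = f c) : RecF g := by
  have : g = f := funext h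
  rwa [this]

section

variable [hM : Fact M.RCA0]

theorem rec_of_formula (θ : AFormula) (hθ : θ.IsDelta0) (e : ℕ → M.Num) (E : ℕ → Set M.Num)
    (hE : ∀ i, E i ∈ M.Sets) {P : M.Num → Prop}
    (h : ∀ w n, M.Sat θ (pushVar w (pushVar n e)) E ↔ P n) : Rec P := by
  obtain ⟨X, hX, hX'⟩ := hM.out.delta1_comprehension (.ex θ) (.all θ) ⟨θ, hθ, rfl⟩ ⟨θ, hθ, rfl⟩
    e E hE (fun n => ⟨fun ⟨w, hw⟩ w' => (h _ _).2 ((h _ _).1 hw), fun hn => ⟨0, hn 0⟩⟩)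
  have : {c | P c} = X := by
    ext n
    rw [hX' n]
    exact ⟨fun hn => ⟨0, (h _ _).2 hn⟩, fun ⟨w, hw⟩ => (h _ _).1 hw⟩
  exact (this ▸ hX : {c | P c} ∈ M.Sets)

theorem rec_of_formula_delta1 (θ θ' : AFormula) (hθ : θ.IsDelta0) (hθ' : θ'.IsDelta0)
    (e : ℕ → M.Num) (E : ℕ → Set M.Num) (hE : ∀ i, E i ∈ M.Sets) {P : M.Num → Prop}
    (h : ∀ n, (∃ w, M.Sat θ (pushVar w (pushVar n e)) E) ↔ P n)
    (h' : ∀ n, (∀ w, M.Sat θ' (pushVar w (pushVar n e)) E) ↔ P n) : Rec P := by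
  obtain ⟨X, hX, hX'⟩ := hM.out.delta1_comprehension (.ex θ) (.all θ') ⟨θ, hθ, rfl⟩
    ⟨θ', hθ', rfl⟩ e E hE (fun n => (h n).trans (h' n).symm)
  have : {c | P c} = X := by
    ext n
    rw [hX' n]
    exact (h n).symm
  exact (this ▸ hX : {c | P c} ∈ M.Sets)

omit hM in
theorem forall_pushVar_mem {A : Set M.Num} {E : ℕ → Set M.Num} (hA : A ∈ M.Sets)
    (hE : ∀ i, E i ∈ M.Sets) : ∀ i, pushVar A E i ∈ M.Sets
  | 0 => hA
  | _ + 1 => hE _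

/-! ### The pairing function -/

theorem le_pair_left (a b : M.Num) : a ≤ pair a b := le_add_self

theorem le_pair_right (a b : M.Num) : b ≤ pair a b := by
  rcases (zero_le' b).eq_or_lt with h | h
  · rw [← h]; exact zero_le' _
  · have h1 : 1 ≤ a + b := by
      have := lt_iff_add_one_le'.1 h
      rw [zero_add] at this
      exact this.trans le_add_self
    have h2 : (a + b) * 1 ≤ (a + b) * (a + b) := mul_le_mul_of_nonneg_left h1 (zero_le' _)
    calc b ≤ a + b := le_add_self
      _ = (a + b) * 1 := by ring
      _ ≤ _ := h2
      _ ≤ _ := le_self_add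

theorem pair_lt_of_add_lt {a b a' b' : M.Num} (h : a + b < a' + b') : pair a b < pair a' b' := by
  have h1 := lt_iff_add_one_le'.1 h
  calc pair a b = (a + b) * (a + b) + a := rfl
    _ ≤ (a + b) * (a + b) + (a + b) := by gcongr; exact le_self_add
    _ < (a + b) * (a + b) + (a + b) + (a + b + 1) := by
        exact lt_add_of_pos_right _ (lt_of_le_of_lt (zero_le' (a + b)) (lt_add_one _))
    _ = (a + b + 1) * (a + b + 1) := by ring
    _ ≤ (a' + b') * (a' + b') := mul_le_mul h1 h1 (zero_le' _) (zero_le' _)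
    _ ≤ pair a' b' := le_self_add

theorem pair_inj {a b a' b' : M.Num} (h : pair a b = pair a' b') : a = a' ∧ b = b' := by
  rcases lt_trichotomy (a + b) (a' + b') with h1 | h1 | h1
  · exact absurd h (pair_lt_of_add_lt h1).ne
  · have h2 : a = a' := by
      unfold pair at h
      rw [h1] at h
      exact add_left_cancel h
    subst h2
    exact ⟨rfl, add_left_cancel h1⟩
  · exact absurd h.symm (pair_lt_of_add_lt h1).ne

@[simp] theorem pair_eq_pair {a b a' b' : M.Num} : pair a b = pair a' b' ↔ a = a' ∧ b = b' :=
  ⟨pair_inj, fun ⟨h, h'⟩ => h ▸ h' ▸ rfl⟩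

theorem lt_pair_add_one_left (a b : M.Num) : a < pair a b + 1 :=
  (lt_add_one_iff' _ _).2 (le_pair_left a b)

theorem lt_pair_add_one_right (a b : M.Num) : b < pair a b + 1 :=
  (lt_add_one_iff' _ _).2 (le_pair_right a b)

/-- `z` is a pair. -/
def IsPair (z : M.Num) : Prop := ∃ a b, z = pair a b

open Classical in
/-- The first component of a pair. -/
noncomputable def fst (z : M.Num) : M.Num := if h : IsPair z then h.choose else 0

open Classical in
/-- The second component of a pair. -/
noncomputable def snd (z : M.Num) : M.Num := if h : IsPair z then h.choose_spec.choose else 0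

omit hM in
theorem isPair_pair (a b : M.Num) : IsPair (pair a b) := ⟨a, b, rfl⟩

omit hM in
theorem pair_fst_snd {z : M.Num} (h : IsPair z) : pair (fst z) (snd z) = z := by
  unfold fst snd
  rw [dif_pos h, dif_pos h]
  exact h.choose_spec.choose_spec.symm

@[simp] theorem fst_pair (a b : M.Num) : fst (pair a b) = a :=
  (pair_inj (pair_fst_snd (isPair_pair a b))).1

@[simp] theorem snd_pair (a b : M.Num) : snd (pair a b) = b :=
  (pair_inj (pair_fst_snd (isPair_pair a b))).2

omit hM in
theorem fst_of_not {z : M.Num} (h : ¬ IsPair z) : fst z = 0 := dif_neg h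

omit hM in
theorem snd_of_not {z : M.Num} (h : ¬ IsPair z) : snd z = 0 := dif_neg h

theorem fst_le (z : M.Num) : fst z ≤ z := by
  by_cases h : IsPair z
  · obtain ⟨a, b, rfl⟩ := h
    rw [fst_pair]; exact le_pair_left a b
  · rw [fst_of_not h]; exact zero_le' _

theorem snd_le (z : M.Num) : snd z ≤ z := by
  by_cases h : IsPair z
  · obtain ⟨a, b, rfl⟩ := h
    rw [snd_pair]; exact le_pair_right a b
  · rw [snd_of_not h]; exact zero_le' _

/-! ### Closure properties of the sets of the model -/

/-- The set variables beyond the ones that are used. -/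
noncomputable def someSet (M : L2Structure.{u}) : Set M.Num := M.sets_nonempty.choose

omit hM in
theorem someSet_mem (M : L2Structure.{u}) : someSet M ∈ M.Sets := M.sets_nonempty.choose_spec

@[fun_prop]
theorem Rec.not {P : M.Num → Prop} (hP : Rec P) : Rec (fun c => ¬ P c) :=
  rec_of_formula (.neg (.mem (.var 1) 0)) trivial (fun _ => 0) (fun _ => {c | P c}) (fun _ => hP)
    (fun _ _ => Iff.rfl)

@[fun_prop]
theorem Rec.and {P Q : M.Num → Prop} (hP : Rec P) (hQ : Rec Q) : Rec (fun c => P c ∧ Q c) :=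
  rec_of_formula (.and (.mem (.var 1) 0) (.mem (.var 1) 1)) ⟨trivial, trivial⟩ (fun _ => 0)
    (pushVar {c | P c} fun _ => {c | Q c}) (forall_pushVar_mem hP fun _ => hQ)
    (fun _ _ => Iff.rfl)

@[fun_prop]
theorem Rec.or {P Q : M.Num → Prop} (hP : Rec P) (hQ : Rec Q) : Rec (fun c => P c ∨ Q c) :=
  (hP.not.and hQ.not).not.congr (fun c => by tauto)

@[fun_prop]
theorem Rec.imp {P Q : M.Num → Prop} (hP : Rec P) (hQ : Rec Q) : Rec (fun c => P c → Q c) :=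
  (hP.and hQ.not).not.congr (fun c => by tauto)

@[fun_prop]
theorem Rec.iff {P Q : M.Num → Prop} (hP : Rec P) (hQ : Rec Q) : Rec (fun c => P c ↔ Q c) :=
  ((hP.imp hQ).and (hQ.imp hP)).congr (fun c => by tauto)

@[fun_prop]
theorem RecF.id : RecF (fun c : M.Num => c) :=
  rec_of_formula (.exLt (.add (.var 1) .one) (.eq (.var 2) (pairTerm (.var 0) (.var 0)))) trivial
    (fun _ => 0) (fun _ => someSet M) (fun _ => someSet_mem M)
    (fun _ _ => ⟨fun ⟨c, _, hc⟩ => ⟨c, hc⟩, fun ⟨c, hc⟩ => ⟨c, hc ▸ lt_pair_add_one_left c c, hc⟩⟩)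

@[fun_prop]
theorem RecF.const (k : M.Num) : RecF (fun _ : M.Num => k) :=
  rec_of_formula (.exLt (.add (.var 1) .one) (.eq (.var 2) (pairTerm (.var 0) (.var 3)))) trivial
    (fun _ => k) (fun _ => someSet M) (fun _ => someSet_mem M)
    (fun _ _ => ⟨fun ⟨c, _, hc⟩ => ⟨c, hc⟩, fun ⟨c, hc⟩ => ⟨c, hc ▸ lt_pair_add_one_left c k, hc⟩⟩)

omit hM in
theorem pair_mem_graph [Fact M.RCA0] {f : M.Num → M.Num} {a b : M.Num} :
    pair a b ∈ {z | ∃ c, z = pair c (f c)} ↔ f a = b := by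
  constructor
  · rintro ⟨c, hc⟩
    obtain ⟨rfl, rfl⟩ := pair_inj hc
    rfl
  · rintro rfl
    exact ⟨a, rfl⟩

@[fun_prop]
theorem Rec.comp {P : M.Num → Prop} {f : M.Num → M.Num} (hP : Rec P) (hf : RecF f) :
    Rec (fun c => P (f c)) := by
  refine rec_of_formula_delta1 (.and (.mem (pairTerm (.var 1) (.var 0)) 0) (.mem (.var 0) 1))
    (.imp (.mem (pairTerm (.var 1) (.var 0)) 0) (.mem (.var 0) 1)) ⟨trivial, trivial⟩
    ⟨trivial, trivial⟩ (fun _ => 0) (pushVar _ fun _ => _) (forall_pushVar_mem hf fun _ => hP)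
    (fun n => ⟨?_, ?_⟩) (fun n => ⟨?_, ?_⟩)
  · rintro ⟨w, hw, hw'⟩
    replace hw : f n = w := pair_mem_graph.1 hw
    rw [hw]; exact hw'
  · exact fun h => ⟨f n, pair_mem_graph.2 rfl, h⟩
  · exact fun h => h (f n) (pair_mem_graph.2 rfl)
  · intro h w hw
    replace hw : f n = w := pair_mem_graph.1 hw
    rw [hw] at h; exact h

@[fun_prop]
theorem recF_pair {f g : M.Num → M.Num} (hf : RecF f) (hg : RecF g) :
    RecF (fun c => pair (f c) (g c)) := by
  have := rec_of_formula (.exLt (.add (.var 1) .one) (.exLt (.add (.var 2) .one)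
    (.exLt (.add (.var 3) .one) (.and (.eq (.var 4) (pairTerm (.var 2)
      (pairTerm (.var 1) (.var 0)))) (.and (.mem (pairTerm (.var 2) (.var 1)) 0)
        (.mem (pairTerm (.var 2) (.var 0)) 1)))))) ⟨trivial, trivial, trivial⟩
    (fun _ => 0) (pushVar _ fun _ => _) (forall_pushVar_mem hf fun _ => hg)
    (P := fun n => ∃ c, c < n + 1 ∧ ∃ a, a < n + 1 ∧ ∃ b, b < n + 1 ∧ n = pair c (pair a b) ∧
      pair c a ∈ {z | ∃ c, z = pair c (f c)} ∧ pair c b ∈ {z | ∃ c, z = pair c (g c)})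
    (fun _ n => Iff.rfl)
  refine Rec.congr this fun n => ⟨?_, ?_⟩
  · rintro ⟨c, rfl⟩
    refine ⟨c, lt_pair_add_one_left _ _, f c, ?_, g c, ?_, rfl, pair_mem_graph.2 rfl,
      pair_mem_graph.2 rfl⟩
    · exact (lt_pair_add_one_left (f c) (g c)).trans_le
        (add_le_add_left (le_pair_right _ _) _)
    · exact (lt_pair_add_one_right (f c) (g c)).trans_le
        (add_le_add_left (le_pair_right _ _) _)
  · rintro ⟨c, _, a, _, b, _, h, h1, h2⟩
    rw [pair_mem_graph] at h1 h2
    subst h1 h2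
    exact ⟨c, h⟩

theorem rec_isPair : Rec (fun z : M.Num => IsPair z) :=
  rec_of_formula (.exLt (.add (.var 1) .one) (.exLt (.add (.var 2) .one)
    (.eq (.var 3) (pairTerm (.var 1) (.var 0))))) trivial
    (fun _ => 0) (fun _ => someSet M) (fun _ => someSet_mem M)
    (fun _ _ => ⟨fun ⟨a, _, b, _, h⟩ => ⟨a, b, h⟩, fun ⟨a, b, h⟩ =>
      ⟨a, h ▸ lt_pair_add_one_left a b, b, h ▸ lt_pair_add_one_right a b, h⟩⟩)

theorem recF_fst_base : RecF (fun z : M.Num => fst z) := by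
  have := rec_of_formula (.exLt (.add (.var 1) .one) (.exLt (.add (.var 2) .one)
    (.and (.eq (.var 3) (pairTerm (.var 1) (.var 0))) (.or
      (.exLt (.add (.var 1) .one) (.eq (.var 2) (pairTerm (.var 1) (.var 0))))
      (.and (.eq (.var 0) .zero) (.neg (.mem (.var 1) 0))))))) ⟨trivial, trivial, trivial, trivial⟩
    (fun _ => 0) (fun _ => _) (fun _ => rec_isPair (M := M))
    (P := fun n => ∃ z, z < n + 1 ∧ ∃ y, y < n + 1 ∧ n = pair z y ∧
      ((∃ b, b < z + 1 ∧ z = pair y b) ∨ y = 0 ∧ ¬ IsPair z)) (fun _ n => Iff.rfl)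
  refine Rec.congr this fun n => ⟨?_, ?_⟩
  · rintro ⟨z, rfl⟩
    refine ⟨z, lt_pair_add_one_left _ _, fst z, lt_pair_add_one_right _ _, rfl, ?_⟩
    by_cases h : IsPair z
    · exact Or.inl ⟨snd z, (lt_add_one_iff' _ _).2 (snd_le z), (pair_fst_snd h).symm⟩
    · exact Or.inr ⟨fst_of_not h, h⟩
  · rintro ⟨a, _, b, _, rfl, ⟨c, _, rfl⟩ | ⟨rfl, h⟩⟩
    · exact ⟨pair b c, by simp⟩
    · exact ⟨a, by simp [fst_of_not h]⟩

theorem recF_snd_base : RecF (fun z : M.Num => snd z) := by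
  have := rec_of_formula (.exLt (.add (.var 1) .one) (.exLt (.add (.var 2) .one)
    (.and (.eq (.var 3) (pairTerm (.var 1) (.var 0))) (.or
      (.exLt (.add (.var 1) .one) (.eq (.var 2) (pairTerm (.var 0) (.var 1))))
      (.and (.eq (.var 0) .zero) (.neg (.mem (.var 1) 0))))))) ⟨trivial, trivial, trivial, trivial⟩
    (fun _ => 0) (fun _ => _) (fun _ => rec_isPair (M := M))
    (P := fun n => ∃ z, z < n + 1 ∧ ∃ y, y < n + 1 ∧ n = pair z y ∧
      ((∃ b, b < z + 1 ∧ z = pair b y) ∨ y = 0 ∧ ¬ IsPair z)) (fun _ n => Iff.rfl)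
  refine Rec.congr this fun n => ⟨?_, ?_⟩
  · rintro ⟨z, rfl⟩
    refine ⟨z, lt_pair_add_one_left _ _, snd z, lt_pair_add_one_right _ _, rfl, ?_⟩
    by_cases h : IsPair z
    · exact Or.inl ⟨fst z, (lt_add_one_iff' _ _).2 (fst_le z), (pair_fst_snd h).symm⟩
    · exact Or.inr ⟨snd_of_not h, h⟩
  · rintro ⟨a, _, b, _, rfl, ⟨c, _, rfl⟩ | ⟨rfl, h⟩⟩
    · exact ⟨pair c b, by simp⟩
    · exact ⟨a, by simp [snd_of_not h]⟩

@[fun_prop]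
theorem RecF.comp {f g : M.Num → M.Num} (hf : RecF f) (hg : RecF g) :
    RecF (fun c => f (g c)) := by
  refine rec_of_formula_delta1
    (.exLt (.add (.var 1) .one) (.exLt (.add (.var 2) .one) (.and
      (.eq (.var 3) (pairTerm (.var 1) (.var 0)))
      (.and (.mem (pairTerm (.var 1) (.var 2)) 1) (.mem (pairTerm (.var 2) (.var 0)) 0)))))
    (.exLt (.add (.var 1) .one) (.exLt (.add (.var 2) .one) (.and
      (.eq (.var 3) (pairTerm (.var 1) (.var 0)))
      (.imp (.mem (pairTerm (.var 1) (.var 2)) 1) (.mem (pairTerm (.var 2) (.var 0)) 0)))))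
    ⟨trivial, trivial, trivial⟩ ⟨trivial, trivial, trivial⟩ (fun _ => 0)
    (pushVar _ fun _ => _) (forall_pushVar_mem hf fun _ => hg)
    (fun n => ⟨?_, ?_⟩) (fun n => ⟨?_, ?_⟩)
  · rintro ⟨w, c, _, y, _, h, h1, h2⟩
    replace h : n = pair c y := h
    replace h1 : g c = w := pair_mem_graph.1 h1
    replace h2 : f w = y := pair_mem_graph.1 h2
    subst h1 h2
    exact ⟨c, h⟩
  · rintro ⟨c, rfl⟩
    exact ⟨g c, c, lt_pair_add_one_left _ _, f (g c), lt_pair_add_one_right _ _, rfl,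
      pair_mem_graph.2 rfl, pair_mem_graph.2 rfl⟩
  · intro hw
    obtain ⟨c0, _, _, _, h0, _⟩ := hw 0
    obtain ⟨c, _, y, _, h, h1⟩ := hw (g c0)
    replace h0 : n = pair c0 _ := h0
    replace h : n = pair c y := h
    obtain ⟨rfl, -⟩ := pair_inj (h.symm.trans h0)
    have h2 : f (g c) = y := pair_mem_graph.1 (h1 (pair_mem_graph.2 rfl))
    subst h2
    exact ⟨c, h⟩
  · rintro ⟨c, rfl⟩ w
    refine ⟨c, lt_pair_add_one_left _ _, f (g c), lt_pair_add_one_right _ _, rfl, fun hw => ?_⟩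
    replace hw : g c = w := pair_mem_graph.1 hw
    subst hw
    exact pair_mem_graph.2 rfl

@[fun_prop]
theorem recF_fst {f : M.Num → M.Num} (hf : RecF f) : RecF (fun c => fst (f c)) :=
  recF_fst_base.comp hf

@[fun_prop]
theorem recF_snd {f : M.Num → M.Num} (hf : RecF f) : RecF (fun c => snd (f c)) :=
  recF_snd_base.comp hf

@[fun_prop]
theorem rec_mem {X : Set M.Num} (hX : X ∈ M.Sets) {f : M.Num → M.Num} (hf : RecF f) :
    Rec (fun c => f c ∈ X) :=
  Rec.comp (P := fun c => c ∈ X) hX hf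

@[fun_prop]
theorem Rec.isPair {f : M.Num → M.Num} (hf : RecF f) : Rec (fun c => IsPair (f c)) :=
  rec_isPair.comp hf

@[fun_prop]
theorem rec_eq {f g : M.Num → M.Num} (hf : RecF f) (hg : RecF g) : Rec (fun c => f c = g c) := by
  have h : Rec (fun c : M.Num => ∃ y, c = pair y y) := RecF.id
  exact (h.comp (recF_pair hf hg)).congr fun c =>
    ⟨fun h => ⟨f c, by rw [h]⟩, fun ⟨y, hy⟩ => by
      obtain ⟨h1, h2⟩ := pair_inj hy
      rw [h1, h2]⟩

@[fun_prop]
theorem rec_lt {f g : M.Num → M.Num} (hf : RecF f) (hg : RecF g) : Rec (fun c => f c < g c) := by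
  have h := rec_of_formula (.exLt (.add (.var 1) .one) (.exLt (.add (.var 2) .one)
    (.and (.eq (.var 3) (pairTerm (.var 1) (.var 0))) (.lt (.var 1) (.var 0)))))
    ⟨trivial, trivial⟩ (fun _ => 0) (fun _ => someSet M) (fun _ => someSet_mem M)
    (P := fun n => ∃ a, a < n + 1 ∧ ∃ b, b < n + 1 ∧ n = pair a b ∧ a < b) (fun _ n => Iff.rfl)
  refine (h.comp (recF_pair hf hg)).congr fun c => ⟨fun h => ?_, ?_⟩
  · exact ⟨f c, lt_pair_add_one_left _ _, g c, lt_pair_add_one_right _ _, rfl, h⟩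
  · rintro ⟨a, _, b, _, h1, h2⟩
    obtain ⟨rfl, rfl⟩ := pair_inj h1
    exact h2

@[fun_prop]
theorem rec_le {f g : M.Num → M.Num} (hf : RecF f) (hg : RecF g) : Rec (fun c => f c ≤ g c) :=
  (rec_lt hg hf).not.congr fun _ => not_lt.symm

@[fun_prop]
theorem rec_const (p : Prop) : Rec (fun _ : M.Num => p) := by
  by_cases hp : p
  · exact (rec_eq (RecF.const 0) (RecF.const 0)).congr fun _ => by simp [hp]
  · exact (rec_eq (RecF.const 0) (RecF.const 0)).not.congr fun _ => by simp [hp]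

theorem RecF.of_graph {f : M.Num → M.Num} (h : Rec (fun z : M.Num => f (fst z) = snd z)) :
    RecF f :=
  (rec_isPair.and h).congr fun z => ⟨by rintro ⟨c, rfl⟩; exact ⟨isPair_pair _ _, by simp⟩, by
    rintro ⟨⟨a, b, rfl⟩, hz⟩
    exact ⟨a, by simp at hz; rw [hz]⟩⟩

/-- A function is in the model when its graph is the restriction of a set of the model. -/
theorem RecF.of_iff {f : M.Num → M.Num} (P : M.Num → M.Num → Prop)
    (hP : Rec (fun z => P (fst z) (snd z))) (h : ∀ c y, f c = y ↔ P c y) : RecF f :=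
  RecF.of_graph (hP.congr fun _ => h _ _)

@[fun_prop]
theorem recF_add {f g : M.Num → M.Num} (hf : RecF f) (hg : RecF g) :
    RecF (fun c => f c + g c) := by
  have h := rec_of_formula (.exLt (.add (.var 1) .one) (.exLt (.add (.var 2) .one)
    (.eq (.var 3) (pairTerm (pairTerm (.var 1) (.var 0)) (.add (.var 1) (.var 0))))))
    trivial (fun _ => 0) (fun _ => someSet M) (fun _ => someSet_mem M)
    (P := fun n => ∃ a, a < n + 1 ∧ ∃ b, b < n + 1 ∧ n = pair (pair a b) (a + b))
    (fun _ n => Iff.rfl)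
  refine RecF.of_graph ((h.comp (f := fun z => pair (pair (f (fst z)) (g (fst z))) (snd z))
    (by fun_prop)).congr fun c => ⟨fun h => ?_, ?_⟩)
  · refine ⟨f (fst c), ?_, g (fst c), ?_, by rw [h]⟩
    · exact (lt_add_one_iff' _ _).2 ((le_pair_left _ _).trans (le_pair_left _ _))
    · exact (lt_add_one_iff' _ _).2 ((le_pair_right _ _).trans (le_pair_left _ _))
  · rintro ⟨a, _, b, _, h1⟩
    obtain ⟨h1, h2⟩ := pair_inj h1
    obtain ⟨rfl, rfl⟩ := pair_inj h1
    exact h2.symm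

@[fun_prop]
theorem recF_mul {f g : M.Num → M.Num} (hf : RecF f) (hg : RecF g) :
    RecF (fun c => f c * g c) := by
  have h := rec_of_formula (.exLt (.add (.var 1) .one) (.exLt (.add (.var 2) .one)
    (.eq (.var 3) (pairTerm (pairTerm (.var 1) (.var 0)) (.mul (.var 1) (.var 0))))))
    trivial (fun _ => 0) (fun _ => someSet M) (fun _ => someSet_mem M)
    (P := fun n => ∃ a, a < n + 1 ∧ ∃ b, b < n + 1 ∧ n = pair (pair a b) (a * b))
    (fun _ n => Iff.rfl)
  refine RecF.of_graph ((h.comp (f := fun z => pair (pair (f (fst z)) (g (fst z))) (snd z))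
    (by fun_prop)).congr fun c => ⟨fun h => ?_, ?_⟩)
  · refine ⟨f (fst c), ?_, g (fst c), ?_, by rw [h]⟩
    · exact (lt_add_one_iff' _ _).2 ((le_pair_left _ _).trans (le_pair_left _ _))
    · exact (lt_add_one_iff' _ _).2 ((le_pair_right _ _).trans (le_pair_left _ _))
  · rintro ⟨a, _, b, _, h1⟩
    obtain ⟨h1, h2⟩ := pair_inj h1
    obtain ⟨rfl, rfl⟩ := pair_inj h1
    exact h2.symm

@[fun_prop]
theorem rec_exists_lt {P : M.Num → M.Num → Prop} {b : M.Num → M.Num}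
    (hb : RecF b) (hP : Rec (fun z => P (fst z) (snd z))) :
    Rec (fun c => ∃ y, y < b c ∧ P c y) := by
  have h := rec_of_formula (.exLt (.add (.var 1) .one) (.exLt (.add (.var 2) .one)
    (.and (.eq (.var 3) (pairTerm (.var 1) (.var 0)))
      (.exLt (.var 0) (.mem (pairTerm (.var 2) (.var 0)) 0)))))
    ⟨trivial, trivial⟩ (fun _ => 0) (fun _ => _) (fun _ => hP)
    (P := fun n => ∃ a, a < n + 1 ∧ ∃ b, b < n + 1 ∧ n = pair a b ∧
      ∃ y, y < b ∧ P (fst (pair a y)) (snd (pair a y))) (fun _ n => Iff.rfl)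
  refine (h.comp (recF_pair RecF.id hb)).congr fun c => ⟨fun h => ?_, ?_⟩
  · exact ⟨c, lt_pair_add_one_left _ _, b c, lt_pair_add_one_right _ _, rfl, by simpa using h⟩
  · rintro ⟨a, _, b, _, h1, h2⟩
    obtain ⟨rfl, rfl⟩ := pair_inj h1
    simpa using h2

@[fun_prop]
theorem rec_exists_le {P : M.Num → M.Num → Prop} {b : M.Num → M.Num}
    (hb : RecF b) (hP : Rec (fun z => P (fst z) (snd z))) :
    Rec (fun c => ∃ y, y ≤ b c ∧ P c y) :=
  (rec_exists_lt (recF_add hb (RecF.const 1)) hP).congr fun _ => by simp only [lt_add_one_iff']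

@[fun_prop]
theorem rec_forall_lt {P : M.Num → M.Num → Prop} {b : M.Num → M.Num}
    (hb : RecF b) (hP : Rec (fun z => P (fst z) (snd z))) :
    Rec (fun c => ∀ y, y < b c → P c y) :=
  (rec_exists_lt (P := fun c y => ¬ P c y) hb hP.not).not.congr fun _ => by push Not; rfl

/-- `Δ⁰₁` comprehension. -/
theorem rec_exists_of_iff_forall {P Q : M.Num → M.Num → Prop}
    (hP : Rec (fun z => P (fst z) (snd z))) (hQ : Rec (fun z => Q (fst z) (snd z)))
    (h : ∀ c, (∃ y, P c y) ↔ ∀ y, Q c y) : Rec (fun c => ∃ y, P c y) := by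
  refine rec_of_formula_delta1 (.mem (pairTerm (.var 1) (.var 0)) 0)
    (.mem (pairTerm (.var 1) (.var 0)) 1) trivial trivial (fun _ => 0)
    (pushVar _ fun _ => _) (forall_pushVar_mem hP fun _ => hQ) (fun n => ?_) (fun n => ?_)
  · change (∃ w, P (fst (pair n w)) (snd (pair n w))) ↔ _
    simp
  · change (∀ w, Q (fst (pair n w)) (snd (pair n w))) ↔ _
    simp [h]

theorem Rec.comp₂ {P : M.Num → M.Num → Prop} (hP : Rec (fun z => P (fst z) (snd z)))
    {f g : M.Num → M.Num} (hf : RecF f) (hg : RecF g) : Rec (fun c => P (f c) (g c)) :=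
  (hP.comp (recF_pair hf hg)).congr fun c => by simp

/-- `Σ⁰₁` induction. -/
theorem sigma1_induction {P : M.Num → M.Num → Prop} (hP : Rec (fun z => P (fst z) (snd z)))
    (h0 : ∃ y, P 0 y) (hs : ∀ n, (∃ y, P n y) → ∃ y, P (n + 1) y) (n : M.Num) : ∃ y, P n y := by
  have key := hM.out.sigma1_induction (.ex (.mem (pairTerm (.var 1) (.var 0)) 0))
    (by refine ⟨_, ?_, rfl⟩; trivial) (fun _ => 0) (fun _ => _) (fun _ => hP)
  have conv : ∀ n, M.Sat (.ex (.mem (pairTerm (.var 1) (.var 0)) 0)) (pushVar n fun _ => 0)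
      (fun _ => {c | P (fst c) (snd c)}) ↔ ∃ y, P n y := by
    intro n
    change (∃ w, P (fst (pair n w)) (snd (pair n w))) ↔ _
    simp
  exact (conv n).1 (key ((conv 0).2 h0) (fun n hn => (conv _).2 (hs n ((conv n).1 hn))) n)

theorem rec_induction {P : M.Num → Prop} (hP : Rec P) (h0 : P 0) (hs : ∀ n, P n → P (n + 1))
    (n : M.Num) : P n := by
  have := sigma1_induction (P := fun n _ => P n) (hP.comp (recF_fst RecF.id)) ⟨0, h0⟩
    (fun n ⟨y, hy⟩ => ⟨y, hs n hy⟩) n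
  exact this.elim fun _ h => h

theorem rec_strong_induction {P : M.Num → Prop} (hP : Rec P) (h : ∀ n, (∀ m < n, P m) → P n)
    (n : M.Num) : P n := by
  have key : ∀ n, ∀ m, m < n → P m := by
    refine rec_induction (P := fun n => ∀ m, m < n → P m)
      (rec_forall_lt RecF.id (hP.comp (recF_snd RecF.id))) ?_ ?_
    · exact fun m hm => absurd hm (zero_le' m).not_gt
    · intro n ih m hm
      rcases ((lt_add_one_iff' _ _).1 hm).lt_or_eq with h1 | rfl
      · exact ih m h1
      · exact h m ih
  exact h n (key n)

theorem exists_least {P : M.Num → Prop} (hP : Rec P) {n : M.Num} (hn : P n) :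
    ∃ m, P m ∧ ∀ k < m, ¬ P k := by
  by_contra! hc
  exact rec_strong_induction hP.not (fun m hm h => by
    obtain ⟨k, hk, hk'⟩ := hc m h
    exact hm k hk hk') n hn

@[fun_prop]
theorem recF_ite {P : M.Num → Prop} [∀ c, Decidable (P c)] {f g : M.Num → M.Num} (hP : Rec P)
    (hf : RecF f) (hg : RecF g) : RecF (fun c => if P c then f c else g c) := by
  have h1 := hP.comp (recF_fst RecF.id)
  have h2 := hf.comp (recF_fst RecF.id)
  have h3 := hg.comp (recF_fst RecF.id)
  have h4 := recF_snd (RecF.id (M := M))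
  refine RecF.of_graph (((h1.and (rec_eq h2 h4)).or (h1.not.and (rec_eq h3 h4))).congr fun c => ?_)
  by_cases h : P (fst c) <;> simp [h]

end
end L2Structure

namespace L2Structure

variable {M : L2Structure.{u}} [hM : Fact M.RCA0]

/-! ### Codes of finite sets -/

theorem dvd_of_dvd_add_right {a x y : M.Num} (h : a ∣ x + y) (hx : a ∣ x) : a ∣ y := by
  obtain ⟨q, rfl⟩ := hx
  obtain ⟨r, hr⟩ := h
  rcases le_total q r with hqr | hqr
  · obtain ⟨s, rfl⟩ := exists_add_of_le hqr
    rw [mul_add] at hr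
    exact ⟨s, add_left_cancel hr⟩
  · have h1 : a * r ≤ a * q := mul_le_mul_of_nonneg_left hqr (zero_le' _)
    rw [← hr] at h1
    have h2 : y = 0 := by
      by_contra hy
      exact absurd h1 (lt_add_of_pos_right _ (lt_of_le_of_ne (zero_le' y) (Ne.symm hy))).not_ge
    rw [h2]; exact dvd_zero a

@[fun_prop]
theorem rec_dvd {f g : M.Num → M.Num} (hf : RecF f) (hg : RecF g) : Rec (fun c => f c ∣ g c) := by
  have h : Rec (fun c => ∃ q, q ≤ g c ∧ g c = f c * q) := by fun_prop
  refine h.congr fun c => ⟨?_, fun ⟨q, _, h⟩ => ⟨q, h⟩⟩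
  rintro ⟨q, hq⟩
  rcases (zero_le' (f c)).eq_or_lt with h0 | h0
  · exact ⟨0, zero_le' _, by rw [hq, ← h0]; ring⟩
  · refine ⟨q, ?_, hq⟩
    have h1 : 1 ≤ f c := by simpa using lt_iff_add_one_le'.1 h0
    calc q = 1 * q := (one_mul q).symm
      _ ≤ f c * q := mul_le_mul_of_nonneg_right h1 (zero_le' _)
      _ = g c := hq.symm

omit hM in
theorem isTriple_iff [Fact M.RCA0] {c : M.Num} : IsTriple c ↔ IsPair c ∧ IsPair (snd c) := by
  constructor
  · rintro ⟨k, m, n, rfl⟩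
    exact ⟨isPair_pair _ _, by rw [snd_pair]; exact isPair_pair _ _⟩
  · rintro ⟨⟨k, b, rfl⟩, h⟩
    rw [snd_pair] at h
    obtain ⟨m, n, rfl⟩ := h
    exact ⟨k, m, n, rfl⟩

theorem finMem_iff {i c : M.Num} : FinMem i c ↔
    IsTriple c ∧ i < fst c ∧ (fst (snd c) * (i + 1) + 1) ∣ snd (snd c) := by
  constructor
  · rintro ⟨k, m, n, rfl, h, h'⟩
    refine ⟨⟨k, m, n, rfl⟩, ?_, ?_⟩
    · simpa using h
    · simpa using (show m * (i + 1) + 1 ∣ n from h')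
  · rintro ⟨⟨k, m, n, rfl⟩, h, h'⟩
    refine ⟨k, m, n, rfl, by simpa using h, ?_⟩
    simp only [snd_pair, fst_pair] at h'
    exact h'

@[fun_prop]
theorem rec_isTriple {f : M.Num → M.Num} (hf : RecF f) : Rec (fun c => IsTriple (f c)) := by
  simp only [isTriple_iff]
  fun_prop

@[fun_prop]
theorem rec_finMem {f g : M.Num → M.Num} (hf : RecF f) (hg : RecF g) :
    Rec (fun c => FinMem (f c) (g c)) := by
  simp only [finMem_iff]
  fun_prop

theorem FinMem.lt {i c : M.Num} (h : FinMem i c) : i < c :=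
  (finMem_iff.1 h).2.1.trans_le (fst_le c)

theorem forall_finMem_iff {c c' : M.Num} : (∀ i, FinMem i c' ↔ FinMem i c) ↔
    ∀ i < c' + c, FinMem i c' ↔ FinMem i c := by
  refine ⟨fun h i _ => h i, fun h i => ⟨fun hi => ?_, fun hi => ?_⟩⟩
  · exact (h i (hi.lt.trans_le le_self_add)).1 hi
  · exact (h i (hi.lt.trans_le le_add_self)).2 hi

@[fun_prop]
theorem rec_isFinCode {f : M.Num → M.Num} (hf : RecF f) : Rec (fun c => IsFinCode (f c)) := by
  simp only [IsFinCode, forall_finMem_iff]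
  fun_prop

theorem exists_common_multiple (b : M.Num) : ∃ m : M.Num, m ≠ 0 ∧ ∀ i < b, i + 1 ∣ m := by
  refine sigma1_induction (P := fun b m => m ≠ 0 ∧ ∀ i < b, i + 1 ∣ m) (by fun_prop)
    ⟨1, one_ne_zero, fun i hi => absurd hi (zero_le' i).not_gt⟩ ?_ b
  rintro n ⟨m, hm0, hm⟩
  refine ⟨m * (n + 1), mul_ne_zero hm0 (hM.out.basic.succ_ne_zero n), fun i hi => ?_⟩
  rcases ((lt_add_one_iff' _ _).1 hi).lt_or_eq with h | rfl
  · exact (hm i h).mul_right _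
  · exact dvd_mul_left _ _

theorem dvd_of_dvd_mul_beta {m d i n : M.Num} (hd : d ∣ m) (h : m * (i + 1) + 1 ∣ n * d) :
    m * (i + 1) + 1 ∣ n := by
  obtain ⟨e, rfl⟩ := hd
  have h1 : d * e * (i + 1) + 1 ∣ n * d * (e * (i + 1)) := h.mul_right _
  refine dvd_of_dvd_add_right (x := n * d * (e * (i + 1))) ?_ h1
  exact ⟨n, by ring⟩

theorem beta_dvd_mul {b m i j n : M.Num} (hm : ∀ i < b, i + 1 ∣ m) (hi : i < b) (hj : j < b)
    (hij : i ≠ j) (h : m * (i + 1) + 1 ∣ n * (m * (j + 1) + 1)) : m * (i + 1) + 1 ∣ n := by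
  rcases lt_or_gt_of_ne hij with hlt | hlt
  · obtain ⟨d, rfl⟩ := (lt_iff_exists_add _ _).1 hlt
    have hd : d < b := lt_of_le_of_lt (by
      rw [add_assoc, add_comm i]
      exact le_trans le_self_add le_self_add) hj
    refine dvd_of_dvd_mul_beta (hm d hd) ?_
    have h1 : m * (i + 1) + 1 ∣ n * (m * (i + d + 1 + 1) + 1) * (i + 1) := h.mul_right _
    have h2 : n * (m * (i + d + 1 + 1) + 1) * (i + 1) + n * (d + 1) =
      (m * (i + 1) + 1) * (n * (i + d + 1 + 1)) := by ring
    exact dvd_of_dvd_add_right (h2 ▸ dvd_mul_right _ _) h1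
  · obtain ⟨d, rfl⟩ := (lt_iff_exists_add _ _).1 hlt
    have hd : d < b := lt_of_le_of_lt (by
      rw [add_assoc, add_comm j]
      exact le_trans le_self_add le_self_add) hi
    refine dvd_of_dvd_mul_beta (hm d hd) ?_
    have h1 : m * (j + d + 1 + 1) + 1 ∣ n * (m * (j + 1) + 1) * (j + d + 1 + 1) := h.mul_right _
    have h2 : n * (m * (j + 1) + 1) * (j + d + 1 + 1) =
      (m * (j + d + 1 + 1) + 1) * (n * (j + 1)) + n * (d + 1) := by ring
    rw [h2] at h1
    exact dvd_of_dvd_add_right h1 (dvd_mul_right _ _)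

theorem beta_not_dvd_one {m : M.Num} (hm0 : m ≠ 0) (i : M.Num) : ¬ m * (i + 1) + 1 ∣ 1 := by
  rintro ⟨q, hq⟩
  have h1 : (m * (i + 1) + 1) * 1 ≤ (m * (i + 1) + 1) * q := by
    refine mul_le_mul_of_nonneg_left ?_ (zero_le' _)
    have : q ≠ 0 := by
      rintro rfl
      simp at hq
    simpa using lt_iff_add_one_le'.1 (lt_of_le_of_ne (zero_le' q) (Ne.symm this))
  rw [← hq, mul_one] at h1
  have h2 : 0 < m * (i + 1) := mul_pos (lt_of_le_of_ne (zero_le' m) (Ne.symm hm0))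
    (lt_of_le_of_lt (zero_le' i) (lt_add_one i))
  exact absurd h1 (lt_add_of_pos_left 1 h2).not_ge

/-- Every bounded set of the model has a presentation by a triple. -/
theorem exists_triple {P : M.Num → Prop} (hP : Rec P) (b : M.Num) :
    ∃ c, IsTriple c ∧ ∀ i, FinMem i c ↔ i < b ∧ P i := by
  obtain ⟨m, hm0, hm⟩ := exists_common_multiple b
  have key : ∀ j : M.Num, ∃ n : M.Num, ∀ i < b, (m * (i + 1) + 1 ∣ n ↔ i < j ∧ P i) := by
    refine sigma1_induction (P := fun j n => ∀ i < b, (m * (i + 1) + 1 ∣ n ↔ i < j ∧ P i))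
      (by fun_prop) ⟨1, fun i _ => ?_⟩ ?_
    · simp only [beta_not_dvd_one hm0 i, (zero_le' i).not_gt, false_and]
    · rintro j ⟨n, hn⟩
      by_cases hj : j < b ∧ P j
      · refine ⟨n * (m * (j + 1) + 1), fun i hi => ?_⟩
        by_cases hij : i = j
        · subst hij
          simp [hj.2]
        · have h1 : m * (i + 1) + 1 ∣ n * (m * (j + 1) + 1) ↔ m * (i + 1) + 1 ∣ n :=
            ⟨beta_dvd_mul hm hi hj.1 hij, fun h => h.mul_right _⟩
          rw [h1, hn i hi, lt_add_one_iff', le_iff_lt_or_eq]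
          simp [hij]
      · refine ⟨n, fun i hi => ?_⟩
        rw [hn i hi, lt_add_one_iff', le_iff_lt_or_eq]
        refine ⟨fun h => ⟨Or.inl h.1, h.2⟩, ?_⟩
        rintro ⟨h | rfl, h'⟩
        · exact ⟨h, h'⟩
        · exact absurd ⟨hi, h'⟩ hj
  obtain ⟨n, hn⟩ := key b
  refine ⟨pair b (pair m n), ⟨b, m, n, rfl⟩, fun i => ?_⟩
  rw [finMem_iff]
  simp only [fst_pair, snd_pair]
  constructor
  · rintro ⟨_, h1, h2⟩
    exact (hn i h1).1 h2
  · rintro ⟨h1, h2⟩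
    exact ⟨⟨b, m, n, rfl⟩, h1, (hn i h1).2 ⟨h1, h2⟩⟩

/-- Every bounded set of the model has a code. -/
theorem exists_finCode {P : M.Num → Prop} (hP : Rec P) (b : M.Num) :
    ∃ c, IsFinCode c ∧ ∀ i, FinMem i c ↔ i < b ∧ P i := by
  obtain ⟨c₀, h₀, h₀'⟩ := exists_triple hP b
  have hr : Rec (fun c => IsTriple c ∧ ∀ i, FinMem i c ↔ FinMem i c₀) := by
    simp only [forall_finMem_iff]
    fun_prop
  obtain ⟨c, ⟨hc, hc'⟩, hmin⟩ := exists_least hr (n := c₀) ⟨h₀, fun i => Iff.rfl⟩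
  refine ⟨c, ⟨hc, fun c' hlt ht heq => ?_⟩, fun i => (hc' i).trans (h₀' i)⟩
  exact hmin c' hlt ⟨ht, fun i => (heq i).trans (hc' i)⟩

omit hM in
theorem IsFinCode.ext [Fact M.RCA0] {c c' : M.Num} (hc : IsFinCode c) (hc' : IsFinCode c')
    (h : ∀ i, FinMem i c ↔ FinMem i c') : c = c' := by
  rcases lt_trichotomy c c' with h1 | h1 | h1
  · exact absurd h (hc'.2 c h1 hc.1)
  · exact h1
  · exact absurd (fun i => (h i).symm) (hc.2 c' h1 hc'.1)

/-! ### Codes of finite sequences -/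

theorem exists_bound {f : M.Num → M.Num} (hf : RecF f) (l : M.Num) : ∃ b, ∀ i < l, f i < b := by
  refine sigma1_induction (P := fun l b => ∀ i < l, f i < b) (by fun_prop)
    ⟨0, fun i hi => absurd hi (zero_le' i).not_gt⟩ ?_ l
  rintro n ⟨b, hb⟩
  refine ⟨b + f n + 1, fun i hi => (lt_add_one_iff' _ _).2 ?_⟩
  rcases ((lt_add_one_iff' _ _).1 hi).lt_or_eq with h | rfl
  · exact (hb i h).le.trans le_self_add
  · exact le_add_self

/-- `σ` is the code of a finite sequence. -/
def IsSeq (σ : M.Num) : Prop := ∃ l, IsSeqLen σ l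

open Classical in
/-- The length of a finite sequence. -/
noncomputable def len (σ : M.Num) : M.Num := if h : IsSeq σ then h.choose else 0

open Classical in
/-- The entry of a finite sequence at the place `i`. -/
noncomputable def ent (σ i : M.Num) : M.Num :=
  if h : IsSeq σ ∧ ∃ x, Entry σ i x then h.2.choose else 0

theorem Entry.lt_left {σ i x : M.Num} (h : Entry σ i x) : i < σ :=
  (le_pair_left i x).trans_lt (FinMem.lt h)

theorem Entry.lt_right {σ i x : M.Num} (h : Entry σ i x) : x < σ :=
  (le_pair_right i x).trans_lt (FinMem.lt h)

theorem IsSeqLen.entry_lt {σ l i x : M.Num} (h : IsSeqLen σ l) (hx : Entry σ i x) : i < l := by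
  obtain ⟨j, y, hj, h1⟩ := h.2.1 _ hx
  rw [(pair_inj h1).1]; exact hj

theorem IsSeqLen.unique {σ l l' : M.Num} (h : IsSeqLen σ l) (h' : IsSeqLen σ l') : l = l' := by
  rcases lt_trichotomy l l' with h1 | h1 | h1
  · obtain ⟨x, hx, _⟩ := h'.2.2 l h1
    exact absurd (h.entry_lt hx) (lt_irrefl _)
  · exact h1
  · obtain ⟨x, hx, _⟩ := h.2.2 l' h1
    exact absurd (h'.entry_lt hx) (lt_irrefl _)

theorem IsSeqLen.len_eq {σ l : M.Num} (h : IsSeqLen σ l) : len σ = l := by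
  have h1 : IsSeq σ := ⟨l, h⟩
  unfold len
  rw [dif_pos h1]
  exact h1.choose_spec.unique h

theorem IsSeq.isSeqLen {σ : M.Num} (h : IsSeq σ) : IsSeqLen σ (len σ) := by
  obtain ⟨l, hl⟩ := h
  rw [hl.len_eq]; exact hl

theorem isSeqLen_iff {σ l : M.Num} : IsSeqLen σ l ↔ IsSeq σ ∧ len σ = l :=
  ⟨fun h => ⟨⟨l, h⟩, h.len_eq⟩, fun ⟨h, h'⟩ => h' ▸ h.isSeqLen⟩

theorem IsSeqLen.le {σ l : M.Num} (h : IsSeqLen σ l) : l ≤ σ := by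
  by_contra! hlt
  obtain ⟨x, hx, _⟩ := h.2.2 σ hlt
  exact absurd hx.lt_left (lt_irrefl _)

theorem IsSeqLen.entry_unique {σ l i x y : M.Num} (h : IsSeqLen σ l) (hx : Entry σ i x)
    (hy : Entry σ i y) : x = y :=
  (h.2.2 i (h.entry_lt hx)).unique hx hy

theorem IsSeqLen.ent_eq {σ l i x : M.Num} (h : IsSeqLen σ l) (hx : Entry σ i x) : ent σ i = x := by
  have h1 : IsSeq σ ∧ ∃ x, Entry σ i x := ⟨⟨l, h⟩, x, hx⟩
  unfold ent
  rw [dif_pos h1]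
  exact h.entry_unique h1.2.choose_spec hx

theorem IsSeqLen.entry_iff {σ l i x : M.Num} (h : IsSeqLen σ l) :
    Entry σ i x ↔ i < l ∧ ent σ i = x := by
  refine ⟨fun hx => ⟨h.entry_lt hx, h.ent_eq hx⟩, ?_⟩
  rintro ⟨hi, rfl⟩
  obtain ⟨x, hx, _⟩ := h.2.2 i hi
  rw [h.ent_eq hx]; exact hx

theorem IsSeq.entry_iff {σ i x : M.Num} (h : IsSeq σ) :
    Entry σ i x ↔ i < len σ ∧ ent σ i = x := h.isSeqLen.entry_iff

@[fun_prop]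
theorem rec_entry {f g h : M.Num → M.Num} (hf : RecF f) (hg : RecF g) (hh : RecF h) :
    Rec (fun c => Entry (f c) (g c) (h c)) := by
  unfold Entry
  fun_prop

theorem isSeqLen_iff_bounded {σ l : M.Num} : IsSeqLen σ l ↔ IsFinCode σ ∧
    (∀ z < σ, FinMem z σ → IsPair z ∧ fst z < l) ∧
    ∀ i < l, ∃ x < σ, Entry σ i x ∧ ∀ y < σ, Entry σ i y → y = x := by
  constructor
  · rintro ⟨h1, h2, h3⟩
    refine ⟨h1, fun z _ hz => ?_, fun i hi => ?_⟩
    · obtain ⟨i, x, hi, rfl⟩ := h2 z hz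
      exact ⟨isPair_pair _ _, by rwa [fst_pair]⟩
    · obtain ⟨x, hx, hu⟩ := h3 i hi
      exact ⟨x, hx.lt_right, hx, fun y _ hy => hu y hy⟩
  · rintro ⟨h1, h2, h3⟩
    refine ⟨h1, fun z hz => ?_, fun i hi => ?_⟩
    · obtain ⟨h4, h5⟩ := h2 z hz.lt hz
      exact ⟨fst z, snd z, h5, (pair_fst_snd h4).symm⟩
    · obtain ⟨x, _, hx, hu⟩ := h3 i hi
      exact ⟨x, hx, fun y hy => hu y hy.lt_right hy⟩

@[fun_prop]
theorem rec_isSeqLen {f g : M.Num → M.Num} (hf : RecF f) (hg : RecF g) :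
    Rec (fun c => IsSeqLen (f c) (g c)) := by
  simp only [isSeqLen_iff_bounded]
  fun_prop

@[fun_prop]
theorem rec_isSeq {f : M.Num → M.Num} (hf : RecF f) : Rec (fun c => IsSeq (f c)) := by
  have : Rec (fun c => ∃ l ≤ f c, IsSeqLen (f c) l) := by fun_prop
  exact this.congr fun c => ⟨fun ⟨l, hl⟩ => ⟨l, hl.le, hl⟩, fun ⟨l, _, hl⟩ => ⟨l, hl⟩⟩

theorem recF_len_base : RecF (fun σ : M.Num => len σ) := by
  refine RecF.of_iff (fun σ l => IsSeqLen σ l ∨ (¬ IsSeq σ ∧ l = 0)) (by fun_prop) fun σ l => ?_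
  by_cases h : IsSeq σ
  · simp only [h, not_true, false_and, or_false, isSeqLen_iff, true_and]
  · have h1 : len σ = 0 := dif_neg h
    simp only [h, not_false_eq_true, isSeqLen_iff, false_and, false_or, true_and, h1]
    exact eq_comm

@[fun_prop]
theorem recF_len {f : M.Num → M.Num} (hf : RecF f) : RecF (fun c => len (f c)) :=
  recF_len_base.comp hf

theorem ent_of_not {σ i : M.Num} (h : ¬ (IsSeq σ ∧ i < len σ)) : ent σ i = 0 := by
  refine dif_neg ?_
  rintro ⟨h1, x, hx⟩
  exact h ⟨h1, h1.isSeqLen.entry_lt hx⟩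

@[fun_prop]
theorem recF_ent {f g : M.Num → M.Num} (hf : RecF f) (hg : RecF g) :
    RecF (fun c => ent (f c) (g c)) := by
  have : RecF (fun z : M.Num => ent (fst z) (snd z)) := by
    refine RecF.of_iff (fun z x => (IsSeq (fst z) ∧ Entry (fst z) (snd z) x) ∨
      (¬ (IsSeq (fst z) ∧ snd z < len (fst z)) ∧ x = 0)) (by fun_prop) fun z x => ?_
    by_cases h : IsSeq (fst z) ∧ snd z < len (fst z)
    · simp only [h.1, h.1.entry_iff, h.2, true_and, not_true, false_and, or_false]
    · rw [ent_of_not h]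
      simp only [h, not_false_eq_true, true_and]
      refine ⟨fun h => Or.inr h.symm, ?_⟩
      rintro (⟨h1, h2⟩ | h1)
      · exact absurd ⟨h1, h1.isSeqLen.entry_lt h2⟩ h
      · exact h1.symm
  exact (this.comp (recF_pair hf hg)).congr fun c => by simp

theorem ent_lt {σ i : M.Num} (h : IsSeq σ) (hi : i < len σ) : ent σ i < σ :=
  Entry.lt_right (h.entry_iff.2 ⟨hi, rfl⟩)

theorem IsSeq.ext {σ ρ : M.Num} (hσ : IsSeq σ) (hρ : IsSeq ρ) (hl : len σ = len ρ)
    (h : ∀ i < len σ, ent σ i = ent ρ i) : σ = ρ := by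
  refine hσ.isSeqLen.1.ext hρ.isSeqLen.1 fun z => ?_
  have aux : ∀ i x, Entry σ i x ↔ Entry ρ i x := by
    intro i x
    rw [hσ.entry_iff, hρ.entry_iff, ← hl]
    refine and_congr_right fun hi => ?_
    rw [h i hi]
  constructor
  · intro hz
    obtain ⟨i, x, _, rfl⟩ := hσ.isSeqLen.2.1 z hz
    exact (aux i x).1 hz
  · intro hz
    obtain ⟨i, x, _, rfl⟩ := hρ.isSeqLen.2.1 z hz
    exact (aux i x).2 hz

theorem exists_seq {f : M.Num → M.Num} (hf : RecF f) (l : M.Num) :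
    ∃ σ, IsSeq σ ∧ len σ = l ∧ ∀ i < l, ent σ i = f i := by
  obtain ⟨b, hb⟩ := exists_bound (recF_pair RecF.id hf) l
  obtain ⟨σ, hσ, hσ'⟩ := exists_finCode
    (P := fun z => IsPair z ∧ fst z < l ∧ f (fst z) = snd z) (by fun_prop) b
  have he : ∀ i x, Entry σ i x ↔ i < l ∧ f i = x := by
    intro i x
    unfold Entry
    rw [hσ']
    simp only [isPair_pair, fst_pair, snd_pair, true_and]
    refine ⟨fun h => h.2, fun h => ⟨?_, h⟩⟩
    rw [← h.2]; exact hb i h.1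
  have hs : IsSeqLen σ l := by
    refine ⟨hσ, fun z hz => ?_, fun i hi => ⟨f i, (he _ _).2 ⟨hi, rfl⟩, fun y hy => ?_⟩⟩
    · obtain ⟨_, h1, h2, _⟩ := (hσ' z).1 hz
      exact ⟨fst z, snd z, h2, (pair_fst_snd h1).symm⟩
    · exact ((he _ _).1 hy).2.symm
  exact ⟨σ, ⟨l, hs⟩, hs.len_eq, fun i hi => hs.ent_eq ((he _ _).2 ⟨hi, rfl⟩)⟩

/-- The empty sequence. -/
noncomputable def nil : M.Num := (exists_seq (M := M) (RecF.const 0) 0).choose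

theorem isSeq_nil : IsSeq (nil : M.Num) := (exists_seq (M := M) (RecF.const 0) 0).choose_spec.1

@[simp] theorem len_nil : len (nil : M.Num) = 0 :=
  (exists_seq (M := M) (RecF.const 0) 0).choose_spec.2.1

theorem eq_nil {σ : M.Num} (h : IsSeq σ) (hl : len σ = 0) : σ = nil :=
  h.ext isSeq_nil (hl.trans len_nil.symm) fun i hi => absurd (hl ▸ hi) (zero_le' i).not_gt

open Classical in
theorem exists_snoc (σ m : M.Num) : ∃ ρ, IsSeq ρ ∧ len ρ = len σ + 1 ∧
    ∀ i < len σ + 1, ent ρ i = if i < len σ then ent σ i else m :=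
  exists_seq (by fun_prop) _

/-- The extension of a finite sequence by one entry. -/
noncomputable def snoc (σ m : M.Num) : M.Num := (exists_snoc σ m).choose

theorem isSeq_snoc (σ m : M.Num) : IsSeq (snoc σ m) := (exists_snoc σ m).choose_spec.1

@[simp] theorem len_snoc (σ m : M.Num) : len (snoc σ m) = len σ + 1 :=
  (exists_snoc σ m).choose_spec.2.1

theorem ent_snoc_of_lt {σ m i : M.Num} (h : i < len σ) : ent (snoc σ m) i = ent σ i :=
  ((exists_snoc σ m).choose_spec.2.2 i (h.trans (lt_add_one _))).trans (if_pos h)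

@[simp] theorem ent_snoc_last (σ m : M.Num) : ent (snoc σ m) (len σ) = m :=
  ((exists_snoc σ m).choose_spec.2.2 _ (lt_add_one _)).trans (if_neg (lt_irrefl _))

theorem eq_snoc_iff {σ m ρ : M.Num} : snoc σ m = ρ ↔ IsSeq ρ ∧ len ρ = len σ + 1 ∧
    (∀ i < len σ, ent ρ i = ent σ i) ∧ ent ρ (len σ) = m := by
  constructor
  · rintro rfl
    exact ⟨isSeq_snoc _ _, len_snoc _ _, fun i hi => ent_snoc_of_lt hi, ent_snoc_last _ _⟩
  · rintro ⟨h1, h2, h3, h4⟩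
    refine (isSeq_snoc σ m).ext h1 (by rw [len_snoc, h2]) fun i hi => ?_
    rw [len_snoc, lt_add_one_iff'] at hi
    rcases hi.lt_or_eq with h | rfl
    · rw [ent_snoc_of_lt h, h3 i h]
    · rw [ent_snoc_last, h4]

@[fun_prop]
theorem recF_snoc {f g : M.Num → M.Num} (hf : RecF f) (hg : RecF g) :
    RecF (fun c => snoc (f c) (g c)) := by
  refine RecF.of_iff _ ?_ fun c y => eq_snoc_iff
  fun_prop

theorem exists_restrict (σ l : M.Num) : ∃ ρ, IsSeq ρ ∧ len ρ = l ∧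
    ∀ i < l, ent ρ i = ent σ i :=
  exists_seq (by fun_prop) _

/-- The sequence of the first `l` entries of `σ`. -/
noncomputable def restrict (σ l : M.Num) : M.Num := (exists_restrict σ l).choose

theorem isSeq_restrict (σ l : M.Num) : IsSeq (restrict σ l) := (exists_restrict σ l).choose_spec.1

@[simp] theorem len_restrict (σ l : M.Num) : len (restrict σ l) = l :=
  (exists_restrict σ l).choose_spec.2.1

theorem ent_restrict {σ l i : M.Num} (h : i < l) : ent (restrict σ l) i = ent σ i :=
  (exists_restrict σ l).choose_spec.2.2 i h

/-! ### Initial segments -/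

/-- `σ` is an initial segment of `ρ`, both taken as finite sequences. -/
def Sub (σ ρ : M.Num) : Prop := len σ ≤ len ρ ∧ ∀ i < len σ, ent σ i = ent ρ i

@[fun_prop]
theorem rec_sub {f g : M.Num → M.Num} (hf : RecF f) (hg : RecF g) :
    Rec (fun c => Sub (f c) (g c)) := by
  unfold Sub
  fun_prop

theorem Sub.refl (σ : M.Num) : Sub σ σ := ⟨le_rfl, fun _ _ => rfl⟩

theorem Sub.trans {σ ρ π : M.Num} (h : Sub σ ρ) (h' : Sub ρ π) : Sub σ π :=
  ⟨h.1.trans h'.1, fun i hi => (h.2 i hi).trans (h'.2 i (hi.trans_le h.1))⟩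

theorem sub_snoc (σ m : M.Num) : Sub σ (snoc σ m) :=
  ⟨by rw [len_snoc]; exact le_self_add, fun i hi => (ent_snoc_of_lt hi).symm⟩

theorem initSeg_iff {σ ρ : M.Num} : InitSeg σ ρ ↔ IsSeq σ ∧ IsSeq ρ ∧ Sub σ ρ := by
  constructor
  · rintro ⟨l, l', h1, h2, hl, h3⟩
    obtain ⟨h1', rfl⟩ := isSeqLen_iff.1 h1
    obtain ⟨h2', rfl⟩ := isSeqLen_iff.1 h2
    refine ⟨h1', h2', hl, fun i hi => ?_⟩
    exact (h2'.entry_iff.1 ((h3 i hi _).1 (h1'.entry_iff.2 ⟨hi, rfl⟩))).2.symm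
  · rintro ⟨h1, h2, hl, h3⟩
    refine ⟨_, _, h1.isSeqLen, h2.isSeqLen, hl, fun i hi x => ?_⟩
    rw [h1.entry_iff, h2.entry_iff, h3 i hi]
    simp [hi, hi.trans_le hl]

theorem isSnoc_iff {σ m ρ : M.Num} : IsSnoc σ m ρ ↔ IsSeq σ ∧ ρ = snoc σ m := by
  constructor
  · rintro ⟨l, h1, h2, h3, h4⟩
    obtain ⟨h1', rfl⟩ := isSeqLen_iff.1 h1
    obtain ⟨h2', h5⟩ := isSeqLen_iff.1 h2
    refine ⟨h1', (eq_snoc_iff.2 ⟨h2', h5, fun i hi => ?_, (h2'.entry_iff.1 h4).2⟩).symm⟩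
    exact (h2'.entry_iff.1 ((h3 i hi _).1 (h1'.entry_iff.2 ⟨hi, rfl⟩))).2
  · rintro ⟨h1, rfl⟩
    refine ⟨len σ, h1.isSeqLen, isSeqLen_iff.2 ⟨isSeq_snoc _ _, len_snoc _ _⟩, fun i hi x => ?_,
      (isSeq_snoc _ _).entry_iff.2 ⟨by rw [len_snoc]; exact lt_add_one _, ent_snoc_last _ _⟩⟩
    rw [h1.entry_iff, (isSeq_snoc _ _).entry_iff, ent_snoc_of_lt hi, len_snoc]
    simp [hi, hi.trans (lt_add_one _)]

theorem isSingleton_iff {σ m : M.Num} : IsSingleton σ m ↔ σ = snoc nil m := by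
  unfold IsSingleton
  rw [isSeqLen_iff, eq_comm (a := σ), eq_snoc_iff, len_nil, zero_add]
  constructor
  · rintro ⟨⟨h1, h2⟩, h3⟩
    exact ⟨h1, h2, fun i hi => absurd hi (zero_le' i).not_gt, (h1.entry_iff.1 h3).2⟩
  · rintro ⟨h1, h2, -, h3⟩
    exact ⟨⟨h1, h2⟩, h1.entry_iff.2 ⟨h2 ▸ zero_lt_one, h3⟩⟩

theorem isLast_iff {σ a : M.Num} : IsLast σ a ↔ IsSeq σ ∧ ∃ l, len σ = l + 1 ∧ ent σ l = a := by
  constructor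
  · rintro ⟨n, h1, h2⟩
    obtain ⟨h1', h3⟩ := isSeqLen_iff.1 h1
    exact ⟨h1', n, h3, (h1'.entry_iff.1 h2).2⟩
  · rintro ⟨h, n, h1, h2⟩
    exact ⟨n, isSeqLen_iff.2 ⟨h, h1⟩, h.entry_iff.2 ⟨h1 ▸ lt_add_one _, h2⟩⟩

theorem isLast_snoc {σ m a : M.Num} : IsLast (snoc σ m) a ↔ a = m := by
  rw [isLast_iff]
  constructor
  · rintro ⟨_, l, h1, rfl⟩
    rw [len_snoc] at h1
    rw [← add_right_cancel h1, ent_snoc_last]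
  · rintro rfl
    exact ⟨isSeq_snoc _ _, len σ, len_snoc _ _, ent_snoc_last _ _⟩

theorem eq_zero_or_exists_add_one (n : M.Num) : n = 0 ∨ ∃ m, n = m + 1 := by
  rcases (zero_le' n).eq_or_lt with h | h
  · exact Or.inl h.symm
  · obtain ⟨d, hd⟩ := (lt_iff_exists_add _ _).1 h
    exact Or.inr ⟨d, by rw [← hd, zero_add]⟩

/-- A finite sequence is empty or the extension of a finite sequence by one entry. -/
theorem IsSeq.eq_nil_or_snoc {σ : M.Num} (h : IsSeq σ) :
    σ = nil ∨ ∃ ρ m, IsSeq ρ ∧ σ = snoc ρ m := by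
  rcases eq_zero_or_exists_add_one (len σ) with h1 | ⟨l, h1⟩
  · exact Or.inl (eq_nil h h1)
  · refine Or.inr ⟨restrict σ l, ent σ l, isSeq_restrict _ _, (eq_snoc_iff.2 ⟨h, ?_, ?_, ?_⟩).symm⟩
    · rw [h1, len_restrict]
    · intro i hi
      rw [len_restrict] at hi
      rw [ent_restrict hi]
    · rw [len_restrict]

end L2Structure

namespace L2Structure

variable {M : L2Structure.{u}} [hM : Fact M.RCA0]

/-! ### Recursion and choice -/

theorem exists_recF_choice {Q : M.Num → M.Num → Prop} (hQ : Rec (fun z => Q (fst z) (snd z)))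
    (h : ∀ a, ∃ b, Q a b) : ∃ F : M.Num → M.Num, RecF F ∧ ∀ a, Q a (F a) := by
  have hl : ∀ a, ∃ b, Q a b ∧ ∀ k < b, ¬ Q a k := fun a =>
    exists_least (hQ.comp₂ (RecF.const a) RecF.id) (h a).choose_spec
  choose F hF hF' using hl
  refine ⟨F, RecF.of_iff (fun a b => Q a b ∧ ∀ k < b, ¬ Q a k) ?_ fun a b => ?_, hF⟩
  · have h1 : Rec (fun z => ∀ k < snd z, ¬ Q (fst z) k) :=
      rec_forall_lt (P := fun z k => ¬ Q (fst z) k) (by fun_prop)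
        (hQ.comp₂ (by fun_prop) (by fun_prop)).not
    exact hQ.and h1
  · constructor
    · rintro rfl
      exact ⟨hF a, hF' a⟩
    · rintro ⟨h1, h2⟩
      rcases lt_trichotomy (F a) b with h3 | h3 | h3
      · exact absurd (hF a) (h2 _ h3)
      · exact h3
      · exact absurd h1 (hF' a _ h3)

/-- Iteration of a function of the model. -/
theorem exists_iterate {F : M.Num → M.Num} (hF : RecF F) (a : M.Num) :
    ∃ g : M.Num → M.Num, RecF g ∧ g 0 = a ∧ ∀ n, g (n + 1) = F (g n) := by
  let P : M.Num → M.Num → Prop := fun n σ => IsSeq σ ∧ len σ = n + 1 ∧ ent σ 0 = a ∧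
    ∀ i < n, ent σ (i + 1) = F (ent σ i)
  have hP : Rec (fun z => P (fst z) (snd z)) := by
    simp only [P]
    fun_prop
  have hex : ∀ n, ∃ σ, P n σ := by
    refine sigma1_induction hP ?_ ?_
    · refine ⟨snoc nil a, isSeq_snoc _ _, by simp, ?_, fun i hi => absurd hi (zero_le' i).not_gt⟩
      have := ent_snoc_last (nil : M.Num) a
      rwa [len_nil] at this
    · rintro n ⟨σ, h1, h2, h3, h4⟩
      refine ⟨snoc σ (F (ent σ n)), isSeq_snoc _ _, by rw [len_snoc, h2], ?_, fun i hi => ?_⟩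
      · rw [ent_snoc_of_lt, h3]
        rw [h2]; exact (lt_add_one_iff' _ _).2 (zero_le' _)
      · rw [ent_snoc_of_lt (i := i) (by rwa [h2])]
        rcases ((lt_add_one_iff' _ _).1 hi).lt_or_eq with h | rfl
        · rw [ent_snoc_of_lt, h4 i h]
          rw [h2]; exact add_lt_add_of_lt_of_le h le_rfl
        · rw [← h2, ent_snoc_last]
  have huniq : ∀ n σ n' σ', P n σ → P n' σ' → ∀ i, i ≤ n → i ≤ n' → ent σ i = ent σ' i := by
    intro n σ n' σ' h h'
    refine rec_induction (P := fun i => i ≤ n → i ≤ n' → ent σ i = ent σ' i) (by fun_prop) ?_ ?_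
    · intro _ _
      rw [h.2.2.1, h'.2.2.1]
    · intro i ih hi hi'
      rw [h.2.2.2 i (lt_iff_add_one_le'.2 hi), h'.2.2.2 i (lt_iff_add_one_le'.2 hi'),
        ih (le_self_add.trans hi) (le_self_add.trans hi')]
  choose s hs using hex
  refine ⟨fun n => ent (s n) n, ?_, (hs 0).2.2.1, fun n => ?_⟩
  · have h1 : Rec (fun z => ∃ σ, P (fst z) σ ∧ ent σ (fst z) = snd z) := by
      refine rec_exists_of_iff_forall (P := fun z σ => P (fst z) σ ∧ ent σ (fst z) = snd z)
        (Q := fun z σ => P (fst z) σ → ent σ (fst z) = snd z) ?_ ?_ fun z => ⟨?_, fun h => ?_⟩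
      · exact (hP.comp₂ (f := fun z => fst (fst z)) (g := fun z => snd z) (by fun_prop)
          (by fun_prop)).and (by fun_prop)
      · exact (hP.comp₂ (f := fun z => fst (fst z)) (g := fun z => snd z) (by fun_prop)
          (by fun_prop)).imp (by fun_prop)
      · rintro ⟨σ, hσ, h⟩ σ' hσ'
        rw [← h]
        exact huniq _ _ _ _ hσ' hσ _ le_rfl le_rfl
      · exact ⟨_, hs (fst z), h _ (hs _)⟩
    refine RecF.of_iff (fun n y => ∃ σ, P n σ ∧ ent σ n = y) h1
      fun n y => ⟨fun h => ⟨_, hs n, h⟩, ?_⟩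
    rintro ⟨σ, hσ, h⟩
    rw [← h]
    exact huniq _ _ _ _ (hs n) hσ _ le_rfl le_rfl
  · change ent (s (n + 1)) (n + 1) = F (ent (s n) n)
    rw [(hs (n + 1)).2.2.2 n (lt_add_one n),
      huniq _ _ _ _ (hs (n + 1)) (hs n) n le_self_add le_rfl]

theorem exists_dependent_choice {P : M.Num → Prop} (hP : Rec P) {T : M.Num → M.Num → Prop}
    (hT : Rec (fun z => T (fst z) (snd z))) {a : M.Num} (ha : P a)
    (h : ∀ a, P a → ∃ b, P b ∧ T a b) :
    ∃ g : M.Num → M.Num, RecF g ∧ g 0 = a ∧ ∀ n, P (g n) ∧ T (g n) (g (n + 1)) := by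
  obtain ⟨F, hF, hF'⟩ := exists_recF_choice (Q := fun a b => P a → P b ∧ T a b)
    ((hP.comp recF_fst_base).imp ((hP.comp recF_snd_base).and hT)) (fun a => by
      by_cases ha : P a
      · obtain ⟨b, hb⟩ := h a ha
        exact ⟨b, fun _ => hb⟩
      · exact ⟨0, fun h => absurd h ha⟩)
  obtain ⟨g, hg, hg0, hgs⟩ := exists_iterate hF a
  have hPg : ∀ n, P (g n) := by
    refine rec_induction (P := fun n => P (g n)) (by fun_prop) (by rwa [hg0]) fun n hn => ?_
    rw [hgs]
    exact (hF' _ hn).1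
  refine ⟨g, hg, hg0, fun n => ⟨hPg n, ?_⟩⟩
  rw [hgs]
  exact (hF' _ (hPg n)).2

/-! ### Functions of the model as sets -/

/-- The graph of a function. -/
def graph (g : M.Num → M.Num) : Set M.Num := {z | ∃ c, z = pair c (g c)}

theorem pair_mem_graph_iff {g : M.Num → M.Num} {a b : M.Num} : pair a b ∈ graph g ↔ g a = b :=
  pair_mem_graph

omit hM in
theorem RecF.graph_mem {g : M.Num → M.Num} (hg : RecF g) : graph g ∈ M.Sets := hg

theorem isFun_graph {g : M.Num → M.Num} {A : Set M.Num} (h : ∀ n, g n ∈ A) :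
    IsFun (graph g) Set.univ A :=
  ⟨fun _ ⟨c, hc⟩ => ⟨c, trivial, g c, h c, hc⟩, fun a _ => ⟨g a, pair_mem_graph_iff.2 rfl,
    fun _ hb => (pair_mem_graph_iff.1 hb).symm⟩⟩

theorem exists_recF_of_isFun {F A : Set M.Num} (hF : F ∈ M.Sets) (h : IsFun F Set.univ A) :
    ∃ g : M.Num → M.Num, RecF g ∧ F = graph g ∧ ∀ a, g a ∈ A := by
  choose g hg hu using fun a => h.2 a trivial
  have hiff : ∀ a b, pair a b ∈ F ↔ g a = b := fun a b =>
    ⟨fun hb => (hu a b hb).symm, fun hb => hb ▸ hg a⟩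
  refine ⟨g, RecF.of_iff (fun a b => pair a b ∈ F) (by fun_prop (disch := assumption))
    fun a b => (hiff a b).symm, ?_, fun a => ?_⟩
  · ext z
    constructor
    · intro hz
      obtain ⟨a, _, b, _, rfl⟩ := h.1 z hz
      exact pair_mem_graph_iff.2 ((hiff a b).1 hz)
    · rintro ⟨c, rfl⟩
      exact (hiff _ _).2 rfl
  · obtain ⟨c, _, b, hb, hz⟩ := h.1 _ (hg a)
    rw [(pair_inj hz).2]; exact hb

/-- The sequence of the first `l` values of a function. -/
theorem isRestriction_graph {g : M.Num → M.Num} {l σ : M.Num} :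
    IsRestriction (graph g) l σ ↔ IsSeq σ ∧ len σ = l ∧ ∀ i < l, ent σ i = g i := by
  unfold IsRestriction
  rw [isSeqLen_iff]
  constructor
  · rintro ⟨⟨h1, rfl⟩, h2⟩
    exact ⟨h1, rfl, fun i hi => (h1.entry_iff.1 ((h2 i hi _).2 (pair_mem_graph_iff.2 rfl))).2⟩
  · rintro ⟨h1, rfl, h2⟩
    refine ⟨⟨h1, rfl⟩, fun i hi x => ?_⟩
    rw [h1.entry_iff, pair_mem_graph_iff, h2 i hi]
    simp [hi]

end L2Structure

namespace L2Structure

variable {M : L2Structure.{u}} [hM : Fact M.RCA0]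

theorem num_eq_cast (n : ℕ) : M.num n = (n : M.Num) := by
  induction n with
  | zero => simp [num]
  | succ n ih => simp [num, ih]

theorem two_mul_add_inj {q q' b b' : M.Num} (hb : b < 2) (hb' : b' < 2)
    (h : 2 * q + b = 2 * q' + b') : q = q' ∧ b = b' := by
  have aux : ∀ {q q' b b' : M.Num}, b < 2 → q < q' → 2 * q + b < 2 * q' + b' := by
    intro q q' b b' hb hq
    calc 2 * q + b < 2 * q + 2 := by gcongr
      _ = 2 * (q + 1) := by ring
      _ ≤ 2 * q' := mul_le_mul_of_nonneg_left (lt_iff_add_one_le'.1 hq) (zero_le' _)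
      _ ≤ 2 * q' + b' := le_self_add
  rcases lt_trichotomy q q' with h1 | rfl | h1
  · exact absurd h (aux hb h1).ne
  · exact ⟨rfl, add_left_cancel h⟩
  · exact absurd h.symm (aux hb' h1).ne

theorem one_lt_two' : (1 : M.Num) < 2 := one_lt_two

theorem exists_half (a : M.Num) : ∃ q, a = 2 * q ∨ a = 2 * q + 1 := by
  refine sigma1_induction (P := fun a q => a = 2 * q ∨ a = 2 * q + 1) (by fun_prop)
    ⟨0, by simp⟩ ?_ a
  rintro n ⟨q, rfl | rfl⟩
  · exact ⟨q, Or.inr rfl⟩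
  · exact ⟨q + 1, Or.inl (by ring)⟩

@[fun_prop]
theorem rec_isLast {f g : M.Num → M.Num} (hf : RecF f) (hg : RecF g) :
    Rec (fun c => IsLast (f c) (g c)) := by
  have : Rec (fun c => IsSeq (f c) ∧ ∃ l < len (f c), len (f c) = l + 1 ∧ ent (f c) l = g c) := by
    fun_prop
  refine this.congr fun c => isLast_iff.trans (and_congr_right fun _ => exists_congr fun l => ?_)
  exact ⟨fun h => ⟨h.1 ▸ lt_add_one l, h⟩, fun h => h.2⟩

/-! ### Trees of paths through a relation -/

/-- The tree of the finite paths through the relation `A` that start at `a₀`. -/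
def pathTree (A : M.Num → M.Num → Prop) (a₀ : M.Num) : Set M.Num :=
  {σ | IsSeq σ ∧ (0 < len σ → ent σ 0 = a₀) ∧
    ∀ i < len σ, i + 1 < len σ → A (ent σ i) (ent σ (i + 1))}

section PathTree

variable {A : M.Num → M.Num → Prop} {a₀ : M.Num}

theorem pathTree_mem_sets (hA : Rec (fun z => A (fst z) (snd z))) : pathTree A a₀ ∈ M.Sets := by
  have h1 : Rec (fun σ : M.Num => ∀ i < len σ, i + 1 < len σ → A (ent σ i) (ent σ (i + 1))) :=
    rec_forall_lt (P := fun σ i => i + 1 < len σ → A (ent σ i) (ent σ (i + 1))) (by fun_prop)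
      (Rec.imp (by fun_prop) (hA.comp₂ (by fun_prop) (by fun_prop)))
  have h2 : Rec (fun σ : M.Num => IsSeq σ ∧ (0 < len σ → ent σ 0 = a₀)) := by fun_prop
  exact (h2.and h1).congr fun σ => and_assoc.symm

theorem singleton_mem_pathTree {m : M.Num} : snoc nil m ∈ pathTree A a₀ ↔ m = a₀ := by
  have h0 : ent (snoc (nil : M.Num) m) 0 = m := by
    have := ent_snoc_last (nil : M.Num) m
    rwa [len_nil] at this
  constructor
  · rintro ⟨_, h, _⟩
    rw [← h (by simp), h0]
  · rintro rfl
    refine ⟨isSeq_snoc _ _, fun _ => h0, fun i hi hi' => ?_⟩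
    rw [len_snoc, len_nil, zero_add] at hi'
    exact absurd hi' (not_lt.2 le_add_self)

theorem sub_mem_pathTree {σ ρ : M.Num} (hσ : σ ∈ pathTree A a₀) (hρ : IsSeq ρ) (h : Sub ρ σ) :
    ρ ∈ pathTree A a₀ := by
  refine ⟨hρ, fun h0 => ?_, fun i hi hi' => ?_⟩
  · rw [h.2 0 h0]; exact hσ.2.1 (h0.trans_le h.1)
  · rw [h.2 i hi, h.2 _ hi']
    exact hσ.2.2 i (hi.trans_le h.1) (hi'.trans_le h.1)

theorem snoc_snoc_mem_pathTree {σ a b : M.Num} :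
    snoc (snoc σ a) b ∈ pathTree A a₀ ↔ snoc σ a ∈ pathTree A a₀ ∧ A a b := by
  have hlt : len σ < len (snoc σ a) := by rw [len_snoc]; exact lt_add_one _
  have ha : ent (snoc (snoc σ a) b) (len σ) = a := by
    rw [ent_snoc_of_lt hlt, ent_snoc_last]
  have hb : ent (snoc (snoc σ a) b) (len σ + 1) = b := by
    have := ent_snoc_last (snoc σ a) b
    rwa [len_snoc] at this
  constructor
  · intro h
    refine ⟨sub_mem_pathTree h (isSeq_snoc _ _) (sub_snoc _ _), ?_⟩
    have := h.2.2 (len σ) (by simp [add_assoc]) (by simp)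
    rwa [ha, hb] at this
  · rintro ⟨⟨_, h1, h2⟩, h3⟩
    refine ⟨isSeq_snoc _ _, fun _ => ?_, fun i hi hi' => ?_⟩
    · have h0 : 0 < len (snoc σ a) := (zero_le' _).trans_lt hlt
      rw [ent_snoc_of_lt h0]
      exact h1 h0
    · rw [len_snoc] at hi'
      have hi2 : i < len (snoc σ a) := by simpa using hi'
      rw [ent_snoc_of_lt hi2]
      by_cases h4 : i + 1 < len (snoc σ a)
      · rw [ent_snoc_of_lt h4]
        exact h2 i hi2 h4
      · have h5 : i = len σ := by
          rw [len_snoc] at hi2 h4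
          exact le_antisymm ((lt_add_one_iff' _ _).1 hi2) (by simpa using h4)
        rw [h5, ent_snoc_last, hb]
        exact h3

theorem isBorelCode_pathTree (hA : Rec (fun z => A (fst z) (snd z)))
    (h : ¬ ∃ g : M.Num → M.Num, RecF g ∧ g 0 = a₀ ∧ ∀ n, A (g n) (g (n + 1))) :
    M.IsBorelCode (pathTree A a₀) where
  mem_sets := pathTree_mem_sets hA
  tree := ⟨fun σ hσ => hσ.1, fun σ hσ ρ hρ =>
    sub_mem_pathTree hσ (initSeg_iff.1 hρ).1 (initSeg_iff.1 hρ).2.2⟩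
  no_path := by
    rintro ⟨G, hG, hG', hp⟩
    obtain ⟨g, hg, hGg, -⟩ := exists_recF_of_isFun hG hG'
    refine h ⟨g, hg, ?_, fun n => ?_⟩
    · obtain ⟨σ, hσ, hσ'⟩ := hp 1
      rw [hGg, isRestriction_graph] at hσ'
      rw [← hσ'.2.2 0 zero_lt_one]
      exact hσ.2.1 (by rw [hσ'.2.1]; exact zero_lt_one)
    · obtain ⟨σ, hσ, hσ'⟩ := hp (n + 1 + 1)
      rw [hGg, isRestriction_graph] at hσ'
      have h1 : n + 1 < n + 1 + 1 := lt_add_one _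
      have h2 : n < n + 1 + 1 := (lt_add_one _).trans h1
      rw [← hσ'.2.2 n h2, ← hσ'.2.2 (n + 1) h1]
      exact hσ.2.2 n (hσ'.2.1 ▸ h2) (hσ'.2.1 ▸ h1)
  root := by
    refine ⟨a₀, ⟨snoc nil a₀, singleton_mem_pathTree.2 rfl, isSingleton_iff.2 rfl⟩, ?_⟩
    rintro m ⟨σ, hσ, hm⟩
    rw [isSingleton_iff] at hm
    subst hm
    exact singleton_mem_pathTree.1 hσ

theorem isLeaf_pathTree {σ a : M.Num} :
    IsLeaf (pathTree A a₀) (snoc σ a) ↔ snoc σ a ∈ pathTree A a₀ ∧ ∀ b, ¬ A a b := by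
  refine and_congr_right fun h => ?_
  simp only [isSnoc_iff]
  constructor
  · intro h1 b hb
    exact h1 ⟨b, _, snoc_snoc_mem_pathTree.2 ⟨h, hb⟩, isSeq_snoc _ _, rfl⟩
  · rintro h1 ⟨b, ρ, hρ, _, rfl⟩
    exact h1 b (snoc_snoc_mem_pathTree.1 hρ).2

variable {τ x f : Set M.Num} (hf : M.IsEvaluation τ (pathTree A a₀) x f) {σ : M.Num}
include hf

theorem IsEvaluation.pathTree_union {a b₀ : M.Num} (ha : snoc σ (2 * a) ∈ pathTree A a₀)
    (hb₀ : A (2 * a) b₀) : pair (snoc σ (2 * a)) 1 ∈ f ↔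
      ∃ b, A (2 * a) b ∧ pair (snoc (snoc σ (2 * a)) b) 1 ∈ f := by
  rw [hf.union _ (2 * a) ha (fun h => (isLeaf_pathTree.1 h).2 _ hb₀) (isLast_snoc.2 rfl)
    ⟨a, by simp [num_eq_cast]⟩]
  constructor
  · rintro ⟨b, ρ, hρ, h1, h2⟩
    obtain ⟨_, rfl⟩ := isSnoc_iff.1 h1
    exact ⟨b, (snoc_snoc_mem_pathTree.1 hρ).2, h2⟩
  · rintro ⟨b, hb, h2⟩
    exact ⟨b, _, snoc_snoc_mem_pathTree.2 ⟨ha, hb⟩, isSnoc_iff.2 ⟨isSeq_snoc _ _, rfl⟩, h2⟩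

theorem IsEvaluation.pathTree_inter {a b₀ : M.Num} (ha : snoc σ (2 * a + 1) ∈ pathTree A a₀)
    (hb₀ : A (2 * a + 1) b₀) : pair (snoc σ (2 * a + 1)) 1 ∈ f ↔
      ∀ b, A (2 * a + 1) b → pair (snoc (snoc σ (2 * a + 1)) b) 1 ∈ f := by
  rw [hf.inter _ (2 * a + 1) ha (fun h => (isLeaf_pathTree.1 h).2 _ hb₀) (isLast_snoc.2 rfl)
    ⟨a, by simp [num_eq_cast]⟩]
  constructor
  · intro h b hb
    exact h b _ (snoc_snoc_mem_pathTree.2 ⟨ha, hb⟩) (isSnoc_iff.2 ⟨isSeq_snoc _ _, rfl⟩)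
  · rintro h b ρ hρ h1
    obtain ⟨_, rfl⟩ := isSnoc_iff.1 h1
    exact h b (snoc_snoc_mem_pathTree.1 hρ).2

theorem IsEvaluation.pathTree_leaf_zero (ha : snoc σ 0 ∈ pathTree A a₀) (h0 : ∀ b, ¬ A 0 b) :
    pair (snoc σ 0) 1 ∉ f := by
  rw [hf.leaf _ 0 (isLeaf_pathTree.2 ⟨ha, h0⟩) (isLast_snoc.2 rfl)]
  rintro (h | ⟨m, t, -, ⟨h, -⟩ | ⟨h, -⟩⟩)
  · exact zero_ne_one h
  · replace h := h.symm
    simp [num_eq_cast] at h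
  · replace h := h.symm
    simp [num_eq_cast] at h

theorem IsEvaluation.pathTree_leaf_one (ha : snoc σ 1 ∈ pathTree A a₀) (h0 : ∀ b, ¬ A 1 b) :
    pair (snoc σ 1) 1 ∈ f := by
  rw [hf.leaf _ 1 (isLeaf_pathTree.2 ⟨ha, h0⟩) (isLast_snoc.2 rfl)]
  exact Or.inl rfl

end PathTree

end L2Structure

namespace L2Structure

variable {M : L2Structure.{u}} [hM : Fact M.RCA0]

/-! ### Well founded games -/

/-- The tree relation of a game with the moves `R`.  The position `q` is represented by the labels
`2(q + 2)` and `2(q + 2) + 1`, whose parity alternates along a play; the label `2` is the root, from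
which every position is reached, and each position has an additional leaf, labelled by the neutral
element of its operation. -/
def gameRel (R : M.Num → M.Num → Prop) (a a' : M.Num) : Prop :=
  (a = 2 ∧ 4 ≤ a') ∨ ∃ q ≤ a, ∃ b < 2, a = 2 * (q + 2) + b ∧
    (a' = b ∨ ∃ q' ≤ a', ∃ b' < 2, b + b' = 1 ∧ a' = 2 * (q' + 2) + b' ∧ R q q')

section Game

variable {R : M.Num → M.Num → Prop}

theorem rec_gameRel (hR : Rec (fun z => R (fst z) (snd z))) :
    Rec (fun z => gameRel R (fst z) (snd z)) := by
  have key : ∀ z : M.Num, gameRel R (fst z) (snd z) ↔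
      (fst z = 2 ∧ 4 ≤ snd z) ∨ ∃ q ≤ fst z, ∃ b < 2, fst z = 2 * (q + 2) + b ∧
      (snd z = b ∨ ∃ q' ≤ snd z, ∃ b' < 2, b + b' = 1 ∧ snd z = 2 * (q' + 2) + b' ∧
        pair q q' ∈ {z | R (fst z) (snd z)}) := by
    intro z
    simp [gameRel]
  have hS : {z | R (fst z) (snd z)} ∈ M.Sets := hR
  refine Rec.congr ?_ key
  fun_prop (disch := assumption)

theorem gameRel_root {R : M.Num → M.Num → Prop} (q : M.Num) : gameRel R 2 (2 * (q + 2)) :=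
  Or.inl ⟨rfl, by
    calc (4 : M.Num) = 2 * 2 := by norm_num
      _ ≤ 2 * (q + 2) := mul_le_mul_of_nonneg_left le_add_self (zero_le' _)⟩

theorem le_label (q b : M.Num) : q ≤ 2 * (q + 2) + b := by
  calc q ≤ q + (q + 4 + b) := le_self_add
    _ = 2 * (q + 2) + b := by ring

theorem label_ne_two (q b : M.Num) : (2 : M.Num) ≠ 2 * (q + 2) + b := by
  refine ne_of_lt ?_
  calc (2 : M.Num) < 4 := by norm_num
    _ ≤ 4 + (2 * q + b) := le_self_add
    _ = 2 * (q + 2) + b := by ring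

theorem not_lt_two_label (q b : M.Num) : ¬ 2 * (q + 2) + b < 2 := by
  refine not_lt.2 ?_
  calc (2 : M.Num) ≤ 2 + (2 * q + 2 + b) := le_self_add
    _ = 2 * (q + 2) + b := by ring

theorem not_gameRel_of_lt_two {a b : M.Num} (ha : a < 2) : ¬ gameRel R a b := by
  rintro (⟨rfl, _⟩ | ⟨q, _, b, _, rfl, _⟩)
  · exact lt_irrefl _ ha
  · exact not_lt_two_label _ _ ha

theorem gameRel_label {q b a' : M.Num} (hb : b < 2) : gameRel R (2 * (q + 2) + b) a' ↔
    a' = b ∨ ∃ q' b', b' < 2 ∧ b + b' = 1 ∧ a' = 2 * (q' + 2) + b' ∧ R q q' := by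
  constructor
  · rintro (⟨h, _⟩ | ⟨q₁, _, b₁, hb₁, h, h'⟩)
    · exact absurd h.symm (label_ne_two _ _)
    · obtain ⟨h1, rfl⟩ := two_mul_add_inj hb hb₁ h
      obtain rfl := add_right_cancel h1
      rcases h' with h' | ⟨q', _, b', h'⟩
      · exact Or.inl h'
      · exact Or.inr ⟨q', b', h'⟩
  · intro h
    refine Or.inr ⟨q, le_label _ _, b, hb, rfl, h.imp id ?_⟩
    rintro ⟨q', b', h1, h2, rfl, h3⟩
    exact ⟨q', le_label _ _, b', h1, h2, rfl, h3⟩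

theorem gameRel_even {q a' : M.Num} : gameRel R (2 * (q + 2)) a' ↔
    a' = 0 ∨ ∃ q', a' = 2 * (q' + 2) + 1 ∧ R q q' := by
  have := gameRel_label (R := R) (q := q) (b := 0) (a' := a') two_pos
  rw [add_zero] at this
  rw [this]
  refine or_congr_right (exists_congr fun q' => ⟨?_, ?_⟩)
  · rintro ⟨b', _, h, h1⟩
    rw [zero_add] at h
    rwa [h] at h1
  · exact fun h => ⟨1, one_lt_two', zero_add 1, h⟩

theorem gameRel_odd {q a' : M.Num} : gameRel R (2 * (q + 2) + 1) a' ↔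
    a' = 1 ∨ ∃ q', a' = 2 * (q' + 2) ∧ R q q' := by
  rw [gameRel_label one_lt_two']
  refine or_congr_right (exists_congr fun q' => ⟨?_, ?_⟩)
  · rintro ⟨b', _, h, h1⟩
    have : b' = 0 := by simpa using h
    rwa [this, add_zero] at h1
  · exact fun h => ⟨0, two_pos, add_zero 1, by rwa [add_zero]⟩

theorem no_path_gameRel (h : ¬ ∃ g : M.Num → M.Num, RecF g ∧ ∀ n, R (g n) (g (n + 1))) :
    ¬ ∃ g : M.Num → M.Num, RecF g ∧ g 0 = 2 ∧ ∀ n, gameRel R (g n) (g (n + 1)) := by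
  rintro ⟨g, hg, hg0, hgs⟩
  have h1 : ∀ n, ∃ q, ∃ b < 2, g (n + 1) = 2 * (q + 2) + b := by
    have h2 : ∀ n, g (n + 1) ≠ 2 := by
      have hr : Rec (fun n => g (n + 1) ≠ 2) := by fun_prop
      refine rec_induction hr ?_ fun n ih => ?_
      · rcases hgs 0 with ⟨_, h2⟩ | ⟨q, _, b, _, h2, _⟩
        · intro h3
          rw [h3] at h2
          exact absurd h2 (by norm_num)
        · exact absurd (hg0.symm.trans h2) (label_ne_two _ _)
      · rcases hgs (n + 1) with ⟨h2, _⟩ | ⟨q, _, b, hb, h2, h3 | ⟨q', _, b', _, _, h3, _⟩⟩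
        · exact absurd h2 ih
        · rw [h3]; exact hb.ne
        · rw [h3]; exact (label_ne_two _ _).symm
    intro n
    rcases hgs (n + 1) with ⟨h3, _⟩ | ⟨q, _, b, hb, h3, _⟩
    · exact absurd h3 (h2 n)
    · exact ⟨q, b, hb, h3⟩
  obtain ⟨p, hp, hp'⟩ := exists_recF_choice
    (Q := fun n q => ∃ b < 2, g (n + 1) = 2 * (q + 2) + b) (by fun_prop) h1
  refine h ⟨p, hp, fun n => ?_⟩
  obtain ⟨b, hb, h2⟩ := hp' n
  obtain ⟨b₁, hb₁, h3⟩ := hp' (n + 1)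
  have h4 := hgs (n + 1)
  rw [h2, h3, gameRel_label hb] at h4
  rcases h4 with h4 | ⟨q', b', hb', _, h5, h6⟩
  · exact absurd (h4 ▸ hb) (not_lt_two_label _ _)
  · have h7 := (two_mul_add_inj hb₁ hb' h5).1
    rwa [add_right_cancel h7]

/-- A Borel code that is evaluated at some point gives the values of the positions of a well
founded game, in which a position is won if there is a move to a position that is not won. -/
theorem exists_game_value {k : ℕ} {τ : Set M.Num} (h : M.BorelCodesHaveEvaluatedPoint k τ)
    (hR : Rec (fun z => R (fst z) (snd z)))
    (hwf : ¬ ∃ g : M.Num → M.Num, RecF g ∧ ∀ n, R (g n) (g (n + 1))) :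
    ∃ V : M.Num → Prop, Rec V ∧ ∀ q, V q ↔ ∃ q', R q q' ∧ ¬ V q' := by
  set T := pathTree (gameRel R) 2 with hT
  have hTs : T ∈ M.Sets := pathTree_mem_sets (rec_gameRel hR)
  obtain ⟨x, f, hf⟩ : ∃ x f, M.IsEvaluation τ T x f := by
    obtain ⟨x, _, ⟨f, hf, _⟩ | ⟨f, hf, _⟩⟩ := h T
      (isBorelCode_pathTree (rec_gameRel hR) (no_path_gameRel hwf))
    · exact ⟨x, f, hf⟩
    · exact ⟨x, f, hf⟩
  have hfs := hf.mem_sets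
  let node : M.Num → M.Num → Prop := fun q σ =>
    σ ∈ T ∧ (IsLast σ (2 * (q + 2)) ∨ IsLast σ (2 * (q + 2) + 1))
  let val : M.Num → Prop := fun σ => (∃ c ≤ σ, IsLast σ (2 * c)) ↔ pair σ 1 ∈ f
  have hval0 : ∀ σ q, val (snoc σ (2 * q)) ↔ pair (snoc σ (2 * q)) 1 ∈ f := by
    intro σ q
    have : ∃ c ≤ snoc σ (2 * q), IsLast (snoc σ (2 * q)) (2 * c) := by
      refine ⟨q, ?_, isLast_snoc.2 rfl⟩
      have h1 := ent_lt (isSeq_snoc σ (2 * q)) (i := len σ) (by simp)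
      rw [ent_snoc_last] at h1
      refine le_trans ?_ h1.le
      rw [two_mul]; exact le_self_add
    simp only [val, this, true_iff]
  have hval1 : ∀ σ q, val (snoc σ (2 * q + 1)) ↔ pair (snoc σ (2 * q + 1)) 1 ∉ f := by
    intro σ q
    have : ¬ ∃ c ≤ snoc σ (2 * q + 1), IsLast (snoc σ (2 * q + 1)) (2 * c) := by
      rintro ⟨c, _, hc⟩
      have h1 : 2 * c + 0 = 2 * q + 1 := by rw [add_zero]; exact isLast_snoc.1 hc
      exact zero_ne_one (two_mul_add_inj two_pos one_lt_two' h1).2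
    simp only [val, this, false_iff]
  have hnode : ∀ q σ, node q σ → ∃ ρ,
      (σ = snoc ρ (2 * (q + 2)) ∨ σ = snoc ρ (2 * (q + 2) + 1)) := by
    rintro q σ ⟨h1, h2⟩
    rcases h1.1.eq_nil_or_snoc with rfl | ⟨ρ, m, _, rfl⟩
    · have : ∀ a, ¬ IsLast (nil : M.Num) a := by
        intro a ha
        obtain ⟨_, l, hl, _⟩ := isLast_iff.1 ha
        rw [len_nil] at hl
        exact hM.out.basic.succ_ne_zero l hl.symm
      rcases h2 with h2 | h2 <;> exact absurd h2 (this _)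
    · rw [isLast_snoc, isLast_snoc] at h2
      exact ⟨ρ, by rcases h2 with h2 | h2 <;> simp [h2]⟩
  have step : ∀ q σ, node q σ → val σ → ∃ q', R q q' ∧ ∃ σ', node q' σ' ∧ ¬ val σ' := by
    intro q σ hσ hv
    obtain ⟨ρ, rfl | rfl⟩ := hnode q σ hσ
    · rw [hval0, hf.pathTree_union hσ.1 (gameRel_even.2 (Or.inl rfl))] at hv
      obtain ⟨b, hb, hv⟩ := hv
      have hmem := snoc_snoc_mem_pathTree.2 ⟨hσ.1, hb⟩
      rcases gameRel_even.1 hb with rfl | ⟨q', rfl, hq'⟩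
      · exact absurd hv (hf.pathTree_leaf_zero hmem fun b => not_gameRel_of_lt_two two_pos)
      · exact ⟨q', hq', _, ⟨hmem, Or.inr (isLast_snoc.2 rfl)⟩, by rwa [hval1, not_not]⟩
    · rw [hval1, hf.pathTree_inter hσ.1 (gameRel_odd.2 (Or.inl rfl))] at hv
      push Not at hv
      obtain ⟨b, hb, hv⟩ := hv
      have hmem := snoc_snoc_mem_pathTree.2 ⟨hσ.1, hb⟩
      rcases gameRel_odd.1 hb with rfl | ⟨q', rfl, hq'⟩
      · exact absurd (hf.pathTree_leaf_one hmem fun b => not_gameRel_of_lt_two one_lt_two') hv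
      · exact ⟨q', hq', _, ⟨hmem, Or.inl (isLast_snoc.2 rfl)⟩, by rwa [hval0]⟩
  have step' : ∀ q σ, node q σ → ¬ val σ → ∀ q', R q q' → ∃ σ', node q' σ' ∧ val σ' := by
    intro q σ hσ hv q' hq'
    obtain ⟨ρ, rfl | rfl⟩ := hnode q σ hσ
    · rw [hval0, hf.pathTree_union hσ.1 (gameRel_even.2 (Or.inl rfl))] at hv
      push Not at hv
      have hb := gameRel_even.2 (Or.inr ⟨q', rfl, hq'⟩)
      exact ⟨_, ⟨snoc_snoc_mem_pathTree.2 ⟨hσ.1, hb⟩, Or.inr (isLast_snoc.2 rfl)⟩,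
        (hval1 _ _).2 (hv _ hb)⟩
    · rw [hval1, not_not, hf.pathTree_inter hσ.1 (gameRel_odd.2 (Or.inl rfl))] at hv
      have hb := gameRel_odd.2 (Or.inr ⟨q', rfl, hq'⟩)
      exact ⟨_, ⟨snoc_snoc_mem_pathTree.2 ⟨hσ.1, hb⟩, Or.inl (isLast_snoc.2 rfl)⟩,
        (hval0 _ _).2 (hv _ hb)⟩
  have cons : ∀ q σ σ', node q σ → node q σ' → val σ → val σ' := by
    intro q₀ σ₀ σ₀' h1 h2 h3
    by_contra h4
    have hr : Rec (fun z => node (fst z) (fst (snd z)) ∧ node (fst z) (snd (snd z)) ∧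
        val (fst (snd z)) ∧ ¬ val (snd (snd z))) := by
      simp only [node, val]
      fun_prop (disch := assumption)
    obtain ⟨g, hg, _, hg'⟩ := exists_dependent_choice hr (T := fun z z' => R (fst z) (fst z'))
      (hR.comp₂ (f := fun z => fst (fst z)) (g := fun z => fst (snd z)) (by fun_prop)
        (by fun_prop)) (a := pair q₀ (pair σ₀ σ₀')) (by simpa using ⟨h1, h2, h3, h4⟩) (by
        rintro z ⟨h1, h2, h3, h4⟩
        obtain ⟨q', hq', σ, hσ, hσ'⟩ := step _ _ h1 h3
        obtain ⟨ρ, hρ, hρ'⟩ := step' _ _ h2 h4 q' hq'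
        exact ⟨pair q' (pair ρ σ), by simpa using ⟨hρ, hσ, hρ', hσ'⟩, by simpa using hq'⟩)
    exact hwf ⟨fun n => fst (g n), by fun_prop, fun n => (hg' n).2⟩
  have hcan : ∀ q, node q (snoc (snoc nil 2) (2 * (q + 2))) := fun q =>
    ⟨snoc_snoc_mem_pathTree.2 ⟨singleton_mem_pathTree.2 rfl, gameRel_root q⟩,
      Or.inl (isLast_snoc.2 rfl)⟩
  refine ⟨fun q => val (snoc (snoc nil 2) (2 * (q + 2))), ?_, fun q => ⟨fun hv => ?_, ?_⟩⟩
  · simp only [val]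
    fun_prop (disch := assumption)
  · obtain ⟨q', hq', σ, hσ, hσ'⟩ := step _ _ (hcan q) hv
    exact ⟨q', hq', fun h => hσ' (cons q' _ _ (hcan q') hσ h)⟩
  · rintro ⟨q', hq', hv'⟩
    by_contra hv
    obtain ⟨σ, hσ, hσ'⟩ := step' _ _ (hcan q) hv q' hq'
    exact hv' (cons q' _ _ hσ (hcan q') hσ')

end Game

end L2Structure

namespace L2Structure

variable {M : L2Structure.{u}} [hM : Fact M.RCA0]

/-! ### Arithmetical comprehension -/

/-- The sets of the model are closed under projections. -/
def ClosedUnderExists (M : L2Structure.{u}) : Prop :=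
  ∀ P : M.Num → M.Num → Prop, Rec (fun z => P (fst z) (snd z)) → Rec (fun c => ∃ y, P c y)

theorem closedUnderExists_of_evaluated {k : ℕ} {τ : Set M.Num}
    (h : M.BorelCodesHaveEvaluatedPoint k τ) : ClosedUnderExists M := by
  intro P hP
  obtain ⟨V, hV, hV'⟩ := exists_game_value h
    (R := fun q q' => fst q = 0 ∧ IsPair q' ∧ fst q' = 1 ∧ P (snd q) (snd q'))
    (Rec.and (by fun_prop) (Rec.and (by fun_prop) (Rec.and (by fun_prop)
      (hP.comp₂ (f := fun z => snd (fst z)) (g := fun z => snd (snd z)) (by fun_prop)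
        (by fun_prop))))) (by
    rintro ⟨g, _, hg⟩
    exact zero_ne_one ((hg (0 + 1)).1.symm.trans (hg 0).2.2.1))
  have hr : Rec (fun c => V (pair 0 c)) := by fun_prop
  refine hr.congr fun c => ?_
  rw [hV']
  constructor
  · rintro ⟨y, hy⟩
    refine ⟨pair 1 y, by simpa [isPair_pair] using hy, fun h1 => ?_⟩
    obtain ⟨q, hq, _⟩ := (hV' _).1 h1
    simp at hq
  · rintro ⟨q, hq, _⟩
    exact ⟨snd q, by simpa using hq.2.2.2⟩

@[fun_prop]
theorem recF_termVal (t : ATerm) {v : ℕ → M.Num → M.Num} (hv : ∀ i, RecF (v i)) :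
    RecF (fun c => M.termVal (fun i => v i c) t) := by
  induction t with
  | var i => exact hv i
  | zero => exact RecF.const 0
  | one => exact RecF.const 1
  | add s t hs ht => exact recF_add hs ht
  | mul s t hs ht => exact recF_mul hs ht

/-- The assignments in a context with one more variable. -/
noncomputable def liftVar (v : ℕ → M.Num → M.Num) : ℕ → M.Num → M.Num
  | 0 => fun z => snd z
  | i + 1 => fun z => v i (fst z)

theorem recF_liftVar {v : ℕ → M.Num → M.Num} (hv : ∀ i, RecF (v i)) : ∀ i, RecF (liftVar v i)
  | 0 => recF_snd_base
  | i + 1 => (hv i).comp recF_fst_base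

omit hM in
theorem liftVar_eq (v : ℕ → M.Num → M.Num) (z : M.Num) :
    (fun i => liftVar v i z) = pushVar (snd z) (fun i => v i (fst z)) := by
  funext i
  cases i <;> rfl

theorem rec_sat (hex : ClosedUnderExists M) {E : ℕ → Set M.Num} (hE : ∀ i, E i ∈ M.Sets)
    (φ : AFormula) : ∀ {v : ℕ → M.Num → M.Num}, (∀ i, RecF (v i)) →
      Rec (fun c => M.Sat φ (fun i => v i c) E) := by
  induction φ with
  | eq s t => exact fun hv => rec_eq (recF_termVal s hv) (recF_termVal t hv)
  | lt s t => exact fun hv => rec_lt (recF_termVal s hv) (recF_termVal t hv)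
  | mem t X => exact fun hv => rec_mem (hE X) (recF_termVal t hv)
  | neg φ ih => exact fun hv => (ih hv).not
  | and φ ψ ih ih' => exact fun hv => (ih hv).and (ih' hv)
  | or φ ψ ih ih' => exact fun hv => (ih hv).or (ih' hv)
  | imp φ ψ ih ih' => exact fun hv => (ih hv).imp (ih' hv)
  | allLt t φ ih =>
    intro v hv
    refine rec_forall_lt (P := fun c x => M.Sat φ (pushVar x fun i => v i c) E)
      (recF_termVal t hv) ((ih (recF_liftVar hv)).congr fun z => ?_)
    rw [liftVar_eq]
  | exLt t φ ih =>
    intro v hv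
    refine rec_exists_lt (P := fun c x => M.Sat φ (pushVar x fun i => v i c) E)
      (recF_termVal t hv) ((ih (recF_liftVar hv)).congr fun z => ?_)
    rw [liftVar_eq]
  | ex φ ih =>
    intro v hv
    refine hex (fun c x => M.Sat φ (pushVar x fun i => v i c) E)
      ((ih (recF_liftVar hv)).congr fun z => ?_)
    rw [liftVar_eq]
  | all φ ih =>
    intro v hv
    refine (hex (fun c x => ¬ M.Sat φ (pushVar x fun i => v i c) E)
      ((ih (recF_liftVar hv)).not.congr fun z => ?_)).not.congr fun c => ?_
    · rw [liftVar_eq]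
    · push Not
      rfl

/-- The assignment of the variable `0` to the argument and of the others to constants. -/
def firstVar (e : ℕ → M.Num) : ℕ → M.Num → M.Num
  | 0 => fun n => n
  | i + 1 => fun _ => e i

theorem recF_firstVar (e : ℕ → M.Num) : ∀ i, RecF (firstVar e i)
  | 0 => RecF.id
  | i + 1 => RecF.const (e i)

omit hM in
theorem firstVar_eq (e : ℕ → M.Num) (n : M.Num) :
    (fun i => firstVar e i n) = pushVar n e := by
  funext i
  cases i <;> rfl

theorem aca0_of_closedUnderExists (hex : ClosedUnderExists M) : M.ACA0 where
  rca0 := hM.out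
  arithmetical_comprehension φ e E hE := by
    refine ⟨_, rec_sat hex hE φ (recF_firstVar e), fun n => ?_⟩
    rw [← firstVar_eq]
    rfl

theorem ACA0.closedUnderExists (h : M.ACA0) : ClosedUnderExists M := by
  intro P hP
  obtain ⟨X, hX, hX'⟩ := h.arithmetical_comprehension
    (.ex (.mem (pairTerm (.var 1) (.var 0)) 0)) (fun _ => 0) (fun _ => _) (fun _ => hP)
  have : Rec (fun c => c ∈ X) := hX
  refine this.congr fun c => ?_
  rw [hX']
  change _ ↔ ∃ w, P (fst (pair c w)) (snd (pair c w))
  simp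

/-! ### Arithmetical formulas as games with queries -/

/-- `Φ(n, Y)` is decided by a game of bounded length with the moves `R`, in which a position `q` is
also won by a query `z` with `Q(q, z)` and `z ∉ Y`. -/
def IsQueryGame (Φ : M.Num → Set M.Num → Prop) : Prop :=
  ∃ (d : ℕ) (rank : M.Num → ℕ) (R Q : M.Num → M.Num → Prop) (s : M.Num → M.Num),
    Rec (fun z => R (fst z) (snd z)) ∧ Rec (fun z => Q (fst z) (snd z)) ∧ RecF s ∧
    (∀ q, rank q ≤ d) ∧ (∀ q q', R q q' → rank q' < rank q) ∧
    ∀ (Y : Set M.Num) (V : M.Num → Prop),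
      (∀ q, V q ↔ (∃ q', R q q' ∧ ¬ V q') ∨ ∃ z, Q q z ∧ z ∉ Y) → ∀ n, V (s n) ↔ Φ n Y

namespace IsQueryGame

omit hM in
theorem congr {Φ Ψ : M.Num → Set M.Num → Prop} (h : IsQueryGame Φ) (hiff : ∀ n Y, Ψ n Y ↔ Φ n Y) :
    IsQueryGame Ψ := by
  have : Ψ = Φ := funext fun n => funext fun Y => propext (hiff n Y)
  rwa [this]

theorem query {f : M.Num → M.Num} (hf : RecF f) : IsQueryGame (fun n Y => f n ∉ Y) := by
  refine ⟨0, fun _ => 0, fun _ _ => False, fun q z => z = f q, fun n => n, by fun_prop,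
    by fun_prop, by fun_prop, fun _ => le_rfl, fun _ _ h => h.elim, fun Y V hV n => ?_⟩
  rw [hV]
  simp

theorem step {P : M.Num → M.Num → Prop} (hP : Rec (fun z => P (fst z) (snd z)))
    {Ψ : M.Num → Set M.Num → Prop} (h : IsQueryGame Ψ) :
    IsQueryGame (fun n Y => ∃ m, P n m ∧ ¬ Ψ m Y) := by
  obtain ⟨d, rank, R, Q, s, hR, hQ, hs, hd, hrank, hV⟩ := h
  classical
  let R' : M.Num → M.Num → Prop := fun q q' =>
    (fst q = 0 ∧ IsPair q' ∧ fst q' = 1 ∧ IsPair (snd q') ∧ P (snd q) (snd (snd q')) ∧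
      fst (snd q') = s (snd (snd q'))) ∨
    (fst q = 1 ∧ IsPair q' ∧ fst q' = 1 ∧ IsPair (snd q') ∧ R (fst (snd q)) (fst (snd q')) ∧
      snd (snd q') = 0)
  let Q' : M.Num → M.Num → Prop := fun q z => fst q = 1 ∧ Q (fst (snd q)) z
  refine ⟨d + 1, fun q => if fst q = 1 then rank (fst (snd q)) else d + 1, R', Q',
    fun n => pair 0 n, ?_, ?_, by fun_prop, fun q => ?_, ?_, fun Y V hV' n => ?_⟩
  · have h1 := hP.comp₂ (f := fun z => snd (fst z)) (g := fun z => snd (snd (snd z)))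
      (by fun_prop) (by fun_prop)
    have h2 := hR.comp₂ (f := fun z => fst (snd (fst z))) (g := fun z => fst (snd (snd z)))
      (by fun_prop) (by fun_prop)
    simp only [R']
    exact Rec.or (Rec.and (by fun_prop) (Rec.and (by fun_prop) (Rec.and (by fun_prop)
      (Rec.and (by fun_prop) (h1.and (by fun_prop)))))) (Rec.and (by fun_prop)
      (Rec.and (by fun_prop) (Rec.and (by fun_prop) (Rec.and (by fun_prop) (h2.and
      (by fun_prop))))))
  · exact Rec.and (by fun_prop) (hQ.comp₂ (f := fun z => fst (snd (fst z)))
      (g := fun z => snd z) (by fun_prop) (by fun_prop))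
  · dsimp only
    split_ifs
    · exact (hd _).trans (Nat.le_succ d)
    · exact le_rfl
  · rintro q q' (⟨h0, _, h1, _⟩ | ⟨h0, _, h1, _, h2, _⟩)
    · simp only [h0, h1, zero_ne_one, if_true, if_false]
      exact Nat.lt_succ_of_le (hd _)
    · simp only [h0, h1, if_true]
      exact hrank _ _ h2
  · have hdep : ∀ q y, V (pair 1 (pair q y)) ↔ V (pair 1 (pair q 0)) := by
      intro q y
      rw [hV', hV' (pair 1 (pair q 0))]
      simp [R', Q']
    have h1 : ∀ q, V (pair 1 (pair q 0)) ↔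
        (∃ q', R q q' ∧ ¬ V (pair 1 (pair q' 0))) ∨ ∃ z, Q q z ∧ z ∉ Y := by
      intro q
      rw [hV']
      simp only [R', Q', fst_pair, snd_pair, one_ne_zero, false_and, false_or, true_and]
      refine or_congr_left ⟨?_, ?_⟩
      · rintro ⟨_, ⟨⟨a, b, rfl⟩, h3, h4, h5, h6⟩, h7⟩
        simp only [fst_pair, snd_pair] at h3 h4 h5 h6
        obtain ⟨a', b', rfl⟩ := h4
        simp only [fst_pair, snd_pair] at h5 h6
        subst h3 h6
        exact ⟨a', h5, h7⟩
      · rintro ⟨q', h3, h4⟩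
        exact ⟨pair 1 (pair q' 0), ⟨isPair_pair _ _, by simp, by simp [isPair_pair], by simpa,
          by simp⟩, h4⟩
    have h2 := hV Y (fun q => V (pair 1 (pair q 0))) h1
    rw [hV']
    simp only [R', Q', fst_pair, snd_pair, zero_ne_one, false_and, or_false, true_and,
      exists_false]
    constructor
    · rintro ⟨_, ⟨⟨a, b, rfl⟩, h3, h4, h5, h6⟩, h7⟩
      simp only [fst_pair, snd_pair] at h3 h4 h5 h6
      obtain ⟨a', b', rfl⟩ := h4
      simp only [fst_pair, snd_pair] at h5 h6
      subst h3 h6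
      rw [hdep, h2] at h7
      exact ⟨b', h5, h7⟩
    · rintro ⟨m, hm, hm'⟩
      refine ⟨pair 1 (pair (s m) m), ⟨isPair_pair _ _, by simp, by simp [isPair_pair], by simpa,
        by simp⟩, ?_⟩
      rwa [hdep, h2]

theorem sum {c : M.Num → Prop} (hc : Rec c) {Φ Ψ : M.Num → Set M.Num → Prop}
    (h : IsQueryGame Φ) (h' : IsQueryGame Ψ) :
    IsQueryGame (fun n Y => (c n ∧ Φ n Y) ∨ (¬ c n ∧ Ψ n Y)) := by
  obtain ⟨d, rank, R, Q, s, hR, hQ, hs, hd, hrank, hV⟩ := h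
  obtain ⟨d', rank', R', Q', s', hR', hQ', hs', hd', hrank', hV'⟩ := h'
  classical
  refine ⟨d + d', fun q => if fst q = 0 then rank (snd q) else rank' (snd q),
    fun q q' => (fst q = 0 ∧ IsPair q' ∧ fst q' = 0 ∧ R (snd q) (snd q')) ∨
      (fst q = 1 ∧ IsPair q' ∧ fst q' = 1 ∧ R' (snd q) (snd q')),
    fun q z => (fst q = 0 ∧ Q (snd q) z) ∨ (fst q = 1 ∧ Q' (snd q) z),
    fun n => if c n then pair 0 (s n) else pair 1 (s' n), ?_, ?_, by fun_prop,
    fun q => ?_, ?_, fun Y V hVV n => ?_⟩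
  · have h1 := hR.comp₂ (f := fun z => snd (fst z)) (g := fun z => snd (snd z))
      (by fun_prop) (by fun_prop)
    have h2 := hR'.comp₂ (f := fun z => snd (fst z)) (g := fun z => snd (snd z))
      (by fun_prop) (by fun_prop)
    exact Rec.or (Rec.and (by fun_prop) (Rec.and (by fun_prop) (Rec.and (by fun_prop) h1)))
      (Rec.and (by fun_prop) (Rec.and (by fun_prop) (Rec.and (by fun_prop) h2)))
  · have h1 := hQ.comp₂ (f := fun z => snd (fst z)) (g := fun z => snd z)
      (by fun_prop) (by fun_prop)
    have h2 := hQ'.comp₂ (f := fun z => snd (fst z)) (g := fun z => snd z)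
      (by fun_prop) (by fun_prop)
    exact Rec.or (Rec.and (by fun_prop) h1) (Rec.and (by fun_prop) h2)
  · dsimp only
    split_ifs
    · exact (hd _).trans (Nat.le_add_right _ _)
    · exact (hd' _).trans (Nat.le_add_left _ _)
  · rintro q q' (⟨h0, _, h1, h2⟩ | ⟨h0, _, h1, h2⟩)
    · simp only [h0, h1, if_true]
      exact hrank _ _ h2
    · simp only [h0, h1, one_ne_zero, if_false]
      exact hrank' _ _ h2
  · have h1 := hV Y (fun q => V (pair 0 q)) (by
      intro q
      rw [hVV]
      simp only [fst_pair, snd_pair, zero_ne_one, false_and, or_false, true_and]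
      refine or_congr_left ⟨?_, ?_⟩
      · rintro ⟨_, ⟨⟨a, b, rfl⟩, h3, h4⟩, h5⟩
        simp only [fst_pair, snd_pair] at h3 h4
        subst h3
        exact ⟨b, h4, h5⟩
      · rintro ⟨b, h3, h4⟩
        exact ⟨pair 0 b, ⟨isPair_pair _ _, by simp, by simpa⟩, h4⟩)
    have h2 := hV' Y (fun q => V (pair 1 q)) (by
      intro q
      rw [hVV]
      simp only [fst_pair, snd_pair, one_ne_zero, false_and, false_or, true_and]
      refine or_congr_left ⟨?_, ?_⟩
      · rintro ⟨_, ⟨⟨a, b, rfl⟩, h3, h4⟩, h5⟩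
        simp only [fst_pair, snd_pair] at h3 h4
        subst h3
        exact ⟨b, h4, h5⟩
      · rintro ⟨b, h3, h4⟩
        exact ⟨pair 1 b, ⟨isPair_pair _ _, by simp, by simpa⟩, h4⟩)
    dsimp only
    by_cases hn : c n
    · simp only [hn, if_true, h1, true_and, not_true, false_and, or_false]
    · simp only [hn, if_false, h2, true_and, not_false_eq_true, false_and, false_or]

theorem not {Φ : M.Num → Set M.Num → Prop} (h : IsQueryGame Φ) :
    IsQueryGame (fun n Y => ¬ Φ n Y) :=
  (step (P := fun n m => m = n) (by fun_prop) h).congr fun n Y => by simp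

theorem exists_and {P : M.Num → M.Num → Prop} (hP : Rec (fun z => P (fst z) (snd z)))
    {Ψ : M.Num → Set M.Num → Prop} (h : IsQueryGame Ψ) :
    IsQueryGame (fun n Y => ∃ m, P n m ∧ Ψ m Y) :=
  (step hP h.not).congr fun n Y => by simp

theorem comp {Φ : M.Num → Set M.Num → Prop} (h : IsQueryGame Φ) {g : M.Num → M.Num}
    (hg : RecF g) : IsQueryGame (fun n Y => Φ (g n) Y) :=
  (exists_and (P := fun n m => m = g n) (by fun_prop) h).congr fun n Y => by simp

theorem const (p : Prop) : IsQueryGame (fun (_ : M.Num) _ => p) := by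
  have h : IsQueryGame (fun (_ : M.Num) _ => False) :=
    (step (P := fun _ _ => False) (by fun_prop) (query RecF.id)).congr fun n Y => by simp
  by_cases hp : p
  · exact h.not.congr fun _ _ => by simp [hp]
  · exact h.congr fun _ _ => by simp [hp]

theorem of_rec {c : M.Num → Prop} (hc : Rec c) : IsQueryGame (fun n _ => c n) :=
  (sum hc (const True) (const False)).congr fun n Y => by simp

theorem or {Φ Ψ : M.Num → Set M.Num → Prop} (h : IsQueryGame Φ) (h' : IsQueryGame Ψ) :
    IsQueryGame (fun n Y => Φ n Y ∨ Ψ n Y) := by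
  have h1 := sum (c := fun m : M.Num => fst m = 0) (by fun_prop) (h.comp recF_snd_base)
    (h'.comp recF_snd_base)
  refine (exists_and (P := fun n m => m = pair 0 n ∨ m = pair 1 n) (by fun_prop) h1).congr
    fun n Y => ⟨?_, ?_⟩
  · rintro (h | h)
    · exact ⟨pair 0 n, by simp, by simp [h]⟩
    · exact ⟨pair 1 n, by simp, by simp [h]⟩
  · rintro ⟨m, rfl | rfl, hm⟩
    · exact Or.inl (by simpa using hm)
    · exact Or.inr (by simpa using hm)

/-- Every arithmetical formula is a game with queries of its first set variable. -/
theorem sat {E : ℕ → Set M.Num} (hE : ∀ i, E i ∈ M.Sets) (φ : AFormula) :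
    ∀ {v : ℕ → M.Num → M.Num}, (∀ i, RecF (v i)) →
      IsQueryGame (fun n Y => M.Sat φ (fun i => v i n) (pushVar Y E)) := by
  induction φ with
  | eq s t => exact fun hv => of_rec (rec_eq (recF_termVal s hv) (recF_termVal t hv))
  | lt s t => exact fun hv => of_rec (rec_lt (recF_termVal s hv) (recF_termVal t hv))
  | mem t X =>
    intro v hv
    cases X with
    | zero => exact (query (recF_termVal t hv)).not.congr fun n Y => not_not.symm
    | succ X => exact of_rec (rec_mem (hE X) (recF_termVal t hv))
  | neg φ ih => exact fun hv => (ih hv).not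
  | and φ ψ ih ih' =>
    exact fun hv => ((ih hv).not.or (ih' hv).not).not.congr fun n Y => by simp only [Sat]; tauto
  | or φ ψ ih ih' => exact fun hv => (ih hv).or (ih' hv)
  | imp φ ψ ih ih' =>
    exact fun hv => ((ih hv).not.or (ih' hv)).congr fun n Y => by simp only [Sat]; tauto
  | allLt t φ ih =>
    intro v hv
    have ht := recF_termVal t hv
    refine (exists_and (P := fun n m => IsPair m ∧ fst m = n ∧
      snd m < M.termVal (fun i => v i (fst m)) t) (by fun_prop)
      (ih (recF_liftVar hv)).not).not.congr fun n Y => ?_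
    simp only [liftVar_eq, Sat]
    push Not
    constructor
    · rintro h m ⟨_, rfl, h1⟩
      exact h _ h1
    · intro h x hx
      simpa using h (pair n x) ⟨isPair_pair _ _, by simp, by simpa using hx⟩
  | exLt t φ ih =>
    intro v hv
    have ht := recF_termVal t hv
    refine (exists_and (P := fun n m => IsPair m ∧ fst m = n ∧
      snd m < M.termVal (fun i => v i (fst m)) t) (by fun_prop)
      (ih (recF_liftVar hv))).congr fun n Y => ?_
    simp only [liftVar_eq, Sat]
    constructor
    · rintro ⟨x, hx, h⟩
      exact ⟨pair n x, ⟨isPair_pair _ _, by simp, by simpa using hx⟩, by simpa using h⟩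
    · rintro ⟨m, ⟨_, rfl, h1⟩, h2⟩
      exact ⟨_, h1, h2⟩
  | all φ ih =>
    intro v hv
    refine (exists_and (P := fun n m => IsPair m ∧ fst m = n) (by fun_prop)
      (ih (recF_liftVar hv)).not).not.congr fun n Y => ?_
    simp only [liftVar_eq, Sat]
    push Not
    constructor
    · rintro h m ⟨_, rfl⟩
      exact h _
    · intro h x
      simpa using h (pair n x) ⟨isPair_pair _ _, by simp⟩
  | ex φ ih =>
    intro v hv
    refine (exists_and (P := fun n m => IsPair m ∧ fst m = n) (by fun_prop)
      (ih (recF_liftVar hv))).congr fun n Y => ?_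
    simp only [liftVar_eq, Sat]
    constructor
    · rintro ⟨x, h⟩
      exact ⟨pair n x, ⟨isPair_pair _ _, by simp⟩, by simpa using h⟩
    · rintro ⟨m, ⟨_, rfl⟩, h2⟩
      exact ⟨_, h2⟩

end IsQueryGame

end L2Structure

namespace L2Structure

variable {M : L2Structure.{u}} [hM : Fact M.RCA0]

/-! ### Arithmetical transfinite recursion from well founded games -/

@[fun_prop]
theorem rec_relLT {X : Set M.Num} (hX : X ∈ M.Sets) {f g : M.Num → M.Num} (hf : RecF f)
    (hg : RecF g) : Rec (fun c => relLT X (f c) (g c)) := by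
  unfold relLT relLE
  fun_prop (disch := assumption)

omit hM in
theorem IsLO.relLT_trans {X : Set M.Num} (h : IsLO X) {a b c : M.Num} (h1 : relLT X a b)
    (h2 : relLT X b c) : relLT X a c :=
  ⟨h.trans _ _ _ h1.1 h2.1, fun h3 => h1.2 (h.trans _ _ _ h2.1 h3)⟩

section

variable (R Q : M.Num → M.Num → Prop) (s : M.Num → M.Num) (X : Set M.Num)

open Classical in
/-- The position of the query game in a position of the hierarchy game. -/
noncomputable def queryPos (p : M.Num) : M.Num :=
  if fst p = 1 then fst (snd p) else s (fst (snd p))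

/-- The moves of the game that computes a hierarchy along `X`.  The position `⟨1, ⟨q, j⟩⟩` is the
position `q` of the query game at the level `j`, the position `⟨2, ⟨n, j⟩⟩` asks for the membership
of `⟨n, j⟩` in the hierarchy, and the positions `⟨0, z⟩` are lost. -/
def hierarchyRel (p p' : M.Num) : Prop :=
  (fst p = 1 ∨ fst p = 2) ∧ IsPair p' ∧
    ((fst p' = 1 ∧ IsPair (snd p') ∧ R (queryPos s p) (fst (snd p')) ∧
        snd (snd p') = snd (snd p)) ∨
      (fst p' = 2 ∧ Q (queryPos s p) (snd p') ∧ IsPair (snd p') ∧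
        relLT X (snd (snd p')) (snd (snd p))) ∨
      (fst p' = 0 ∧ Q (queryPos s p) (snd p') ∧
        ¬ (IsPair (snd p') ∧ relLT X (snd (snd p')) (snd (snd p)))))

variable {R Q s X}

theorem rec_hierarchyRel (hR : Rec (fun z => R (fst z) (snd z)))
    (hQ : Rec (fun z => Q (fst z) (snd z))) (hs : RecF s) (hX : X ∈ M.Sets) :
    Rec (fun z => hierarchyRel R Q s X (fst z) (snd z)) := by
  have hq : RecF (fun z : M.Num => queryPos s (fst z)) := by
    unfold queryPos
    fun_prop
  have h1 := hR.comp₂ (g := fun z : M.Num => fst (snd (snd z))) hq (by fun_prop)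
  have h2 := hQ.comp₂ (g := fun z : M.Num => snd (snd z)) hq (by fun_prop)
  have h3 : Rec (fun z : M.Num => fst (fst z) = 1 ∨ fst (fst z) = 2) := by fun_prop
  have h4 : Rec (fun z : M.Num => IsPair (snd z)) := by fun_prop
  have h5 : Rec (fun z : M.Num => relLT X (snd (snd (snd z))) (snd (snd (fst z)))) := by
    fun_prop (disch := assumption)
  have h6 : Rec (fun z : M.Num => IsPair (snd (snd z))) := by fun_prop
  have h7 : ∀ k : M.Num, Rec (fun z : M.Num => fst (snd z) = k) := fun k => by fun_prop
  have h8 : Rec (fun z : M.Num => snd (snd (snd z)) = snd (snd (fst z))) := by fun_prop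
  exact h3.and (h4.and (((h7 1).and (h6.and (h1.and h8))).or
    (((h7 2).and (h2.and (h6.and h5))).or ((h7 0).and (h2.and (h6.and h5).not)))))

theorem no_path_hierarchyRel {d : ℕ} {rank : M.Num → ℕ} (hX' : IsWO X)
    (hd : ∀ q, rank q ≤ d) (hrank : ∀ q q', R q q' → rank q' < rank q) :
    ¬ ∃ g : M.Num → M.Num, RecF g ∧ ∀ n, hierarchyRel R Q s X (g n) (g (n + 1)) := by
  rintro ⟨g, hg, hgs⟩
  have hstep : ∀ n, (snd (snd (g (n + 1))) = snd (snd (g n)) ∧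
      rank (queryPos s (g (n + 1))) < rank (queryPos s (g n))) ∨
      relLT X (snd (snd (g (n + 1)))) (snd (snd (g n))) := by
    intro n
    obtain ⟨_, _, ⟨h1, _, h2, h3⟩ | ⟨_, _, _, h1⟩ | ⟨h1, _⟩⟩ := hgs n
    · refine Or.inl ⟨h3, ?_⟩
      have : queryPos s (g (n + 1)) = fst (snd (g (n + 1))) := if_pos h1
      rw [this]
      exact hrank _ _ h2
    · exact Or.inr h1
    · rcases (hgs (n + 1)).1 with h2 | h2
      · exact absurd (h1.symm.trans h2) zero_ne_one
      · exact absurd (h1.symm.trans h2) (by norm_num)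
  have hmany : ∀ (i : ℕ) (n : M.Num), (snd (snd (g (n + i))) = snd (snd (g n)) ∧
      rank (queryPos s (g (n + i))) + i ≤ rank (queryPos s (g n))) ∨
      relLT X (snd (snd (g (n + i)))) (snd (snd (g n))) := by
    intro i n
    induction i with
    | zero => simp
    | succ i ih =>
      have hs := hstep (n + i)
      rw [add_assoc] at hs
      rw [Nat.cast_succ]
      rcases hs with ⟨h1, h2⟩ | h1
      · rcases ih with ⟨h3, h4⟩ | h3
        · exact Or.inl ⟨h1.trans h3, by omega⟩
        · exact Or.inr (by rw [h1]; exact h3)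
      · rcases ih with ⟨h3, h4⟩ | h3
        · exact Or.inr (by rw [← h3]; exact h1)
        · exact Or.inr (hX'.1.relLT_trans h1 h3)
  have hdesc : ∀ n, relLT X (snd (snd (g (((d + 1 : ℕ) : M.Num) * (n + 1)))))
      (snd (snd (g (((d + 1 : ℕ) : M.Num) * n)))) := by
    intro n
    have h1 := hmany (d + 1) (((d + 1 : ℕ) : M.Num) * n)
    rw [mul_add, mul_one]
    rcases h1 with ⟨_, h2⟩ | h1
    · have := hd (queryPos s (g (((d + 1 : ℕ) : M.Num) * n)))
      omega
    · exact h1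
  refine hX'.2 ⟨graph (fun n => snd (snd (g (((d + 1 : ℕ) : M.Num) * n)))),
    RecF.graph_mem (by fun_prop), isFun_graph fun n => ?_, fun n a b ha hb => ?_⟩
  · exact (hX'.1.refl _ _ (hdesc n).1).2
  · rw [pair_mem_graph_iff] at ha hb
    rw [← ha, ← hb]
    exact hdesc n

end

theorem transfinite_recursion_of_evaluated {k : ℕ} {τ : Set M.Num}
    (h : M.BorelCodesHaveEvaluatedPoint k τ) : M.ArithmeticalTransfiniteRecursion := by
  intro θ e E hE X hX hX'
  obtain ⟨d, rank, R, Q, s, hR, hQ, hs, hd, hrank, hV⟩ :=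
    IsQueryGame.sat hE θ (recF_firstVar e)
  obtain ⟨V, hVr, hV'⟩ := exists_game_value h (rec_hierarchyRel hR hQ hs hX)
    (no_path_hierarchyRel hX' hd hrank)
  have h0 : ∀ z, ¬ V (pair 0 z) := by
    intro z hz
    obtain ⟨q, ⟨h1, _⟩, _⟩ := (hV' _).1 hz
    simp at h1
  have h2 : ∀ n j, V (pair 2 (pair n j)) ↔ V (pair 1 (pair (s n) j)) := by
    intro n j
    rw [hV', hV' (pair 1 _)]
    simp [hierarchyRel, queryPos]
  have hr : Rec (fun z => IsPair z ∧ pair (snd z) (snd z) ∈ X ∧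
      V (pair 1 (pair (s (fst z)) (snd z)))) := by
    fun_prop (disch := assumption)
  refine ⟨_, hr, hX'.1, ?_⟩
  set Y : Set M.Num := {z | IsPair z ∧ pair (snd z) (snd z) ∈ X ∧
      V (pair 1 (pair (s (fst z)) (snd z)))} with hY
  have hYmem : ∀ n j, pair n j ∈ Y ↔ j ∈ field X ∧ V (pair 1 (pair (s n) j)) := by
    intro n j
    simp [hY, isPair_pair, field, relLE]
  have hbelow : ∀ z j, z ∈ below X Y j ↔ IsPair z ∧ relLT X (snd z) j ∧ V (pair 2 z) := by
    intro z j
    constructor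
    · rintro ⟨m, a, rfl, h3, h4⟩
      refine ⟨isPair_pair _ _, by simpa using h3, (h2 _ _).2 ((hYmem _ _).1 h4).2⟩
    · rintro ⟨⟨m, a, rfl⟩, h3, h4⟩
      rw [snd_pair] at h3
      exact ⟨m, a, rfl, h3, (hYmem _ _).2 ⟨(hX'.1.refl _ _ h3.1).1, (h2 _ _).1 h4⟩⟩
  have hkey : ∀ n j, V (pair 1 (pair (s n) j)) ↔
      M.Sat θ (pushVar n e) (pushVar (below X Y j) E) := by
    intro n j
    rw [← firstVar_eq]
    refine hV (below X Y j) (fun q => V (pair 1 (pair q j))) (fun q => ?_) n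
    have hpos : queryPos s (pair 1 (pair q j)) = q := by simp [queryPos]
    rw [hV']
    constructor
    · rintro ⟨_, ⟨_, ⟨a, b, rfl⟩, h3⟩, h4⟩
      simp only [fst_pair, snd_pair, hpos] at h3
      rcases h3 with ⟨rfl, ⟨q', j', rfl⟩, h5, h6⟩ | ⟨rfl, h5, h6, h7⟩ | ⟨rfl, h5, h6⟩
      · simp only [fst_pair, snd_pair] at h5 h6
        subst h6
        exact Or.inl ⟨q', h5, h4⟩
      · exact Or.inr ⟨b, h5, fun h8 => h4 ((hbelow _ _).1 h8).2.2⟩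
      · exact Or.inr ⟨b, h5, fun h8 => h6 ⟨((hbelow _ _).1 h8).1, ((hbelow _ _).1 h8).2.1⟩⟩
    · rintro (⟨q', h3, h4⟩ | ⟨z, h3, h4⟩)
      · refine ⟨pair 1 (pair q' j), ⟨by simp, isPair_pair _ _, Or.inl ?_⟩, h4⟩
        simp [hpos, h3, isPair_pair]
      · by_cases h5 : IsPair z ∧ relLT X (snd z) j
        · refine ⟨pair 2 z, ⟨by simp, isPair_pair _ _, Or.inr (Or.inl ?_)⟩, fun h6 => ?_⟩
          · simp [hpos, h3, h5]
          · exact h4 ((hbelow _ _).2 ⟨h5.1, h5.2, h6⟩)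
        · refine ⟨pair 0 z, ⟨by simp, isPair_pair _ _, Or.inr (Or.inr ?_)⟩, h0 z⟩
          simp only [fst_pair, snd_pair, hpos, h3, true_and]
          exact h5
  intro z
  constructor
  · intro hz
    obtain ⟨n, j, rfl⟩ := hz.1
    obtain ⟨h3, h4⟩ := (hYmem _ _).1 hz
    exact ⟨n, j, rfl, h3, (hkey _ _).1 h4⟩
  · rintro ⟨n, j, rfl, h3, h4⟩
    exact (hYmem _ _).2 ⟨h3, (hkey _ _).2 h4⟩

theorem atr0_of_evaluated {k : ℕ} {τ : Set M.Num} (h : M.BorelCodesHaveEvaluatedPoint k τ) :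
    M.ATR0 :=
  ⟨aca0_of_closedUnderExists (closedUnderExists_of_evaluated h),
    transfinite_recursion_of_evaluated h⟩

end L2Structure

namespace L2Structure

variable {M : L2Structure.{u}} [hM : Fact M.RCA0]

/-! ### The space of partitions -/

theorem mem_finPartition {k : ℕ} {σ : M.Num} : σ ∈ M.FinPartition k ↔ IsSeq σ ∧
    (∀ n < len σ, ent σ n < (k : M.Num)) ∧ (∀ n < len σ, ∀ j < ent σ n, ∃ m < n, ent σ m = j) ∧
    ∀ i < (k : M.Num), ∃ n < len σ, ent σ n = i := by
  rw [← num_eq_cast]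
  constructor
  · rintro ⟨l, h1, h2, h3, h4⟩
    obtain ⟨h1', rfl⟩ := isSeqLen_iff.1 h1
    refine ⟨h1', fun n hn => h2 n _ hn (h1'.entry_iff.2 ⟨hn, rfl⟩), fun n hn j hj => ?_,
      fun i hi => ?_⟩
    · obtain ⟨m, hm, hm'⟩ := h3 n _ hn (h1'.entry_iff.2 ⟨hn, rfl⟩) j hj
      exact ⟨m, hm, (h1'.entry_iff.1 hm').2⟩
    · obtain ⟨n, hn, hn'⟩ := h4 i hi
      exact ⟨n, hn, (h1'.entry_iff.1 hn').2⟩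
  · rintro ⟨h1, h2, h3, h4⟩
    refine ⟨len σ, h1.isSeqLen, fun n i hn hi => ?_, fun n i hn hi j hj => ?_, fun i hi => ?_⟩
    · rw [← (h1.entry_iff.1 hi).2]; exact h2 n hn
    · rw [← (h1.entry_iff.1 hi).2] at hj
      obtain ⟨m, hm, hm'⟩ := h3 n hn j hj
      exact ⟨m, hm, h1.entry_iff.2 ⟨hm.trans hn, hm'⟩⟩
    · obtain ⟨n, hn, hn'⟩ := h4 i hi
      exact ⟨n, hn, h1.entry_iff.2 ⟨hn, hn'⟩⟩

theorem finPartition_mem_sets (k : ℕ) : M.FinPartition k ∈ M.Sets := by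
  have : Rec (fun σ : M.Num => IsSeq σ ∧ (∀ n < len σ, ent σ n < (k : M.Num)) ∧
      (∀ n < len σ, ∀ j < ent σ n, ∃ m < n, ent σ m = j) ∧
      ∀ i < (k : M.Num), ∃ n < len σ, ent σ n = i) := by fun_prop
  exact this.congr fun σ => mem_finPartition

@[fun_prop]
theorem rec_mem_finPartition (k : ℕ) {f : M.Num → M.Num} (hf : RecF f) :
    Rec (fun c => f c ∈ M.FinPartition k) :=
  rec_mem (finPartition_mem_sets k) hf

theorem isSeq_of_mem_finPartition {k : ℕ} {σ : M.Num} (h : σ ∈ M.FinPartition k) : IsSeq σ :=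
  (mem_finPartition.1 h).1

theorem finPartition_nonempty (k : ℕ) : ∃ σ, σ ∈ M.FinPartition k := by
  obtain ⟨σ, h1, h2, h3⟩ := exists_seq (M := M) RecF.id (k : M.Num)
  refine ⟨σ, mem_finPartition.2 ⟨h1, ?_, ?_, ?_⟩⟩
  · intro n hn
    rw [h2] at hn
    rw [h3 n hn]; exact hn
  · intro n hn j hj
    rw [h2] at hn
    rw [h3 n hn] at hj
    exact ⟨j, hj, h3 j (hj.trans hn)⟩
  · intro i hi
    exact ⟨i, by rwa [h2], h3 i hi⟩

theorem snoc_zero_mem_finPartition {k : ℕ} (hk : 0 < k) {σ : M.Num} (h : σ ∈ M.FinPartition k) :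
    snoc σ 0 ∈ M.FinPartition k := by
  rw [mem_finPartition] at h ⊢
  have hlt : ∀ {m}, m < len σ → m < len (snoc σ 0) := fun hm => by
    rw [len_snoc]; exact hm.trans (lt_add_one _)
  refine ⟨isSeq_snoc _ _, fun n hn => ?_, fun n hn j hj => ?_, fun i hi => ?_⟩
  · rw [len_snoc, lt_add_one_iff'] at hn
    rcases hn.lt_or_eq with hn | rfl
    · rw [ent_snoc_of_lt hn]; exact h.2.1 n hn
    · rw [ent_snoc_last]; exact_mod_cast hk
  · rw [len_snoc, lt_add_one_iff'] at hn
    rcases hn.lt_or_eq with hn | rfl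
    · rw [ent_snoc_of_lt hn] at hj
      obtain ⟨m, hm, hm'⟩ := h.2.2.1 n hn j hj
      exact ⟨m, hm, by rwa [ent_snoc_of_lt (hm.trans hn)]⟩
    · rw [ent_snoc_last] at hj
      exact absurd hj (zero_le' j).not_gt
  · obtain ⟨n, hn, hn'⟩ := h.2.2.2 i hi
    exact ⟨n, hlt hn, by rwa [ent_snoc_of_lt hn]⟩

theorem exists_isEnumeration (k : ℕ) : ∃ τ, M.IsEnumeration k τ := by
  classical
  obtain ⟨σ₀, h₀⟩ := finPartition_nonempty (M := M) k
  refine ⟨graph (fun m => if m ∈ M.FinPartition k then m else σ₀),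
    RecF.graph_mem (by fun_prop), isFun_graph fun n => ?_, fun σ hσ => ?_⟩
  · split_ifs with h
    · exact h
    · exact h₀
  · exact ⟨σ, pair_mem_graph_iff.2 (if_pos hσ)⟩

theorem mem_partition {k : ℕ} {p : Set M.Num} : p ∈ M.Partition k ↔
    ∃ g : M.Num → M.Num, RecF g ∧ p = graph g ∧ (∀ n, g n < (k : M.Num)) ∧
      (∀ n, ∀ j < g n, ∃ m < n, g m = j) ∧ ∀ i < (k : M.Num), ∃ n, g n = i := by
  rw [← num_eq_cast]
  constructor
  · rintro ⟨h1, h2, h3, h4⟩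
    obtain ⟨g, hg, rfl, hg'⟩ := exists_recF_of_isFun h1 h2
    simp only [pair_mem_graph_iff] at h3 h4
    exact ⟨g, hg, rfl, hg', fun n j hj => h3 n _ rfl j hj, h4⟩
  · rintro ⟨g, hg, rfl, h1, h2, h3⟩
    refine ⟨hg.graph_mem, isFun_graph h1, ?_, ?_⟩
    · simp only [pair_mem_graph_iff]
      rintro n _ rfl j hj
      exact h2 n j hj
    · simpa only [pair_mem_graph_iff] using h3

theorem precFun_graph {g : M.Num → M.Num} {σ : M.Num} :
    PrecFun σ (graph g) ↔ IsSeq σ ∧ ∀ i < len σ, ent σ i = g i := by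
  unfold PrecFun
  simp only [isRestriction_graph]
  constructor
  · rintro ⟨l, h1, rfl, h2⟩
    exact ⟨h1, h2⟩
  · rintro ⟨h1, h2⟩
    exact ⟨_, h1, rfl, h2⟩

theorem PrecFun.sub_or_sub {g : M.Num → M.Num} {σ ρ : M.Num} (h : PrecFun σ (graph g))
    (h' : PrecFun ρ (graph g)) : Sub σ ρ ∨ Sub ρ σ := by
  rw [precFun_graph] at h h'
  rcases le_total (len σ) (len ρ) with hl | hl
  · exact Or.inl ⟨hl, fun i hi => (h.2 i hi).trans (h'.2 i (hi.trans_le hl)).symm⟩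
  · exact Or.inr ⟨hl, fun i hi => (h'.2 i hi).trans (h.2 i (hi.trans_le hl)).symm⟩

theorem PrecFun.of_sub {g : M.Num → M.Num} {σ ρ : M.Num} (h : PrecFun σ (graph g))
    (hρ : IsSeq ρ) (hs : Sub ρ σ) : PrecFun ρ (graph g) := by
  rw [precFun_graph] at h ⊢
  exact ⟨hρ, fun i hi => (hs.2 i hi).trans (h.2 i (hi.trans_le hs.1))⟩

omit hM in
theorem pair_mem_openSlice [Fact M.RCA0] {D : Set M.Num} {i n σ : M.Num} :
    pair n σ ∈ openSlice D i ↔ pair i (pair n σ) ∈ D := by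
  constructor
  · rintro ⟨n', σ', h, h'⟩
    obtain ⟨rfl, rfl⟩ := pair_inj h
    exact h'
  · exact fun h => ⟨n, σ, rfl, h⟩

theorem exists_sub_of_comparable {k : ℕ} {σ ρ : M.Num} (hσ : σ ∈ M.FinPartition k)
    (hρ : ρ ∈ M.FinPartition k) (h : Comparable ρ σ) :
    ∃ π ∈ M.FinPartition k, Sub σ π ∧ Sub ρ π := by
  rcases h with h | h
  · exact ⟨σ, hσ, Sub.refl _, (initSeg_iff.1 h).2.2⟩
  · exact ⟨ρ, hρ, (initSeg_iff.1 h).2.2, Sub.refl _⟩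

/-- The Baire category theorem for the space of partitions. -/
theorem exists_generic {k : ℕ} (hk : 0 < k) {D : Set M.Num} (hD : M.IsOpenSeqCode k D)
    (hd : ∀ n, IsDenseOpen k (openSlice D n)) {σ₀ : M.Num} (h₀ : σ₀ ∈ M.FinPartition k) :
    ∃ x ∈ M.Partition k, PrecFun σ₀ x ∧ ∀ n, MemOpen x (openSlice D n) := by
  have hDs := hD.1
  obtain ⟨g, hg, hg0, hg'⟩ := exists_dependent_choice
    (P := fun z => fst (snd z) ∈ M.FinPartition k) (by fun_prop)
    (T := fun z z' => fst z' = fst z + 1 ∧ Sub (fst (snd z)) (fst (snd z')) ∧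
      len (fst (snd z)) < len (fst (snd z')) ∧
      pair (fst z) (pair (fst (snd (snd z'))) (snd (snd (snd z')))) ∈ D ∧
      Sub (snd (snd (snd z'))) (fst (snd z')))
    (by fun_prop (disch := assumption)) (a := pair 0 (pair σ₀ 0)) (by simpa using h₀) (by
      intro z hz
      obtain ⟨m, ρ, h1, h2⟩ := hd (fst z) _ hz
      rw [pair_mem_openSlice] at h1
      obtain ⟨i', n', ρ', hρ', h3⟩ := hD.2 _ h1
      obtain ⟨-, h3⟩ := pair_inj h3
      obtain ⟨-, rfl⟩ := pair_inj h3
      obtain ⟨π, hπ, hπ1, hπ2⟩ := exists_sub_of_comparable hz hρ' h2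
      refine ⟨pair (fst z + 1) (pair (snoc π 0) (pair m ρ)), ?_, ?_⟩
      · simpa using snoc_zero_mem_finPartition hk hπ
      · simp only [fst_pair, snd_pair, true_and]
        refine ⟨hπ1.trans (sub_snoc _ _), ?_, h1, hπ2.trans (sub_snoc _ _)⟩
        rw [len_snoc]
        exact lt_of_le_of_lt hπ1.1 (lt_add_one _))
  set S : M.Num → M.Num := fun n => fst (snd (g n)) with hS
  have hSr : RecF S := by fun_prop
  have hSP : ∀ n, S n ∈ M.FinPartition k := fun n => (hg' n).1
  have hn : ∀ n, fst (g n) = n := by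
    refine rec_induction (P := fun n => fst (g n) = n) (by fun_prop) (by simp [hg0]) fun n ih => ?_
    rw [(hg' n).2.1, ih]
  have hlen : ∀ n, n ≤ len (S n) := by
    refine rec_induction (P := fun n => n ≤ len (S n)) (by fun_prop) (zero_le' _) fun n ih => ?_
    exact lt_iff_add_one_le'.1 (lt_of_le_of_lt ih (hg' n).2.2.2.1)
  have hmono : ∀ n d, Sub (S n) (S (n + d)) := by
    intro n
    refine rec_induction (P := fun d => Sub (S n) (S (n + d))) (by fun_prop) ?_ fun d ih => ?_
    · rw [add_zero]; exact Sub.refl _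
    · rw [← add_assoc]; exact ih.trans (hg' (n + d)).2.2.1
  set x : M.Num → M.Num := fun i => ent (S (i + 1)) i with hx
  have hxr : RecF x := by fun_prop
  have hxS : ∀ n, ∀ i < len (S n), ent (S n) i = x i := by
    intro n i hi
    have hi' : i < len (S (i + 1)) := lt_of_lt_of_le (lt_add_one i) (hlen _)
    rcases le_total n (i + 1) with h | h
    · obtain ⟨d, hd⟩ := exists_add_of_le h
      have := (hmono n d).2 i hi
      rwa [← hd] at this
    · obtain ⟨d, rfl⟩ := exists_add_of_le h
      exact ((hmono (i + 1) d).2 i hi').symm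
  have hprec : ∀ n, PrecFun (S n) (graph x) := fun n =>
    precFun_graph.2 ⟨isSeq_of_mem_finPartition (hSP n), hxS n⟩
  refine ⟨graph x, mem_partition.2 ⟨x, hxr, rfl, fun n => ?_, fun n j hj => ?_, fun i hi => ?_⟩,
    ?_, fun n => ?_⟩
  · exact (mem_finPartition.1 (hSP (n + 1))).2.1 n (lt_of_lt_of_le (lt_add_one n) (hlen _))
  · have h1 : n < len (S (n + 1)) := lt_of_lt_of_le (lt_add_one n) (hlen _)
    obtain ⟨m, hm, hm'⟩ := (mem_finPartition.1 (hSP (n + 1))).2.2.1 n h1 j hj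
    exact ⟨m, hm, by rw [← hxS (n + 1) m (hm.trans h1), hm']⟩
  · obtain ⟨n, hn, hn'⟩ := (mem_finPartition.1 (hSP 0)).2.2.2 i hi
    exact ⟨n, by rw [← hxS 0 n hn, hn']⟩
  · have : S 0 = σ₀ := by simp [hS, hg0]
    rw [← this]; exact hprec 0
  · obtain ⟨-, -, -, h1, h2⟩ := (hg' n).2
    rw [hn n] at h1
    refine ⟨_, _, pair_mem_openSlice.2 h1, (hprec (n + 1)).of_sub ?_ h2⟩
    obtain ⟨i', n', ρ', hρ', h3⟩ := hD.2 _ h1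
    obtain ⟨-, h3⟩ := pair_inj h3
    obtain ⟨-, h3⟩ := pair_inj h3
    rw [h3]
    exact isSeq_of_mem_finPartition hρ'

theorem evaluated_of_baireCode {k : ℕ} (hk : 0 < k) {τ : Set M.Num}
    (h : M.BorelCodesHaveBaireCode k τ) : M.BorelCodesHaveEvaluatedPoint k τ := by
  intro B hB
  obtain ⟨U, V, D, hbc⟩ := h B hB
  obtain ⟨σ, hσ⟩ := finPartition_nonempty (M := M) k
  obtain ⟨n, ρ, hρ, hcomp⟩ := hbc.denseUV σ hσ
  have hρ' : ρ ∈ M.FinPartition k := by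
    rcases hρ with h1 | h1
    · obtain ⟨_, ρ', h2, h3⟩ := hbc.openU.2 _ h1
      rwa [(pair_inj h3).2]
    · obtain ⟨_, ρ', h2, h3⟩ := hbc.openV.2 _ h1
      rwa [(pair_inj h3).2]
  obtain ⟨x, hx, hρx, hxD⟩ := exists_generic hk hbc.openD hbc.denseD hρ'
  refine ⟨x, hx, ?_⟩
  rcases hρ with h1 | h1
  · exact Or.inl (hbc.mem_of_mem x hx hxD ⟨n, ρ, h1, hρx⟩)
  · exact Or.inr (hbc.not_mem_of_mem x hx hxD ⟨n, ρ, h1, hρx⟩)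

end L2Structure

namespace L2Structure

variable {M : L2Structure.{u}} [hM : Fact M.RCA0]

/-! ### The Kleene–Brouwer order -/

section ArithmeticalComprehension

variable [hex : Fact (ClosedUnderExists M)]

omit hM in
@[fun_prop]
theorem rec_exists {P : M.Num → M.Num → Prop} (hP : Rec (fun z => P (fst z) (snd z))) :
    Rec (fun c => ∃ y, P c y) :=
  hex.out P hP

@[fun_prop]
theorem rec_forall {P : M.Num → M.Num → Prop} (hP : Rec (fun z => P (fst z) (snd z))) :
    Rec (fun c => ∀ y, P c y) :=
  (hex.out (fun c y => ¬ P c y) hP.not).not.congr fun c => by push Not; rfl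

end ArithmeticalComprehension

/-- The strict Kleene–Brouwer order of finite sequences: `σ` properly extends `ρ`, or `σ` has the
smaller entry at the first place where the two differ. -/
def KBLT (σ ρ : M.Num) : Prop := ∃ i < len σ, i ≤ len ρ ∧ (∀ j < i, ent σ j = ent ρ j) ∧
  (i < len ρ → ent σ i < ent ρ i)

@[fun_prop]
theorem rec_kblt {f g : M.Num → M.Num} (hf : RecF f) (hg : RecF g) :
    Rec (fun c => KBLT (f c) (g c)) := by
  unfold KBLT
  fun_prop

theorem KBLT.trans {σ ρ π : M.Num} (h : KBLT σ ρ) (h' : KBLT ρ π) : KBLT σ π := by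
  obtain ⟨i, hi, hi', hi1, hi2⟩ := h
  obtain ⟨j, hj, hj', hj1, hj2⟩ := h'
  rcases lt_trichotomy i j with hij | rfl | hij
  · refine ⟨i, hi, hij.le.trans hj', fun l hl => (hi1 l hl).trans (hj1 l (hl.trans hij)),
      fun _ => ?_⟩
    rw [← hj1 i hij]; exact hi2 (hij.trans hj)
  · exact ⟨i, hi, hj', fun l hl => (hi1 l hl).trans (hj1 l hl),
      fun h => (hi2 hj).trans (hj2 h)⟩
  · refine ⟨j, hij.trans hi, hj', fun l hl => (hi1 l (hl.trans hij)).trans (hj1 l hl),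
      fun h => ?_⟩
    rw [hi1 j hij]; exact hj2 h

theorem KBLT.irrefl (σ : M.Num) : ¬ KBLT σ σ := by
  rintro ⟨i, hi, _, _, h⟩
  exact lt_irrefl _ (h hi)

theorem KBLT.total {σ ρ : M.Num} (hσ : IsSeq σ) (hρ : IsSeq ρ) (hne : σ ≠ ρ) :
    KBLT σ ρ ∨ KBLT ρ σ := by
  by_cases h : ∃ i, i < len σ ∧ i < len ρ ∧ ent σ i ≠ ent ρ i
  · obtain ⟨i₀, h₀⟩ := h
    obtain ⟨i, ⟨h1, h2, h3⟩, hmin⟩ := exists_least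
      (P := fun i => i < len σ ∧ i < len ρ ∧ ent σ i ≠ ent ρ i) (by fun_prop) h₀
    have h4 : ∀ j < i, ent σ j = ent ρ j := by
      intro j hj
      by_contra hj'
      exact hmin j hj ⟨hj.trans h1, hj.trans h2, hj'⟩
    rcases lt_or_gt_of_ne h3 with h5 | h5
    · exact Or.inl ⟨i, h1, h2.le, h4, fun _ => h5⟩
    · exact Or.inr ⟨i, h2, h1.le, fun j hj => (h4 j hj).symm, fun _ => h5⟩
  · push Not at h
    rcases lt_trichotomy (len σ) (len ρ) with h1 | h1 | h1
    · exact Or.inr ⟨len σ, h1, le_rfl, fun j hj => (h j hj (hj.trans h1)).symm,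
        fun h => absurd h (lt_irrefl _)⟩
    · exact absurd (hσ.ext hρ h1 fun i hi => h i hi (h1 ▸ hi)) hne
    · exact Or.inl ⟨len ρ, h1, le_rfl, fun j hj => h j (hj.trans h1) hj,
        fun h => absurd h (lt_irrefl _)⟩

theorem kblt_snoc (σ m : M.Num) : KBLT (snoc σ m) σ :=
  ⟨len σ, by rw [len_snoc]; exact lt_add_one _, le_rfl, fun _ hj => ent_snoc_of_lt hj,
    fun h => absurd h (lt_irrefl _)⟩

/-- The Kleene–Brouwer order of a set of finite sequences. -/
def kbOrder (T : Set M.Num) : Set M.Num :=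
  {z | IsPair z ∧ fst z ∈ T ∧ snd z ∈ T ∧ (fst z = snd z ∨ KBLT (fst z) (snd z))}

theorem kbOrder_mem_sets {T : Set M.Num} (hT : T ∈ M.Sets) : kbOrder T ∈ M.Sets := by
  have : Rec (fun z => IsPair z ∧ fst z ∈ T ∧ snd z ∈ T ∧
    (fst z = snd z ∨ KBLT (fst z) (snd z))) := by fun_prop (disch := assumption)
  exact this

theorem relLE_kbOrder {T : Set M.Num} {σ ρ : M.Num} :
    relLE (kbOrder T) σ ρ ↔ σ ∈ T ∧ ρ ∈ T ∧ (σ = ρ ∨ KBLT σ ρ) := by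
  simp [relLE, kbOrder, isPair_pair]

theorem relLT_kbOrder {T : Set M.Num} {σ ρ : M.Num} :
    relLT (kbOrder T) σ ρ ↔ σ ∈ T ∧ ρ ∈ T ∧ KBLT σ ρ := by
  unfold relLT
  rw [relLE_kbOrder, relLE_kbOrder]
  constructor
  · rintro ⟨⟨h1, h2, rfl | h3⟩, h4⟩
    · exact absurd ⟨h1, h1, Or.inl rfl⟩ h4
    · exact ⟨h1, h2, h3⟩
  · rintro ⟨h1, h2, h3⟩
    refine ⟨⟨h1, h2, Or.inr h3⟩, ?_⟩
    rintro ⟨_, _, rfl | h4⟩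
    · exact KBLT.irrefl _ h3
    · exact KBLT.irrefl _ (h3.trans h4)

theorem mem_field_kbOrder {T : Set M.Num} {σ : M.Num} : σ ∈ field (kbOrder T) ↔ σ ∈ T := by
  change relLE (kbOrder T) σ σ ↔ _
  rw [relLE_kbOrder]
  simp

theorem isLO_kbOrder {T : Set M.Num} (hT : ∀ σ ∈ T, IsSeq σ) : IsLO (kbOrder T) where
  refl i j h := by
    rw [relLE_kbOrder] at h
    exact ⟨mem_field_kbOrder.2 h.1, mem_field_kbOrder.2 h.2.1⟩
  trans i j k h h' := by
    rw [relLE_kbOrder] at h h' ⊢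
    refine ⟨h.1, h'.2.1, ?_⟩
    rcases h.2.2 with rfl | h1
    · exact h'.2.2
    · rcases h'.2.2 with rfl | h2
      · exact Or.inr h1
      · exact Or.inr (h1.trans h2)
  antisymm i j h h' := by
    rw [relLE_kbOrder] at h h'
    rcases h.2.2 with rfl | h1
    · rfl
    · rcases h'.2.2 with rfl | h2
      · rfl
      · exact absurd (h1.trans h2) (KBLT.irrefl _)
  total i hi j hj := by
    rw [mem_field_kbOrder] at hi hj
    rw [relLE_kbOrder, relLE_kbOrder]
    by_cases h : i = j
    · exact Or.inl ⟨hi, hj, Or.inl h⟩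
    · rcases KBLT.total (hT i hi) (hT j hj) h with h1 | h1
      · exact Or.inl ⟨hi, hj, Or.inr h1⟩
      · exact Or.inr ⟨hj, hi, Or.inr h1⟩

section WellOrder

variable [hex : Fact (ClosedUnderExists M)] {g : M.Num → M.Num}

theorem exists_snoc_eventually_sub (hg : RecF g) (hdesc : ∀ n, KBLT (g (n + 1)) (g n))
    {σ n : M.Num} (h : ∀ m, n ≤ m → Sub σ (g m)) :
    ∃ c n', ∀ m, n' ≤ m → Sub (snoc σ c) (g m) := by
  have hi : ∀ m, n ≤ m → ∃ i < len (g (m + 1)), len σ ≤ i ∧ i ≤ len (g m) ∧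
      (∀ j < i, ent (g (m + 1)) j = ent (g m) j) ∧
      (i < len (g m) → ent (g (m + 1)) i < ent (g m) i) := by
    intro m hm
    obtain ⟨i, h1, h2, h3, h4⟩ := hdesc m
    refine ⟨i, h1, ?_, h2, h3, h4⟩
    by_contra! hlt
    have h5 := h m hm
    have h6 := h (m + 1) (hm.trans le_self_add)
    have h7 := h4 (hlt.trans_le h5.1)
    rw [← h5.2 i hlt, ← h6.2 i hlt] at h7
    exact lt_irrefl _ h7
  have hlen : ∀ m, n + 1 ≤ m → len σ < len (g m) := by
    intro m hm
    obtain ⟨d, rfl⟩ := exists_add_of_le hm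
    obtain ⟨i, h1, h2, _⟩ := hi (n + d) le_self_add
    rw [add_right_comm]
    exact lt_of_le_of_lt h2 h1
  have hle : ∀ m, n + 1 ≤ m → ent (g (m + 1)) (len σ) ≤ ent (g m) (len σ) := by
    intro m hm
    obtain ⟨i, _, h2, h3, h4, h5⟩ := hi m (le_self_add.trans hm)
    rcases h2.lt_or_eq with h6 | rfl
    · exact (h4 _ h6).le
    · exact (h5 (hlen m hm)).le
  obtain ⟨c, ⟨m₁, hm₁, rfl⟩, hmin⟩ := exists_least
    (P := fun c => ∃ m, n + 1 ≤ m ∧ ent (g m) (len σ) = c) (by fun_prop)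
    ⟨n + 1, le_rfl, rfl⟩
  have hc : ∀ d, ent (g (m₁ + d)) (len σ) = ent (g m₁) (len σ) := by
    refine rec_induction (P := fun d => ent (g (m₁ + d)) (len σ) = ent (g m₁) (len σ))
      (by fun_prop) (by rw [add_zero]) fun d ih => ?_
    rw [← add_assoc]
    have h1 : n + 1 ≤ m₁ + d := hm₁.trans le_self_add
    refine le_antisymm ((hle _ h1).trans ih.le) ?_
    by_contra! hlt
    exact hmin _ hlt ⟨_, h1.trans le_self_add, rfl⟩
  refine ⟨ent (g m₁) (len σ), m₁, fun m hm => ?_⟩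
  obtain ⟨d, rfl⟩ := exists_add_of_le hm
  have h1 : n + 1 ≤ m₁ + d := hm₁.trans le_self_add
  refine ⟨?_, fun i hi => ?_⟩
  · rw [len_snoc]; exact lt_iff_add_one_le'.1 (hlen _ h1)
  · rw [len_snoc, lt_add_one_iff'] at hi
    rcases hi.lt_or_eq with h2 | rfl
    · rw [ent_snoc_of_lt h2]
      exact (h _ (le_self_add.trans h1)).2 i h2
    · rw [ent_snoc_last, hc]

theorem isWO_kbOrder {T : Set M.Num} (hT : IsTree T)
    (hp : ¬ ∃ g ∈ M.Sets, IsFun g Set.univ Set.univ ∧ ∀ n, ∃ σ ∈ T, IsRestriction g n σ) :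
    IsWO (kbOrder T) := by
  refine ⟨isLO_kbOrder hT.1, ?_⟩
  rintro ⟨F, hF, hF', hdesc⟩
  obtain ⟨g, hg, rfl, hgT⟩ := exists_recF_of_isFun hF hF'
  replace hgT : ∀ n, g n ∈ T := fun n => mem_field_kbOrder.1 (hgT n)
  replace hdesc : ∀ n, KBLT (g (n + 1)) (g n) := fun n =>
    (relLT_kbOrder.1 (hdesc n _ _ (pair_mem_graph_iff.2 rfl) (pair_mem_graph_iff.2 rfl))).2.2
  let P : M.Num → Prop := fun σ => IsSeq σ ∧ ∃ n, ∀ m, n ≤ m → Sub σ (g m)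
  have hP : ∀ l, ∃ σ, P σ ∧ len σ = l := by
    refine rec_induction (P := fun l => ∃ σ, P σ ∧ len σ = l) ?_ ?_ ?_
    · simp only [P]
      fun_prop
    · refine ⟨nil, ⟨isSeq_nil, 0, fun m _ => ⟨?_, fun i hi => ?_⟩⟩, len_nil⟩
      · rw [len_nil]; exact zero_le' _
      · rw [len_nil] at hi
        exact absurd hi (zero_le' i).not_gt
    · rintro l ⟨σ, ⟨h1, n, hn⟩, rfl⟩
      obtain ⟨c, n', h2⟩ := exists_snoc_eventually_sub hg hdesc hn
      exact ⟨snoc σ c, ⟨isSeq_snoc _ _, n', h2⟩, len_snoc _ _⟩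
  have hPT : ∀ σ, P σ → σ ∈ T := fun σ ⟨h1, n, hn⟩ =>
    hT.2 _ (hgT n) _ (initSeg_iff.2 ⟨h1, hT.1 _ (hgT n), hn n le_rfl⟩)
  have hcomp : ∀ σ ρ i, P σ → P ρ → i < len σ → i < len ρ → ent σ i = ent ρ i := by
    rintro σ ρ i ⟨_, n, hn⟩ ⟨_, n', hn'⟩ h1 h2
    rw [(hn (n + n') le_self_add).2 i h1, (hn' (n + n') le_add_self).2 i h2]
  choose s hs hs' using hP
  have hslt : ∀ i, i < len (s (i + 1)) := fun i => by rw [hs']; exact lt_add_one i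
  have hpr : RecF (fun i => ent (s (i + 1)) i) := by
    refine RecF.of_iff (fun i y => ∃ σ, P σ ∧ i < len σ ∧ ent σ i = y) ?_ fun i y => ⟨?_, ?_⟩
    · simp only [P]
      fun_prop
    · exact fun h => ⟨_, hs (i + 1), hslt i, h⟩
    · rintro ⟨σ, hσ, h1, rfl⟩
      exact hcomp _ _ _ (hs _) hσ (hslt i) h1
  refine hp ⟨graph _, hpr.graph_mem, isFun_graph fun _ => trivial, fun n =>
    ⟨s n, hPT _ (hs n), isRestriction_graph.2 ⟨(hs n).1, hs' n, fun i hi => ?_⟩⟩⟩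
  exact hcomp _ _ _ (hs _) (hs _) (by rwa [hs']) (hslt i)

end WellOrder

end L2Structure

namespace L2Structure

variable {M : L2Structure.{u}} [hM : Fact M.RCA0]

/-! ### Baire codes from arithmetical transfinite recursion -/

/-- The recursion that defines forcing.  `L` is the value at the leaves, `A` and `A'` are the
positive and the negative clause, and `r ≤ t` is the order of the conditions. -/
theorem exists_forcing (hATR : M.ATR0) {X : Set M.Num} (hXs : X ∈ M.Sets) (hX : IsWO X)
    {L le : M.Num → M.Num → Prop} {A A' : M.Num → M.Num → M.Num → M.Num → Prop}
    (hL : Rec (fun n => L (fst n) (snd n))) (hle : Rec (fun n => le (fst n) (snd n)))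
    (hA : Rec (fun c => A (fst (fst c)) (snd (fst c)) (fst (snd c)) (snd (snd c))))
    (hA' : Rec (fun c => A' (fst (fst c)) (snd (fst c)) (fst (snd c)) (snd (snd c))))
    (hAX : ∀ σ s σ' t, A σ s σ' t → relLT X σ' σ)
    (hAX' : ∀ σ s σ' t, A' σ s σ' t → relLT X σ' σ) :
    ∃ W : M.Num → M.Num → Prop, Rec (fun n => W (fst n) (snd n)) ∧ ∀ σ ∈ field X, ∀ s,
      (W σ s ↔ L σ s ∨ (∃ σ' t, A σ s σ' t ∧ W σ' t) ∨
        ∃ σ' t, A' σ s σ' t ∧ ∀ r, le r t → ¬ W σ' r) := by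
  let pos : M.Num → M.Num → M.Num := fun σ s => pair (pair σ s) σ
  let isPos : M.Num → Prop := fun z => IsPair z ∧ IsPair (fst z) ∧ fst (fst z) = snd z
  have hpos : ∀ z, isPos z → ∃ σ s, z = pos σ s := by
    rintro _ ⟨⟨a, b, rfl⟩, h1, h2⟩
    simp only [fst_pair, snd_pair] at h1 h2
    obtain ⟨c, d, rfl⟩ := h1
    rw [fst_pair] at h2
    exact ⟨b, d, by rw [h2]⟩
  have hisPos : ∀ σ s, isPos (pos σ s) := fun σ s =>
    ⟨isPair_pair _ _, by simp [pos, isPair_pair], by simp [pos]⟩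
  let R : (M.Num → M.Num → M.Num → M.Num → Prop) → Set M.Num := fun A => {c | isPos (snd c) ∧
    A (fst (fst c)) (snd (fst c)) (snd (snd c)) (snd (fst (snd c)))}
  have hRmem : ∀ A σ s σ' t, pair (pair σ s) (pos σ' t) ∈ R A ↔ A σ s σ' t := by
    intro A σ s σ' t
    simp only [R, Set.mem_ofPred_eq, fst_pair, snd_pair, hisPos, true_and]
    simp [pos]
  have hR : ∀ A : M.Num → M.Num → M.Num → M.Num → Prop,
      Rec (fun c => A (fst (fst c)) (snd (fst c)) (fst (snd c)) (snd (snd c))) → R A ∈ M.Sets := by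
    intro A hA
    have h1 : Rec (fun c : M.Num => isPos (snd c)) := by
      simp only [isPos]
      fun_prop
    have h2 := hA.comp (f := fun c => pair (fst c) (pair (snd (snd c)) (snd (fst (snd c)))))
      (by fun_prop)
    simp only [fst_pair, snd_pair] at h2
    exact h1.and h2
  let ext : Set M.Num := {c | isPos (snd c) ∧ snd (snd c) = snd (fst c) ∧
    le (snd (fst (snd c))) (snd (fst (fst c)))}
  have hext : ext ∈ M.Sets := by
    have h1 : Rec (fun c : M.Num => isPos (snd c)) := by
      simp only [isPos]
      fun_prop
    have h2 := hle.comp₂ (f := fun c => snd (fst (snd c))) (g := fun c => snd (fst (fst c)))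
      (by fun_prop) (by fun_prop)
    have h3 : Rec (fun c : M.Num => snd (snd c) = snd (fst c)) := by fun_prop
    exact h1.and (h3.and h2)
  have hextmem : ∀ σ t σ' r, pair (pos σ t) (pos σ' r) ∈ ext ↔ σ' = σ ∧ le r t := by
    intro σ t σ' r
    simp only [ext, Set.mem_ofPred_eq, fst_pair, snd_pair, hisPos, true_and]
    simp [pos]
  obtain ⟨Y, hY, -, hY'⟩ := hATR.transfinite_recursion
    (.or (.mem (.var 0) 1) (.or
      (.ex (.and (.mem (pairTerm (.var 1) (.var 0)) 2) (.mem (.var 0) 0)))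
      (.ex (.and (.mem (pairTerm (.var 1) (.var 0)) 3)
        (.all (.imp (.mem (pairTerm (.var 1) (.var 0)) 4) (.neg (.mem (.var 0) 0))))))))
    (fun _ => 0) (pushVar {n | L (fst n) (snd n)} (pushVar (R A) (pushVar (R A') fun _ => ext)))
    (forall_pushVar_mem hL (forall_pushVar_mem (hR A hA) (forall_pushVar_mem (hR A' hA')
      fun _ => hext))) X hXs hX
  have hYpos : ∀ σ ∈ field X, ∀ s, (pos σ s ∈ Y ↔ L σ s ∨
      (∃ z, pair (pair σ s) z ∈ R A ∧ z ∈ below X Y σ) ∨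
      ∃ z, pair (pair σ s) z ∈ R A' ∧ ∀ w, pair z w ∈ ext → w ∉ below X Y σ) := by
    intro σ hσ s
    rw [hY']
    constructor
    · rintro ⟨n, j, h1, _, h2⟩
      obtain ⟨rfl, rfl⟩ := pair_inj h1
      rcases h2 with h2 | h2
      · refine Or.inl ?_
        have h3 : L (fst (pair σ s)) (snd (pair σ s)) := h2
        simpa using h3
      · exact Or.inr h2
    · intro h
      refine ⟨pair σ s, σ, rfl, hσ, h.imp (fun h1 => ?_) id⟩
      change L (fst (pair σ s)) (snd (pair σ s))
      simpa using h1
  have hbelow : ∀ σ' t σ, relLT X σ' σ → (pos σ' t ∈ below X Y σ ↔ pos σ' t ∈ Y) := by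
    intro σ' t σ h
    constructor
    · rintro ⟨m, a, h1, _, h2⟩
      rw [h1]; exact h2
    · exact fun h1 => ⟨_, _, rfl, h, h1⟩
  refine ⟨fun σ s => pos σ s ∈ Y, by simp only [pos]; fun_prop (disch := assumption),
    fun σ hσ s => ?_⟩
  refine (hYpos σ hσ s).trans (or_congr_right (or_congr ⟨?_, ?_⟩ ⟨?_, ?_⟩))
  · rintro ⟨z, h1, h2⟩
    obtain ⟨σ', t, rfl⟩ := hpos z (by have := h1.1; rwa [snd_pair] at this)
    rw [hRmem] at h1
    exact ⟨σ', t, h1, (hbelow _ _ _ (hAX _ _ _ _ h1)).1 h2⟩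
  · rintro ⟨σ', t, h1, h2⟩
    exact ⟨pos σ' t, (hRmem _ _ _ _ _).2 h1, (hbelow _ _ _ (hAX _ _ _ _ h1)).2 h2⟩
  · rintro ⟨z, h1, h2⟩
    obtain ⟨σ', t, rfl⟩ := hpos z (by have := h1.1; rwa [snd_pair] at this)
    rw [hRmem] at h1
    refine ⟨σ', t, h1, fun r hr hW => ?_⟩
    exact h2 _ ((hextmem _ _ _ _).2 ⟨rfl, hr⟩) ((hbelow _ _ _ (hAX' _ _ _ _ h1)).2 hW)
  · rintro ⟨σ', t, h1, h2⟩
    refine ⟨pos σ' t, (hRmem _ _ _ _ _).2 h1, fun w hw hw' => ?_⟩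
    obtain ⟨σ'', r, rfl⟩ := hpos w (by have := hw.1; rwa [snd_pair] at this)
    obtain ⟨rfl, hr⟩ := (hextmem _ _ _ _).1 hw
    exact h2 r hr ((hbelow _ _ _ (hAX' _ _ _ _ h1)).1 hw')

/-- The last entry of `σ` is even. -/
def EvenLast (σ : M.Num) : Prop := ∃ c ≤ σ, IsLast σ (2 * c)

@[fun_prop]
theorem rec_evenLast {f : M.Num → M.Num} (hf : RecF f) : Rec (fun c => EvenLast (f c)) := by
  unfold EvenLast
  fun_prop

theorem IsLast.lt {σ a : M.Num} (h : IsLast σ a) : a < σ := by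
  obtain ⟨n, _, h2⟩ := h
  exact h2.lt_right

theorem IsLast.unique {σ a b : M.Num} (h : IsLast σ a) (h' : IsLast σ b) : a = b := by
  obtain ⟨_, l, h1, rfl⟩ := isLast_iff.1 h
  obtain ⟨_, l', h2, rfl⟩ := isLast_iff.1 h'
  rw [add_right_cancel (h1.symm.trans h2)]

theorem IsLast.evenLast {σ c : M.Num} (h : IsLast σ (2 * c)) : EvenLast σ :=
  ⟨c, le_trans (by rw [two_mul]; exact le_self_add) h.lt.le, h⟩

theorem IsLast.not_evenLast {σ c : M.Num} (h : IsLast σ (2 * c + 1)) : ¬ EvenLast σ := by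
  rintro ⟨d, _, hd⟩
  have h1 : 2 * d + 0 = 2 * c + 1 := by rw [add_zero]; exact hd.unique h
  exact zero_ne_one (two_mul_add_inj two_pos one_lt_two' h1).2

theorem isLeaf_iff {B : Set M.Num} {σ : M.Num} (hB : IsTree B) :
    IsLeaf B σ ↔ σ ∈ B ∧ ∀ m, snoc σ m ∉ B := by
  refine and_congr_right fun h => ?_
  simp only [isSnoc_iff]
  constructor
  · exact fun h1 m hm => h1 ⟨m, _, hm, hB.1 _ h, rfl⟩
  · rintro h1 ⟨m, _, hρ, _, rfl⟩
    exact h1 m hρ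

end L2Structure

namespace L2Structure

variable {M : L2Structure.{u}} [hM : Fact M.RCA0]

/-- `u` is a condition below `s` and `σ'` is a child of `σ` in `B`. -/
def ChildCond (k : ℕ) (B : Set M.Num) (σ s σ' u : M.Num) : Prop :=
  (∃ m, σ' = snoc σ m) ∧ σ ∈ B ∧ σ' ∈ B ∧ u ∈ M.FinPartition k ∧ Sub u s

/-- No extension of the condition `s` belongs to `W σ`. -/
def NegForce (k : ℕ) (W : M.Num → M.Num → Prop) (σ s : M.Num) : Prop :=
  ∀ r, r ∈ M.FinPartition k ∧ Sub s r → ¬ W σ r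

/-- The condition `s` decides the leaf `σ` by extending the sequence that it is labelled with. -/
def LeafForce (t : M.Num → M.Num) (B : Set M.Num) (σ s : M.Num) : Prop :=
  IsLeaf B σ ∧ ∃ m, (IsLast σ (2 * m + 2) ∨ IsLast σ (2 * m + 3)) ∧ Sub (t m) s

/-- `W σ s` says that the condition `s` forces a generic point into the set coded by the node `σ`
if the label of `σ` is even, and out of it if the label is odd. -/
structure IsForcing (k : ℕ) (t : M.Num → M.Num) (B : Set M.Num) (W : M.Num → M.Num → Prop) :
    Prop where
  isRec : Rec (fun n => W (fst n) (snd n))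
  iff : ∀ σ ∈ B, ∀ s, (W σ s ↔ LeafForce t B σ s ∨
    (∃ σ' u, (ChildCond k B σ s σ' u ∧ (EvenLast σ ↔ EvenLast σ')) ∧ W σ' u) ∨
    ∃ σ' u, (ChildCond k B σ s σ' u ∧ ¬ (EvenLast σ ↔ EvenLast σ')) ∧ NegForce k W σ' u)

/-- `s` forces a generic point into the set coded by the node `σ`. -/
def PosForce (k : ℕ) (W : M.Num → M.Num → Prop) (σ s : M.Num) : Prop :=
  (EvenLast σ ∧ W σ s) ∨ (¬ EvenLast σ ∧ NegForce k W σ s)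

/-- `s` forces a generic point out of the set coded by the node `σ`. -/
def CoForce (k : ℕ) (W : M.Num → M.Num → Prop) (σ s : M.Num) : Prop :=
  (EvenLast σ ∧ NegForce k W σ s) ∨ (¬ EvenLast σ ∧ W σ s)

/-- Some initial segment of `x` has the property `Φ`. -/
def Meets (k : ℕ) (x : Set M.Num) (Φ : M.Num → Prop) : Prop :=
  ∃ s, s ∈ M.FinPartition k ∧ PrecFun s x ∧ Φ s

section

variable [hex : Fact (ClosedUnderExists M)]

theorem rec_negForce {k : ℕ} {W : M.Num → M.Num → Prop} (hW : Rec (fun n => W (fst n) (snd n)))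
    {f g : M.Num → M.Num} (hf : RecF f) (hg : RecF g) :
    Rec (fun c => NegForce k W (f c) (g c)) := by
  have h1 := hW.comp₂ (f := fun z => f (fst z)) (g := fun z => snd z) (by fun_prop) (by fun_prop)
  exact rec_forall (P := fun c r => r ∈ M.FinPartition k ∧ Sub (g c) r → ¬ W (f c) r)
    (Rec.imp (by fun_prop) h1.not)

theorem rec_posForce {k : ℕ} {W : M.Num → M.Num → Prop} (hW : Rec (fun n => W (fst n) (snd n)))
    {f g : M.Num → M.Num} (hf : RecF f) (hg : RecF g) :
    Rec (fun c => PosForce k W (f c) (g c)) := by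
  have h1 := rec_negForce (k := k) hW hf hg
  have h2 := hW.comp₂ hf hg
  unfold PosForce
  exact Rec.or (Rec.and (by fun_prop) h2) (Rec.and (by fun_prop) h1)

theorem rec_coForce {k : ℕ} {W : M.Num → M.Num → Prop} (hW : Rec (fun n => W (fst n) (snd n)))
    {f g : M.Num → M.Num} (hf : RecF f) (hg : RecF g) :
    Rec (fun c => CoForce k W (f c) (g c)) := by
  have h1 := rec_negForce (k := k) hW hf hg
  have h2 := hW.comp₂ hf hg
  unfold CoForce
  exact Rec.or (Rec.and (by fun_prop) h1) (Rec.and (by fun_prop) h2)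

theorem exists_isForcing (hATR : M.ATR0) (k : ℕ) {t : M.Num → M.Num} (ht : RecF t)
    {B : Set M.Num} (hB : M.IsBorelCode B) : ∃ W, IsForcing k t B W := by
  have hBs := hB.mem_sets
  obtain ⟨W, hW, hW'⟩ := exists_forcing hATR (kbOrder_mem_sets hBs)
    (isWO_kbOrder hB.tree hB.no_path) (L := LeafForce t B)
    (le := fun r s => r ∈ M.FinPartition k ∧ Sub s r)
    (A := fun σ s σ' u => ChildCond k B σ s σ' u ∧ (EvenLast σ ↔ EvenLast σ'))
    (A' := fun σ s σ' u => ChildCond k B σ s σ' u ∧ ¬ (EvenLast σ ↔ EvenLast σ'))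
    (by
      simp only [LeafForce, isLeaf_iff hB.tree]
      fun_prop (disch := assumption)) (by fun_prop)
    (by
      simp only [ChildCond]
      fun_prop (disch := assumption))
    (by
      simp only [ChildCond]
      fun_prop (disch := assumption))
    (by
      rintro σ s _ u ⟨⟨⟨m, rfl⟩, h1, h2, -⟩, -⟩
      exact relLT_kbOrder.2 ⟨h2, h1, kblt_snoc _ _⟩)
    (by
      rintro σ s _ u ⟨⟨⟨m, rfl⟩, h1, h2, -⟩, -⟩
      exact relLT_kbOrder.2 ⟨h2, h1, kblt_snoc _ _⟩)
  exact ⟨W, hW, fun σ hσ s => hW' σ (mem_field_kbOrder.2 hσ) s⟩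

end

section

variable {k : ℕ} {t : M.Num → M.Num} {B : Set M.Num} {W : M.Num → M.Num → Prop}

theorem LeafForce.mono {σ s s' : M.Num} (h : LeafForce t B σ s) (hs : Sub s s') :
    LeafForce t B σ s' :=
  ⟨h.1, h.2.imp fun _ hm => ⟨hm.1, hm.2.trans hs⟩⟩

theorem ChildCond.mono {σ s s' σ' u : M.Num} (h : ChildCond k B σ s σ' u) (hs : Sub s s') :
    ChildCond k B σ s' σ' u :=
  ⟨h.1, h.2.1, h.2.2.1, h.2.2.2.1, h.2.2.2.2.trans hs⟩

theorem IsForcing.mono (hW : IsForcing k t B W) {σ s s' : M.Num} (hσ : σ ∈ B) (h : W σ s)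
    (hs : Sub s s') : W σ s' := by
  rw [hW.iff σ hσ] at h ⊢
  rcases h with h | ⟨σ', u, h1, h2⟩ | ⟨σ', u, h1, h2⟩
  · exact Or.inl (h.mono hs)
  · exact Or.inr (Or.inl ⟨σ', u, ⟨h1.1.mono hs, h1.2⟩, h2⟩)
  · exact Or.inr (Or.inr ⟨σ', u, ⟨h1.1.mono hs, h1.2⟩, h2⟩)

variable {g : M.Num → M.Num}

theorem IsForcing.not_meets_both (hW : IsForcing k t B W) {σ : M.Num} (hσ : σ ∈ B)
    (h : Meets k (graph g) (W σ)) (h' : Meets k (graph g) (NegForce k W σ)) : False := by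
  obtain ⟨s, hs, hsx, h1⟩ := h
  obtain ⟨r, hr, hrx, h2⟩ := h'
  rcases hsx.sub_or_sub hrx with h3 | h3
  · exact h2 r ⟨hr, Sub.refl r⟩ (hW.mono hσ h1 h3)
  · exact h2 s ⟨hs, h3⟩ h1

omit hM in
theorem meets_or {x : Set M.Num} {Φ Ψ : M.Num → Prop} :
    Meets k x (fun s => Φ s ∨ Ψ s) ↔ Meets k x Φ ∨ Meets k x Ψ := by
  constructor
  · rintro ⟨s, h1, h2, h3 | h3⟩
    · exact Or.inl ⟨s, h1, h2, h3⟩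
    · exact Or.inr ⟨s, h1, h2, h3⟩
  · rintro (⟨s, h1, h2, h3⟩ | ⟨s, h1, h2, h3⟩)
    · exact ⟨s, h1, h2, Or.inl h3⟩
    · exact ⟨s, h1, h2, Or.inr h3⟩

omit hM in
theorem meets_and {x : Set M.Num} {p : Prop} {Φ : M.Num → Prop} :
    Meets k x (fun s => p ∧ Φ s) ↔ p ∧ Meets k x Φ :=
  ⟨fun ⟨s, h1, h2, h3, h4⟩ => ⟨h3, s, h1, h2, h4⟩,
    fun ⟨h3, s, h1, h2, h4⟩ => ⟨s, h1, h2, h3, h4⟩⟩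

theorem meets_posForce {x : Set M.Num} {σ : M.Num} : Meets k x (PosForce k W σ) ↔
    (EvenLast σ ∧ Meets k x (W σ)) ∨ (¬ EvenLast σ ∧ Meets k x (NegForce k W σ)) := by
  unfold PosForce
  rw [meets_or, meets_and, meets_and]

theorem meets_coForce {x : Set M.Num} {σ : M.Num} : Meets k x (CoForce k W σ) ↔
    (EvenLast σ ∧ Meets k x (NegForce k W σ)) ∨ (¬ EvenLast σ ∧ Meets k x (W σ)) := by
  unfold CoForce
  rw [meets_or, meets_and, meets_and]

/-- The conditions that decide the node `σ` are met. -/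
theorem IsForcing.meets_negForce_iff (hW : IsForcing k t B W) {σ : M.Num} (hσ : σ ∈ B)
    (hgen : Meets k (graph g) (W σ) ∨ Meets k (graph g) (NegForce k W σ)) :
    Meets k (graph g) (NegForce k W σ) ↔ ¬ Meets k (graph g) (W σ) :=
  ⟨fun h h' => hW.not_meets_both hσ h' h, fun h => hgen.resolve_left h⟩

theorem IsForcing.meets_coForce_iff (hW : IsForcing k t B W) {σ : M.Num} (hσ : σ ∈ B)
    (hgen : Meets k (graph g) (W σ) ∨ Meets k (graph g) (NegForce k W σ)) :
    Meets k (graph g) (CoForce k W σ) ↔ ¬ Meets k (graph g) (PosForce k W σ) := by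
  rw [meets_coForce, meets_posForce, hW.meets_negForce_iff hσ hgen]
  tauto

theorem IsForcing.meets_leaf (hW : IsForcing k t B W) (hB : IsTree B)
    (ht : ∀ m, t m ∈ M.FinPartition k) {σ : M.Num} (hσ : IsLeaf B σ) :
    Meets k (graph g) (W σ) ↔
      ∃ m, (IsLast σ (2 * m + 2) ∨ IsLast σ (2 * m + 3)) ∧ PrecFun (t m) (graph g) := by
  have hno : ∀ s σ' u, ¬ ChildCond k B σ s σ' u := by
    rintro s _ u ⟨⟨m, rfl⟩, -, h2, -⟩
    exact ((isLeaf_iff hB).1 hσ).2 m h2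
  have hWL : ∀ s, W σ s ↔ LeafForce t B σ s := by
    intro s
    rw [hW.iff σ hσ.1]
    simp [hno]
  constructor
  · rintro ⟨s, _, h2, h3⟩
    obtain ⟨-, m, h4, h5⟩ := (hWL s).1 h3
    exact ⟨m, h4, h2.of_sub (isSeq_of_mem_finPartition (ht m)) h5⟩
  · rintro ⟨m, h1, h2⟩
    exact ⟨t m, ht m, h2, (hWL _).2 ⟨hσ, m, h1, Sub.refl _⟩⟩

theorem IsForcing.meets_node (hW : IsForcing k t B W) {σ : M.Num} (hσ : σ ∈ B)
    (hl : ¬ IsLeaf B σ) : Meets k (graph g) (W σ) ↔ ∃ m, snoc σ m ∈ B ∧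
      ((EvenLast σ ∧ Meets k (graph g) (PosForce k W (snoc σ m))) ∨
        (¬ EvenLast σ ∧ Meets k (graph g) (CoForce k W (snoc σ m)))) := by
  simp only [meets_posForce, meets_coForce]
  constructor
  · rintro ⟨s, _, h2, h3⟩
    rw [hW.iff σ hσ] at h3
    rcases h3 with h3 | ⟨_, u, ⟨⟨⟨m, rfl⟩, -, h4, h5, h6⟩, h7⟩, h8⟩ |
      ⟨_, u, ⟨⟨⟨m, rfl⟩, -, h4, h5, h6⟩, h7⟩, h8⟩
    · exact absurd h3.1 hl
    · have hm : Meets k (graph g) (W (snoc σ m)) :=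
        ⟨u, h5, h2.of_sub (isSeq_of_mem_finPartition h5) h6, h8⟩
      exact ⟨m, h4, by tauto⟩
    · have hm : Meets k (graph g) (NegForce k W (snoc σ m)) :=
        ⟨u, h5, h2.of_sub (isSeq_of_mem_finPartition h5) h6, h8⟩
      exact ⟨m, h4, by tauto⟩
  · rintro ⟨m, h1, h2⟩
    have hc : ∀ u ∈ M.FinPartition k, ChildCond k B σ u (snoc σ m) u := fun u hu =>
      ⟨⟨m, rfl⟩, hσ, h1, hu, Sub.refl u⟩
    by_cases hp : EvenLast σ ↔ EvenLast (snoc σ m)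
    · obtain ⟨u, hu, hux, h3⟩ : Meets k (graph g) (W (snoc σ m)) := by tauto
      exact ⟨u, hu, hux, (hW.iff σ hσ u).2 (Or.inr (Or.inl ⟨_, u, ⟨hc u hu, hp⟩, h3⟩))⟩
    · obtain ⟨u, hu, hux, h3⟩ : Meets k (graph g) (NegForce k W (snoc σ m)) := by tauto
      exact ⟨u, hu, hux, (hW.iff σ hσ u).2 (Or.inr (Or.inr ⟨_, u, ⟨hc u hu, hp⟩, h3⟩))⟩

variable [hex : Fact (ClosedUnderExists M)]

/-- A sufficiently generic point has an evaluation map, which is given by forcing. -/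
theorem IsForcing.exists_isEvaluation (hW : IsForcing k t B W) (hB : M.IsBorelCode B)
    (ht : ∀ m, t m ∈ M.FinPartition k) (hg : RecF g) {m₀ : M.Num} (hm₀ : snoc nil m₀ ∈ B)
    (hgen : ∀ σ ∈ B, Meets k (graph g) (W σ) ∨ Meets k (graph g) (NegForce k W σ)) :
    ∃ f, M.IsEvaluation (graph t) B (graph g) f ∧
      (pair nil 1 ∈ f ↔ Meets k (graph g) (PosForce k W (snoc nil m₀))) ∧
      (pair nil 0 ∈ f ↔ ¬ Meets k (graph g) (PosForce k W (snoc nil m₀))) := by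
  have hBs := hB.mem_sets
  have hseq : ∀ σ ∈ B, IsSeq σ := hB.tree.1
  have hnil : nil ∈ B := hB.tree.2 _ hm₀ _
    (initSeg_iff.2 ⟨isSeq_nil, isSeq_snoc _ _, sub_snoc _ _⟩)
  have hsnoc : ∀ σ m : M.Num, snoc σ m ≠ nil := by
    intro σ m h
    have := congrArg len h
    rw [len_snoc, len_nil] at this
    exact hM.out.basic.succ_ne_zero _ this
  let val : M.Num → Prop := fun σ =>
    (σ = nil ∧ Meets k (graph g) (PosForce k W (snoc nil m₀))) ∨
      (σ ≠ nil ∧ Meets k (graph g) (PosForce k W σ))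
  have hvaln : val nil ↔ Meets k (graph g) (PosForce k W (snoc nil m₀)) := by simp [val]
  have hval : ∀ σ, σ ≠ nil → (val σ ↔ Meets k (graph g) (PosForce k W σ)) := by
    intro σ h
    simp [val, h]
  have hlastnil : ∀ a, ¬ IsLast (nil : M.Num) a := by
    intro a ha
    obtain ⟨_, l, hl, _⟩ := isLast_iff.1 ha
    rw [len_nil] at hl
    exact hM.out.basic.succ_ne_zero l hl.symm
  have hne : ∀ {σ a : M.Num}, IsLast σ a → σ ≠ nil := by
    rintro σ a h rfl
    exact hlastnil a h
  have hvr : Rec val := by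
    have h1 : Rec (fun σ => Meets k (graph g) (PosForce k W σ)) := by
      have h2 := rec_posForce (k := k) hW.isRec (f := fun z => fst z) (g := fun z => snd z)
        (by fun_prop) (by fun_prop)
      have h3 : Rec (fun z : M.Num => PrecFun (snd z) (graph g)) := by
        simp only [precFun_graph]
        fun_prop
      exact rec_exists (P := fun σ s => s ∈ M.FinPartition k ∧ PrecFun s (graph g) ∧
        PosForce k W σ s) (Rec.and (by fun_prop) (h3.and h2))
    exact Rec.or (Rec.and (by fun_prop) (rec_const _)) (Rec.and (by fun_prop) h1)
  let f : Set M.Num := {z | IsPair z ∧ fst z ∈ B ∧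
    ((snd z = 1 ∧ val (fst z)) ∨ (snd z = 0 ∧ ¬ val (fst z)))}
  have hf1 : ∀ σ, pair σ 1 ∈ f ↔ σ ∈ B ∧ val σ := by
    intro σ
    simp [f, isPair_pair]
  have hf0 : ∀ σ, pair σ 0 ∈ f ↔ σ ∈ B ∧ ¬ val σ := by
    intro σ
    simp [f, isPair_pair]
  have hleaf : ∀ {σ a}, IsLast σ a → (LeafHolds (graph t) (graph g) a ↔ a = 1 ∨ ∃ m,
      (a = 2 * m + 2 ∧ PrecFun (t m) (graph g)) ∨ (a = 2 * m + 3 ∧ ¬ PrecFun (t m) (graph g))) := by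
    intro σ a _
    simp [LeafHolds, num_eq_cast, pair_mem_graph_iff]
  refine ⟨f, ⟨?_, ⟨?_, ?_⟩, ?_, ?_, ?_, ?_⟩, ?_, ?_⟩
  · have : Rec (fun z => IsPair z ∧ fst z ∈ B ∧
      ((snd z = 1 ∧ val (fst z)) ∨ (snd z = 0 ∧ ¬ val (fst z)))) := by
      fun_prop (disch := assumption)
    exact this
  · rintro z ⟨h1, h2, h3⟩
    refine ⟨fst z, h2, snd z, ?_, (pair_fst_snd h1).symm⟩
    rcases h3 with h3 | h3
    · exact Or.inr h3.1
    · exact Or.inl h3.1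
  · intro σ hσ
    by_cases h : val σ
    · refine ⟨1, (hf1 σ).2 ⟨hσ, h⟩, ?_⟩
      rintro b ⟨-, -, h1⟩
      simpa [h] using h1
    · refine ⟨0, (hf0 σ).2 ⟨hσ, h⟩, ?_⟩
      rintro b ⟨-, -, h1⟩
      simpa [h] using h1
  · intro σ a hl ha
    rw [hf1, hval σ (hne ha), hleaf ha, meets_posForce,
      hW.meets_negForce_iff hl.1 (hgen σ hl.1), hW.meets_leaf hB.tree ht hl]
    have hl1 := hl.1
    have huniq : ∀ b, IsLast σ b ↔ b = a := fun b => ⟨fun h => h.unique ha, fun h => h ▸ ha⟩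
    simp only [huniq, hl1, true_and]
    have e2 : ∀ m : M.Num, 2 * m + 2 = 2 * (m + 1) + 0 := fun m => by ring
    have e3 : ∀ m : M.Num, 2 * m + 3 = 2 * (m + 1) + 1 := fun m => by ring
    have inj0 : ∀ {m q : M.Num}, 2 * m + 2 = 2 * q + 1 → False := fun h => by
      rw [e2] at h
      exact zero_ne_one (two_mul_add_inj two_pos one_lt_two' h).2
    obtain ⟨q, rfl | rfl⟩ := exists_half a
    · have hev := ha.evenLast
      simp only [hev, true_and, not_true, false_and, or_false]
      constructor
      · rintro ⟨m, h1 | h1, h2⟩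
        · exact Or.inr ⟨m, Or.inl ⟨h1.symm, h2⟩⟩
        · rw [e3, ← add_zero (2 * q)] at h1
          exact absurd (two_mul_add_inj one_lt_two' two_pos h1).2 one_ne_zero
      · rintro (h1 | ⟨m, ⟨h1, h2⟩ | ⟨h1, h2⟩⟩)
        · have h2 : 2 * q + 0 = 2 * 0 + 1 := by rw [h1]; ring
          exact absurd (two_mul_add_inj two_pos one_lt_two' h2).2 zero_ne_one
        · exact ⟨m, Or.inl h1.symm, h2⟩
        · rw [e3, ← add_zero (2 * q)] at h1
          exact absurd (two_mul_add_inj two_pos one_lt_two' h1).2 zero_ne_one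
    · have hev := ha.not_evenLast
      simp only [hev, false_and, not_false_eq_true, true_and, false_or]
      constructor
      · intro h
        push Not at h
        rcases eq_zero_or_exists_add_one q with rfl | ⟨m, rfl⟩
        · exact Or.inl (by ring)
        · exact Or.inr ⟨m, Or.inr ⟨(e3 m).symm, h m (Or.inr (e3 m))⟩⟩
      · rintro h ⟨m, h1 | h1, h2⟩
        · exact inj0 h1
        · rcases h with h | ⟨m', ⟨h3, _⟩ | ⟨h3, h4⟩⟩
          · have h3 : 2 * (m + 1) + 1 = 2 * 0 + 1 := by rw [← e3, h1, h]; ring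
            exact hM.out.basic.succ_ne_zero m (two_mul_add_inj one_lt_two' one_lt_two' h3).1
          · exact inj0 h3.symm
          · have h5 : 2 * (m + 1) + 1 = 2 * (m' + 1) + 1 := by rw [← e3, ← e3, h1, h3]
            have h6 := add_right_cancel (two_mul_add_inj one_lt_two' one_lt_two' h5).1
            exact h4 (h6 ▸ h2)
  · rintro σ a hσ hl ha ⟨c, rfl⟩
    have hev : EvenLast σ := IsLast.evenLast (c := c) (by simpa [num_eq_cast] using ha)
    rw [hf1, hval σ (hne ha), meets_posForce, hW.meets_node hσ hl]
    simp only [hσ, hev, true_and, not_true, false_and, or_false]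
    constructor
    · rintro ⟨m, h1, h2⟩
      exact ⟨m, _, h1, isSnoc_iff.2 ⟨hseq σ hσ, rfl⟩, (hf1 _).2 ⟨h1, (hval _ (hsnoc _ _)).2 h2⟩⟩
    · rintro ⟨m, σ', h1, h2, h3⟩
      obtain ⟨-, rfl⟩ := isSnoc_iff.1 h2
      exact ⟨m, h1, (hval _ (hsnoc _ _)).1 ((hf1 _).1 h3).2⟩
  · rintro σ a hσ hl ha ⟨c, rfl⟩
    have hev : ¬ EvenLast σ := IsLast.not_evenLast (c := c) (by simpa [num_eq_cast] using ha)
    rw [hf1, hval σ (hne ha), meets_posForce, hW.meets_negForce_iff hσ (hgen σ hσ),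
      hW.meets_node hσ hl]
    simp only [hσ, hev, true_and, false_and, false_or, not_false_eq_true]
    push Not
    constructor
    · intro h m σ' h1 h2
      obtain ⟨-, rfl⟩ := isSnoc_iff.1 h2
      refine (hf1 _).2 ⟨h1, (hval _ (hsnoc _ _)).2 ?_⟩
      have h3 := h m h1
      rwa [hW.meets_coForce_iff h1 (hgen _ h1), not_not] at h3
    · intro h m h1
      rw [hW.meets_coForce_iff h1 (hgen _ h1), not_not]
      exact (hval _ (hsnoc _ _)).1 ((hf1 _).1 (h m _ h1 (isSnoc_iff.2 ⟨hseq σ hσ, rfl⟩))).2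
  · intro σ ρ m hσ hρ hm
    obtain ⟨h1, h2⟩ := isSeqLen_iff.1 hσ
    obtain rfl := eq_nil h1 h2
    have hm' := isSingleton_iff.1 hm
    subst hm'
    obtain ⟨m', _, hu⟩ := hB.root
    have h3 : m = m₀ := (hu m ⟨_, hρ, hm⟩).trans
      (hu m₀ ⟨_, hm₀, isSingleton_iff.2 rfl⟩).symm
    rw [hf1, hf1, hvaln, hval _ (hsnoc _ _), h3]
    simp [hnil, hm₀]
  · rw [hf1, hvaln]
    simp [hnil]
  · rw [hf0, hvaln]
    simp [hnil]

/-- The code of the open set of the conditions in a set of the model. -/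
def openCode (k : ℕ) (Φ : M.Num → Prop) : Set M.Num :=
  {z | IsPair z ∧ fst z = 0 ∧ snd z ∈ M.FinPartition k ∧ Φ (snd z)}

omit hex in
theorem isOpenCode_openCode {Φ : M.Num → Prop} (hΦ : Rec Φ) : M.IsOpenCode k (openCode k Φ) := by
  refine ⟨?_, fun z hz => ⟨fst z, snd z, hz.2.2.1, (pair_fst_snd hz.1).symm⟩⟩
  have : Rec (fun z => IsPair z ∧ fst z = 0 ∧ snd z ∈ M.FinPartition k ∧ Φ (snd z)) := by
    fun_prop
  exact this

omit hex in
theorem pair_mem_openCode {Φ : M.Num → Prop} {n s : M.Num} :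
    pair n s ∈ openCode k Φ ↔ n = 0 ∧ s ∈ M.FinPartition k ∧ Φ s := by
  simp [openCode, isPair_pair]

omit hex in
theorem memOpen_openCode {Φ : M.Num → Prop} {x : Set M.Num} :
    MemOpen x (openCode k Φ) ↔ Meets k x Φ := by
  constructor
  · rintro ⟨n, s, h1, h2⟩
    rw [pair_mem_openCode] at h1
    exact ⟨s, h1.2.1, h2, h1.2.2⟩
  · rintro ⟨s, h1, h2, h3⟩
    exact ⟨0, s, pair_mem_openCode.2 ⟨rfl, h1, h3⟩, h2⟩

omit hex in
theorem exists_decided (σ : M.Num) {s : M.Num} (hs : s ∈ M.FinPartition k) :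
    ∃ r ∈ M.FinPartition k, InitSeg s r ∧ (W σ r ∨ NegForce k W σ r) := by
  have hseq := isSeq_of_mem_finPartition hs
  by_cases h : NegForce k W σ s
  · exact ⟨s, hs, initSeg_iff.2 ⟨hseq, hseq, Sub.refl s⟩, Or.inr h⟩
  · unfold NegForce at h
    push Not at h
    obtain ⟨r, ⟨h1, h2⟩, h3⟩ := h
    exact ⟨r, h1, initSeg_iff.2 ⟨hseq, isSeq_of_mem_finPartition h1, h2⟩, Or.inl h3⟩

theorem baireCode_of_atr0 (hATR : M.ATR0) {τ : Set M.Num} (hτ : M.IsEnumeration k τ) :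
    M.BorelCodesHaveBaireCode k τ := by
  intro B hB
  have hBs := hB.mem_sets
  obtain ⟨t, ht, rfl, htP⟩ := exists_recF_of_isFun hτ.1 hτ.2.1
  obtain ⟨W, hW⟩ := exists_isForcing hATR k ht hB
  obtain ⟨m₀, ⟨ρ, hρ, hm₀⟩, -⟩ := hB.root
  obtain rfl := isSingleton_iff.1 hm₀
  have hslice : ∀ σ, openSlice {z | IsPair z ∧ snd z ∈ openCode k fun s =>
      W (fst z) s ∨ NegForce k W (fst z) s} σ = openCode k fun s => W σ s ∨ NegForce k W σ s := by
    intro σ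
    ext z
    constructor
    · rintro ⟨n, s, rfl, -, h⟩
      simpa using h
    · intro h
      obtain ⟨n, s, rfl⟩ := h.1
      exact ⟨n, s, rfl, isPair_pair _ _, by simpa using h⟩
  refine ⟨openCode k (PosForce k W (snoc nil m₀)), openCode k (CoForce k W (snoc nil m₀)),
    {z | IsPair z ∧ snd z ∈ openCode k fun s => W (fst z) s ∨ NegForce k W (fst z) s},
    isOpenCode_openCode (rec_posForce hW.isRec (RecF.const _) RecF.id),
    isOpenCode_openCode (rec_coForce hW.isRec (RecF.const _) RecF.id), ⟨?_, ?_⟩, ?_, ?_, ?_, ?_⟩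
  · have h1 := hW.isRec.comp₂ (f := fun z => fst z) (g := fun z => snd (snd z)) (by fun_prop)
      (by fun_prop)
    have h2 := rec_negForce (k := k) hW.isRec (f := fun z => fst z) (g := fun z => snd (snd z))
      (by fun_prop) (by fun_prop)
    have h3 : Rec (fun z : M.Num => IsPair z ∧ IsPair (snd z) ∧ fst (snd z) = 0 ∧
        snd (snd z) ∈ M.FinPartition k) := by fun_prop
    refine Rec.congr (h3.and (h1.or h2)) fun z => ?_
    change (_ ∧ _ ∧ _ ∧ _ ∧ _) ↔ _
    tauto
  · rintro z ⟨h1, h2⟩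
    exact ⟨fst z, fst (snd z), snd (snd z), h2.2.2.1, by
      rw [pair_fst_snd h2.1, pair_fst_snd h1]⟩
  · intro σ s hs
    rw [hslice]
    obtain ⟨r, h1, h2, h3⟩ := exists_decided (W := W) σ hs
    exact ⟨0, r, pair_mem_openCode.2 ⟨rfl, h1, h3⟩, Or.inr h2⟩
  · intro s hs
    obtain ⟨r, h1, h2, h3⟩ := exists_decided (W := W) (snoc nil m₀) hs
    refine ⟨0, r, ?_, Or.inr h2⟩
    rw [Set.mem_union, pair_mem_openCode, pair_mem_openCode]
    unfold PosForce CoForce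
    tauto
  all_goals
    intro x hx hxD hxU
    obtain ⟨g, hg, rfl, -⟩ := mem_partition.1 hx
    have hgen : ∀ σ ∈ B, Meets k (graph g) (W σ) ∨ Meets k (graph g) (NegForce k W σ) := by
      intro σ _
      have h1 := hxD σ
      rw [hslice, memOpen_openCode] at h1
      exact meets_or.1 h1
    obtain ⟨f, hf, h1, h0⟩ := hW.exists_isEvaluation hB htP hg hρ hgen
    rw [memOpen_openCode] at hxU
  · exact ⟨f, hf, nil, isSeqLen_iff.2 ⟨isSeq_nil, len_nil⟩, h1.2 hxU⟩
  · exact ⟨f, hf, nil, isSeqLen_iff.2 ⟨isSeq_nil, len_nil⟩,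
      h0.2 ((hW.meets_coForce_iff hρ (hgen _ hρ)).1 hxU)⟩

end

end L2Structure

theorem mainTheorem2 (M : L2Structure.{u}) (hM : M.RCA0) (k : ℕ) (hk : 2 ≤ k) :
    (∃ τ, M.IsEnumeration k τ) ∧
      ∀ τ, M.IsEnumeration k τ →
        List.TFAE [M.ATR0, M.BorelCodesHaveEvaluatedPoint k τ, M.BorelCodesHaveBaireCode k τ] := by
  have : Fact M.RCA0 := ⟨hM⟩
  refine ⟨L2Structure.exists_isEnumeration k, fun τ hτ => ?_⟩
  tfae_have 1 → 3 := fun h =>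
    have : Fact (L2Structure.ClosedUnderExists M) := ⟨h.aca0.closedUnderExists⟩
    L2Structure.baireCode_of_atr0 h hτ
  tfae_have 3 → 2 := L2Structure.evaluated_of_baireCode (by omega)
  tfae_have 2 → 1 := L2Structure.atr0_of_evaluated
  tfae_finish
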